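/- Let $H_{\mathbf R}$ be an infinite-dimensional real Hilbert space and let $(U_t)_{t\in\mathbf R}$ be a strongly continuous one-parameter group of orthogonal transformations of $H_{\mathbf R}$. Let $H=H_{\mathbf R}\otimes_{\mathbf R}\mathbf C$ be the complexification, let $A$ be the infinitesimal generator of the complex linear extension of $(U_t)$ to $H$ (the nonsingular positive self-adjoint operator with $U_t=A^{it}$), let $j:H_{\mathbf R}\to H$, $j(\zeta)=\bigl(\tfrac{2}{A^{-1}+1}\bigr)^{1/2}\zeta$, and put $K_{\mathbf R}=j(H_{\mathbf R})$. On the full Fock space $\mathcal F(H)=\mathbf C\Omega\oplus\bigoplus_{n\ge 1}H^{\otimes n}$ let $\ell(\xi)$ be the left creation operator, given by $\ell(\xi)\Omega=\xi$ and $\ell(\xi)(\xi_1\otimes\cdots\otimes\xi_n)=\xi\otimes\xi_1\otimes\cdots\otimes\xi_n$, let $s(\xi)=\tfrac12(\ell(\xi)+\ell(\xi)^*)$, and let $\Gamma(H_{\mathbf R},U_t)\subset\mathbf B(\mathcal F(H))$ be the unital $C^*$-algebra generated by $\{s(\xi):\xi\in K_{\mathbf R}\}$. For $e_1,\dots,e_n\in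 K_{\mathbf R}+iK_{\mathbf R}$ let $W(e_1\otimes\cdots\otimes e_n)$ denote the element $x$ of $\Gamma(H_{\mathbf R},U_t)$ with $x\Omega=e_1\otimes\cdots\otimes e_n$ (for $n=0$: $x\Omega=\Omega$). Then for every $d\in\mathbf N$ there is exactly one bounded linear map $P_d:\Gamma(H_{\mathbf R},U_t)\to\Gamma(H_{\mathbf R},U_t)$ (the projection onto words of length at most $d$) such that, for all $n\ge 0$ and all $e_1,\dots,e_n\in K_{\mathbf R}+iK_{\mathbf R}$, $$P_d\bigl(W(e_1\otimes\cdots\otimes e_n)\bigr)=\begin{cases}W(e_1\otimes\cdots\otimes e_n)&\text{if } n\le d,\\ 0&\text{if } n>d.\end{cases}$$ The map $P_d$ is completely bounded, and its completely bounded norm $\|P_d\|_{\mathrm{cb}}=\sup_{m\ge1}\|\mathrm{id}_{M_m(\mathbf C)}\otimes P_d\|$ satisfies $$\|P_d\|_{\mathrm{cb}}\;\sim\;\frac4\pi\,d\qquad(d\to\infty),$$ that is, $\|P_d\|_{\mathrm{cb}}/d\to 4/\pi$. -/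

import Mathlib

open scoped InnerProductSpace TensorProduct ENNReal Asymptotics
open Filter

universe u

set_option linter.unusedSectionVars false

namespace FreeArakiWoods

noncomputable section

/-! ### Complexification of a real Hilbert space -/

/-- The complexification `E ⊗_ℝ ℂ` of a real Hilbert space `E`: the pair `(x, y)` stands for
`x + i y`, and the norm is `‖x + i y‖ ^ 2 = ‖x‖ ^ 2 + ‖y‖ ^ 2`. -/
def Complexification (E : Type u) : Type u := WithLp 2 (E × E)

section Complexification

variable {E : Type u} [NormedAddCommGroup E] [InnerProductSpace ℝ E]

namespace Complexification

instance : NormedAddCommGroup (Complexification E) :=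
  inferInstanceAs (NormedAddCommGroup (WithLp 2 (E × E)))

instance [CompleteSpace E] : CompleteSpace (Complexification E) :=
  inferInstanceAs (CompleteSpace (WithLp 2 (E × E)))

/-- The vector `x + i y`. -/
def mk (x y : E) : Complexification E := WithLp.toLp 2 (x, y)

/-- The real part of a vector. -/
def re (z : Complexification E) : E := (WithLp.ofLp z).1

/-- The imaginary part of a vector. -/
def im (z : Complexification E) : E := (WithLp.ofLp z).2

@[simp] theorem re_mk (x y : E) : re (mk x y) = x := rfl

@[simp] theorem im_mk (x y : E) : im (mk x y) = y := rfl

@[simp] theorem re_add (z w : Complexification E) : re (z + w) = re z + re w := rfl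

@[simp] theorem im_add (z w : Complexification E) : im (z + w) = im z + im w := rfl

@[simp] theorem re_zero : re (0 : Complexification E) = 0 := rfl

@[simp] theorem im_zero : im (0 : Complexification E) = 0 := rfl

theorem ext {z w : Complexification E} (h₁ : re z = re w) (h₂ : im z = im w) : z = w :=
  WithLp.ofLp_injective 2 (Prod.ext h₁ h₂)

theorem norm_sq (z : Complexification E) : ‖z‖ ^ 2 = ‖re z‖ ^ 2 + ‖im z‖ ^ 2 :=
  WithLp.prod_norm_sq_eq_of_L2 (show WithLp 2 (E × E) from z)

instance : SMul ℂ (Complexification E) :=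
  ⟨fun c z => mk (c.re • re z - c.im • im z) (c.im • re z + c.re • im z)⟩

@[simp] theorem re_smul (c : ℂ) (z : Complexification E) :
    re (c • z) = c.re • re z - c.im • im z := rfl

@[simp] theorem im_smul (c : ℂ) (z : Complexification E) :
    im (c • z) = c.im • re z + c.re • im z := rfl

instance : Module ℂ (Complexification E) where
  one_smul z := by apply ext <;> simp
  mul_smul a b z := by
    apply ext
    · simp only [re_smul, im_smul, Complex.mul_re, Complex.mul_im]; module
    · simp only [re_smul, im_smul, Complex.mul_re, Complex.mul_im]; module
  smul_zero a := by apply ext <;> simp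
  smul_add a z w := by
    apply ext
    · simp only [re_smul, re_add, im_add]; module
    · simp only [im_smul, re_add, im_add]; module
  add_smul a b z := by
    apply ext
    · simp only [re_smul, re_add, Complex.add_re, Complex.add_im]; module
    · simp only [im_smul, im_add, Complex.add_re, Complex.add_im]; module
  zero_smul z := by apply ext <;> simp

/-- The inner product extends the one of `E` sesquilinearly (linear in the second variable). -/
instance : InnerProductSpace ℂ (Complexification E) where
  inner z w := ⟨⟪re z, re w⟫_ℝ + ⟪im z, im w⟫_ℝ, ⟪re z, im w⟫_ℝ - ⟪im z, re w⟫_ℝ⟩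
  norm_smul_le c z := by
    have h : ‖c • z‖ ^ 2 = (‖c‖ * ‖z‖) ^ 2 := by
      rw [mul_pow, norm_sq, norm_sq, re_smul, im_smul, norm_sub_sq_real, norm_add_sq_real,
        Complex.sq_norm, Complex.normSq_apply]
      simp only [norm_smul, mul_pow, real_inner_smul_left, real_inner_smul_right, Real.norm_eq_abs,
        sq_abs, real_inner_comm (im z) (re z)]
      ring
    exact le_of_eq ((sq_eq_sq₀ (norm_nonneg _) (by positivity)).1 h)
  norm_sq_eq_re_inner z := by
    rw [norm_sq]
    simp
  conj_inner_symm z w := by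
    apply Complex.ext
    · simp [real_inner_comm]
    · simp [real_inner_comm]
  add_left z w v := by
    apply Complex.ext
    · simp [inner_add_left]; ring
    · simp [inner_add_left]; ring
  smul_left z w c := by
    apply Complex.ext
    · simp [inner_add_left, inner_sub_left, real_inner_smul_left]; ring
    · simp [inner_add_left, inner_sub_left, real_inner_smul_left]; ring

/-- The canonical inclusion of `E` in its complexification. -/
def ofReal (x : E) : Complexification E := mk x 0

end Complexification

/-! ### Orthogonal groups and the real subspace `K_ℝ` -/

/-- A strongly continuous one-parameter group of orthogonal transformations of `E`. -/
structure OrthogonalGroup (E : Type u) [NormedAddCommGroup E] [InnerProductSpace ℝ E] where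
  /-- The transformation `U_t`. -/
  toFun : ℝ → (E ≃ₗᵢ[ℝ] E)
  map_add : ∀ (s t : ℝ) (x : E), toFun (s + t) x = toFun s (toFun t x)
  continuous_apply : ∀ x : E, Continuous fun t => toFun t x

namespace OrthogonalGroup

open Complexification (re im ofReal)

/-- The complex linear extension of `U_t` to the complexification. -/
def complexified (U : OrthogonalGroup E) (t : ℝ) (z : Complexification E) : Complexification E :=
  Complexification.mk (U.toFun t (re z)) (U.toFun t (im z))

/-- The graph of the infinitesimal generator of `(U_t)`, i.e. of the nonsingular positive
self-adjoint operator `A` such that `U_t = A ^ (i t)`: a vector `x` is in the domain of `A` and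
`A x = y` if and only if the orbit `t ↦ U_t x = A ^ (i t) x` extends to a continuous function on
the strip `-1 ≤ Im z ≤ 0` which is holomorphic in the interior and has the value `y` at the point
`-i` (where `A ^ (i z) = A`). -/
def generatorGraph (U : OrthogonalGroup E) : Set (Complexification E × Complexification E) :=
  {p | ∃ F : ℂ → Complexification E,
    ContinuousOn F {z : ℂ | -1 ≤ z.im ∧ z.im ≤ 0} ∧
    DifferentiableOn ℂ F {z : ℂ | -1 < z.im ∧ z.im < 0} ∧
    (∀ t : ℝ, F (t : ℂ) = U.complexified t p.1) ∧
    F (-Complex.I) = p.2}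

/-- `S` is the operator `(2 / (A⁻¹ + 1)) ^ (1/2)`, where `A` is the infinitesimal generator: `S` is
a bounded positive operator, and for every `x` the vector `u = S² x` is in the domain of `A⁻¹`
with `A⁻¹ u + u = 2 x`, i.e. `A (2 x - u) = u`. There is exactly one such `S`. -/
def IsEmbeddingOperator (U : OrthogonalGroup E) [CompleteSpace E]
    (S : Complexification E →L[ℂ] Complexification E) : Prop :=
  S.IsPositive ∧
    ∀ x : Complexification E, ((2 : ℂ) • x - S (S x), S (S x)) ∈ U.generatorGraph

/-- The operator `(2 / (A⁻¹ + 1)) ^ (1/2)`. -/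
def embeddingOperator (U : OrthogonalGroup E) [CompleteSpace E] :
    Complexification E →L[ℂ] Complexification E :=
  Classical.epsilon U.IsEmbeddingOperator

/-- The isometric embedding `j ζ = (2 / (A⁻¹ + 1)) ^ (1/2) ζ` of `E` in its complexification. -/
def j (U : OrthogonalGroup E) [CompleteSpace E] (ζ : E) : Complexification E :=
  U.embeddingOperator (ofReal ζ)

/-- The real subspace `K_ℝ = j(E)`. -/
def realSubspace (U : OrthogonalGroup E) [CompleteSpace E] : Set (Complexification E) :=
  Set.range U.j

/-- The complex subspace `K_ℝ + i K_ℝ`. -/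
def complexSubspace (U : OrthogonalGroup E) [CompleteSpace E] : Set (Complexification E) :=
  {ζ | ∃ ξ ∈ U.realSubspace, ∃ η ∈ U.realSubspace, ζ = ξ + Complex.I • η}

end OrthogonalGroup

end Complexification

/-! ### The full Fock space -/

/-- A bundled complex Hilbert space. -/
structure HilbertSpace : Type (u + 1) where
  /-- The underlying type. -/
  carrier : Type u
  [normed : NormedAddCommGroup carrier]
  [inner : InnerProductSpace ℂ carrier]
  [complete : CompleteSpace carrier]

attribute [instance] HilbertSpace.normed HilbertSpace.inner HilbertSpace.complete

section Fock

variable (H : Type u) [NormedAddCommGroup H] [InnerProductSpace ℂ H]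

/-- The Hilbert space tensor powers: the one-dimensional space `ℂ` for `n = 0`, and the completion
of `H ⊗ H^{⊗ n}` for `n + 1`. -/
def tensorPower : ℕ → HilbertSpace.{u}
  | 0 => ⟨EuclideanSpace ℂ PUnit.{u + 1}⟩
  | n + 1 => ⟨UniformSpace.Completion (H ⊗[ℂ] (tensorPower n).carrier)⟩

/-- The full Fock space `⨁ₙ H^{⊗ n}` (Hilbert space direct sum). -/
abbrev FockSpace : Type u := lp (fun n => (tensorPower H n).carrier) 2

/-- The unit vector `1` of `H^{⊗ 0} = ℂ`. -/
def tensorUnit : (tensorPower H 0).carrier :=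
  (EuclideanSpace.single PUnit.unit (1 : ℂ) : EuclideanSpace ℂ PUnit.{u + 1})

/-- The vacuum vector `Ω`. -/
def vacuum : FockSpace H := lp.single 2 0 (tensorUnit H)

variable {H}

/-- The map `x ↦ ξ ⊗ x` from `H^{⊗ n}` to `H^{⊗ (n + 1)}`. -/
def tensorLeft (ξ : H) (n : ℕ) :
    (tensorPower H n).carrier →L[ℂ] (tensorPower H (n + 1)).carrier :=
  (UniformSpace.Completion.toComplL (𝕜 := ℂ) (E := H ⊗[ℂ] (tensorPower H n).carrier)).comp
    (TensorProduct.mkL ℂ H (tensorPower H n).carrier ξ)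

theorem norm_tensorLeft (ξ : H) (n : ℕ) (x : (tensorPower H n).carrier) :
    ‖tensorLeft ξ n x‖ = ‖ξ‖ * ‖x‖ :=
  (UniformSpace.Completion.norm_coe (ξ ⊗ₜ[ℂ] x)).trans (TensorProduct.norm_tmul ξ x)

/-- The components of `ξ ⊗ f`. -/
def creationFun (ξ : H) (f : ∀ n, (tensorPower H n).carrier) :
    ∀ n, (tensorPower H n).carrier
  | 0 => 0
  | n + 1 => tensorLeft ξ n (f n)

theorem hasSum_creationFun (ξ : H) (f : FockSpace H) :
    HasSum (fun n => ‖creationFun ξ f n‖ ^ 2) ((‖ξ‖ * ‖f‖) ^ 2) := by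
  have h : HasSum (fun n => ‖f n‖ ^ 2) (‖f‖ ^ 2) := by
    have := lp.hasSum_norm (p := 2) (by norm_num) f
    simpa using this
  have h2 : HasSum (fun n => ‖creationFun ξ f (n + 1)‖ ^ 2) (‖ξ‖ ^ 2 * ‖f‖ ^ 2) := by
    have h3 := h.mul_left (‖ξ‖ ^ 2)
    refine h3.congr_fun ?_
    intro n
    rw [creationFun, norm_tensorLeft, mul_pow]
  have h4 := (hasSum_nat_add_iff (f := fun n => ‖creationFun ξ f n‖ ^ 2) 1).1 h2
  simpa [creationFun, mul_pow] using h4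

theorem memℓp_creationFun (ξ : H) (f : FockSpace H) : Memℓp (creationFun ξ f) 2 := by
  apply memℓp_gen
  simpa using (hasSum_creationFun ξ f).summable

/-- The left creation operator `ℓ(ξ)`: `ℓ(ξ) Ω = ξ` and
`ℓ(ξ) (ξ₁ ⊗ ⋯ ⊗ ξₙ) = ξ ⊗ ξ₁ ⊗ ⋯ ⊗ ξₙ`. -/
def creation (ξ : H) : FockSpace H →L[ℂ] FockSpace H :=
  LinearMap.mkContinuous
    { toFun := fun f => ⟨creationFun ξ f, memℓp_creationFun ξ f⟩
      map_add' := by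
        intro f g
        ext n
        cases n with
        | zero => exact (add_zero (0 : (tensorPower H 0).carrier)).symm
        | succ n => exact (tensorLeft ξ n).map_add (f n) (g n)
      map_smul' := by
        intro c f
        ext n
        cases n with
        | zero => exact (smul_zero (A := (tensorPower H 0).carrier) c).symm
        | succ n => exact (tensorLeft ξ n).map_smul c (f n) }
    ‖ξ‖ (by
      intro f
      have h := lp.hasSum_norm (p := 2) (by norm_num)
        (⟨creationFun ξ f, memℓp_creationFun ξ f⟩ : FockSpace H)
      have h2 : HasSum (fun n => ‖creationFun ξ f n‖ ^ 2)
          (‖(⟨creationFun ξ f, memℓp_creationFun ξ f⟩ : FockSpace H)‖ ^ 2) := by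
        simpa using h
      have h3 := h2.unique (hasSum_creationFun ξ f)
      exact le_of_eq ((sq_eq_sq₀ (norm_nonneg _) (by positivity)).1 h3))

/-- The elementary tensor `e₁ ⊗ ⋯ ⊗ eₙ` in the Fock space (`Ω` for the empty list). -/
def elementaryTensor : List H → FockSpace H
  | [] => vacuum H
  | ξ :: l => creation ξ (elementaryTensor l)

/-- The operator `s(ξ) = (ℓ(ξ) + ℓ(ξ)^*) / 2`. -/
def realPart (ξ : H) : FockSpace H →L[ℂ] FockSpace H :=
  (1 / 2 : ℂ) • (creation ξ + star (creation ξ))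

end Fock

/-! ### Completely bounded norms -/

section CB

variable {F : Type u} [NormedAddCommGroup F] [InnerProductSpace ℂ F] [CompleteSpace F]

/-- The operator on the Hilbert space `F ⊕ ⋯ ⊕ F` given by a square matrix of operators on `F`. -/
def matrixOperator {n : ℕ} (X : Matrix (Fin n) (Fin n) (F →L[ℂ] F)) :
    PiLp 2 (fun _ : Fin n => F) →L[ℂ] PiLp 2 (fun _ : Fin n => F) :=
  ((PiLp.continuousLinearEquiv 2 ℂ (fun _ : Fin n => F)).symm :
      (Fin n → F) →L[ℂ] PiLp 2 (fun _ : Fin n => F)).comp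
    (ContinuousLinearMap.pi fun i => ∑ k, (X i k).comp (PiLp.proj 2 (fun _ : Fin n => F) k))

/-- The completely bounded norm `sup_n ‖id ⊗ Φ : M_n(A) → M_n(A)‖` (possibly infinite) of a map
`Φ` of a concrete operator algebra `A ⊆ B(F)` to itself, where `M_n(A) ⊆ B(F ⊕ ⋯ ⊕ F)`. -/
def cbNorm {A : StarSubalgebra ℂ (F →L[ℂ] F)} (Φ : A →L[ℂ] A) : ℝ≥0∞ :=
  ⨆ (n : ℕ) (X : Matrix (Fin n) (Fin n) A)
    (_ : ‖matrixOperator (X.map fun x => (x : F →L[ℂ] F))‖ ≤ 1),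
    ‖matrixOperator (X.map fun x => ((Φ x : A) : F →L[ℂ] F))‖ₑ

end CB

/-! ### Free Araki-Woods algebras and radial multipliers -/

section ArakiWoods

variable {E : Type u} [NormedAddCommGroup E] [InnerProductSpace ℝ E] [CompleteSpace E]

/-- The free Araki-Woods C⋆-algebra `Γ(E, U)`, generated by the `s(ξ)`, `ξ ∈ K_ℝ`. -/
def ArakiWoodsAlgebra (U : OrthogonalGroup E) :
    StarSubalgebra ℂ (FockSpace (Complexification E) →L[ℂ] FockSpace (Complexification E)) :=
  (StarAlgebra.adjoin ℂ (realPart '' U.realSubspace)).topologicalClosure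

/-- `x = W(e₁ ⊗ ⋯ ⊗ eₙ)`, i.e. `x Ω = e₁ ⊗ ⋯ ⊗ eₙ`. -/
def IsWickWord (U : OrthogonalGroup E) (e : List (Complexification E)) (x : ArakiWoodsAlgebra U) : Prop :=
  (x : FockSpace (Complexification E) →L[ℂ] FockSpace (Complexification E))
    (vacuum (Complexification E)) = elementaryTensor e

/-- `Φ` is the bounded extension to `Γ(E, U)` of the radial multiplier
`W(e₁ ⊗ ⋯ ⊗ eₙ) ↦ φ(n) W(e₁ ⊗ ⋯ ⊗ eₙ)`, where `e₁, …, eₙ ∈ K_ℝ + i K_ℝ`. -/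
def IsRadialMultiplier (U : OrthogonalGroup E) (φ : ℕ → ℂ) (Φ : ArakiWoodsAlgebra U →L[ℂ] ArakiWoodsAlgebra U) : Prop :=
  ∀ e : List (Complexification E), (∀ v ∈ e, v ∈ U.complexSubspace) →
    ∀ x : ArakiWoodsAlgebra U, IsWickWord U e x → Φ x = φ e.length • x

/-- `Φ` is the projection onto words of length at most `d`. -/
def IsWordProjection (U : OrthogonalGroup E) (d : ℕ) (Φ : ArakiWoodsAlgebra U →L[ℂ] ArakiWoodsAlgebra U) : Prop :=
  IsRadialMultiplier U (fun n => if n ≤ d then 1 else 0) Φ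

end ArakiWoods

end

end FreeArakiWoods

/-! The completely bounded norm is computed exactly. Let φ be the indicator of {0, …, d} and h(t,t')
= φ(t+t') − φ(t+t'+2), the Hankel matrix which is 1 on the antidiagonals t+t' = d and t+t' = d−1 and
0 elsewhere. Then ‖P_d‖_cb is the trace norm of h. The eigenvectors of h are discrete sine vectors
with eigenvalues (−1)^s 2cos(π(s+1)/(2d+3)) (`hankel_eigen`), so its trace norm is 1/sin(π/(4d+6)) −
1 (`hankelNorm_eq`), which is equivalent to 4d/π.

Upper bound. A Wick word of length n is a sum of products of k creation operators, followed on the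
right by n−k annihilation operators. It therefore suffices to find a map on all bounded operators of
the Fock space that multiplies a product with k creators and l annihilators by φ(k+l). Cutting words
after t letters gives isometries V_t with mutually orthogonal ranges such that (ℓ(ξ)*⊗1)V_{t+1} =
V_t ℓ(ξ)* and (ℓ(ξ)*⊗1)V_0 = 0. Hence a ↦ V_t*(a⊗1)V_{t'} fixes such a product if t−k = t'−l ≥ 0 and
kills it otherwise (`compress_word`), and the sum with weights h(t,t') telescopes to φ(k+l).
Diagonalizing h turns this sum into Σ λ_s W_s*(·⊗1)W_s with contractions W_s, so the norm is at most
Σ|λ_s| (`norm_truncation_le`).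

Lower bound. Since the space is infinite dimensional, there are arbitrarily many vectors of K_ℝ
which are orthonormal in H. Arrange the corresponding n+1 creation operators, divided by √(n+1),
into an isometry L, and the annihilation operators into an operator G of norm at most 1/√(n+1).
Adding to L^k L*^l terms that contain G or G* gives operators Y_kl whose matrix entries are exactly
multiples of Wick words of length k+l (`exists_entry_wickGrid`). Let u be the unitary part of h.
Then Σ u_kl (Y_kl − Y_{k+1,l+1}) is close to Σ u_kl L^k(1−LL*)L*^l, which is a contraction
(`norm_sum_hankelSign_defect_le`). Applying P_d entrywise gives Σ u_kl (φ(k+l)Y_kl −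
φ(k+l+2)Y_{k+1,l+1}), and its quadratic form at a unit vector almost fixed by L* is close to Σ u_kl
h(k,l), the trace norm of h.

Two preliminaries make the objects meaningful. The generator A is known only through analytic
continuation of orbits, so the bounded operator 2A(1+A)⁻¹ has to be constructed
(`graphSum_bijective`). And a Wick word must be determined by its vacuum vector
(`eq_zero_of_vacuum`), which holds because enough right field operators commute with the algebra. -/

namespace FreeArakiWoods

noncomputable section

/-! ### Holomorphic functions on a strip -/

section Strip

/-- The closed strip `-1 ≤ Im z ≤ 0`. -/
def closedStrip : Set ℂ := {z : ℂ | -1 ≤ z.im ∧ z.im ≤ 0}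

/-- The open strip `-1 < Im z < 0`. -/
def openStrip : Set ℂ := {z : ℂ | -1 < z.im ∧ z.im < 0}

theorem openStrip_eq : openStrip = Complex.im ⁻¹' Set.Ioo (-1) 0 := rfl

theorem closedStrip_eq : closedStrip = Complex.im ⁻¹' Set.Icc (-1) 0 := rfl

theorem closure_openStrip : closure openStrip = closedStrip := by
  rw [openStrip_eq, Complex.closure_preimage_im, closure_Ioo (by norm_num), closedStrip_eq]

theorem isOpen_openStrip : IsOpen openStrip :=
  isOpen_Ioo.preimage Complex.continuous_im

theorem openStrip_subset : openStrip ⊆ closedStrip := fun _ hz => ⟨hz.1.le, hz.2.le⟩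

theorem isPreconnected_openStrip : IsPreconnected openStrip := by
  have : Convex ℝ openStrip := by
    rw [openStrip_eq]
    exact (convex_Ioo (-1 : ℝ) 0).linear_preimage Complex.imLm
  exact this.isPreconnected

/-- A holomorphic function vanishing on one side of a square vanishes at its centre. -/
theorem eq_zero_center {f : ℂ → ℂ} (hc : ContinuousOn f closedStrip)
    (hd : DifferentiableOn ℂ f openStrip) (h0 : ∀ t : ℝ, f t = 0) (c : ℝ) :
    f (c - Complex.I / 2) = 0 := by
  set z₀ : ℂ := c - Complex.I / 2 with hz₀
  have him : z₀.im = -1 / 2 := by simp [hz₀]; norm_num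
  set Q : Set ℂ := Set.Ioo (-1 / 2 : ℝ) (1 / 2) ×ℂ Set.Ioo (-1 / 2 : ℝ) (1 / 2) with hQ
  have hQc : closure Q = Set.Icc (-1 / 2 : ℝ) (1 / 2) ×ℂ Set.Icc (-1 / 2 : ℝ) (1 / 2) := by
    rw [hQ, Complex.closure_reProdIm, closure_Ioo (by norm_num)]
  have key : ∀ u : ℂ, (u = 1 ∨ u = -1 ∨ u = Complex.I ∨ u = -Complex.I) →
      DiffContOnCl ℂ (fun w => f (z₀ + u * w)) Q := by
    intro u hu
    constructor
    · refine hd.comp (by fun_prop) ?_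
      intro w hw
      rw [hQ, Complex.mem_reProdIm] at hw
      obtain ⟨⟨h1, h2⟩, h3, h4⟩ := hw
      rcases hu with rfl | rfl | rfl | rfl <;> constructor <;> simp [him] <;> linarith
    · refine hc.comp (by fun_prop) ?_
      intro w hw
      rw [hQc, Complex.mem_reProdIm] at hw
      obtain ⟨⟨h1, h2⟩, h3, h4⟩ := hw
      rcases hu with rfl | rfl | rfl | rfl <;> constructor <;> simp [him] <;> linarith
  have hzero : ∀ z : ℂ, z.im = 0 → f z = 0 := by
    intro z hz
    have : z = (z.re : ℂ) := by apply Complex.ext <;> simp [hz]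
    rw [this]; exact h0 _
  have hb : Bornology.IsBounded Q := (Metric.isBounded_Ioo _ _).reProdIm (Metric.isBounded_Ioo _ _)
  -- Maximum principle for the product of the four functions w ↦ f(z₀ + u w), u⁴ = 1. On each side
  -- of the square one of the four arguments is real, so the product vanishes on the frontier; at w
  -- = 0 it is f(z₀)⁴.
  have hG := Complex.norm_le_of_forall_mem_frontier_norm_le (C := 0) (z := 0) hb
    ((((key 1 (by simp)).smul (key (-1) (by simp))).smul (key Complex.I (by simp))).smul
      (key (-Complex.I) (by simp))) ?_ ?_
  · have h1 : ‖f z₀‖ * ‖f z₀‖ * ‖f z₀‖ * ‖f z₀‖ ≤ 0 := by simpa using hG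
    by_contra hne
    have : 0 < ‖f z₀‖ := norm_pos_iff.2 hne
    exact absurd h1 (not_le.2 (by positivity))
  · intro w hw
    have hw1 : w ∈ closure Q := frontier_subset_closure hw
    have hw2 : w ∉ Q := by
      have : IsOpen Q := isOpen_Ioo.reProdIm isOpen_Ioo
      rw [this.frontier_eq] at hw
      exact hw.2
    rw [hQc, Complex.mem_reProdIm] at hw1
    obtain ⟨⟨h1, h2⟩, h3, h4⟩ := hw1
    have : w.re = -1 / 2 ∨ w.re = 1 / 2 ∨ w.im = -1 / 2 ∨ w.im = 1 / 2 := by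
      by_contra hcon
      push Not at hcon
      apply hw2
      rw [hQ, Complex.mem_reProdIm]
      exact ⟨⟨lt_of_le_of_ne h1 hcon.1.symm, lt_of_le_of_ne h2 hcon.2.1⟩,
        lt_of_le_of_ne h3 hcon.2.2.1.symm, lt_of_le_of_ne h4 hcon.2.2.2⟩
    rcases this with h | h | h | h
    · have := hzero (z₀ + -Complex.I * w) (by simp [him, h])
      simp only [smul_eq_mul, this]; simp
    · have := hzero (z₀ + Complex.I * w) (by simp [him, h]; try norm_num)
      simp only [smul_eq_mul, this]; simp
    · have := hzero (z₀ + -1 * w) (by simp [him, h])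
      simp only [smul_eq_mul, this]; simp
    · have := hzero (z₀ + 1 * w) (by simp [him, h]; try norm_num)
      simp only [smul_eq_mul, this]; simp
  · rw [hQc, Complex.mem_reProdIm]; constructor <;> constructor <;> norm_num

variable {V : Type*} [NormedAddCommGroup V]

/-- The zeros c − i/2 given by `eq_zero_center` accumulate at −i/2, so the identity theorem applies
in the open strip, and continuity carries the conclusion to the closed one. -/
theorem strip_eq_zero_scalar {f : ℂ → ℂ} (hc : ContinuousOn f closedStrip)
    (hd : DifferentiableOn ℂ f openStrip) (h0 : ∀ t : ℝ, f t = 0) {z : ℂ} (hz : z ∈ closedStrip) :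
    f z = 0 := by
  have han : AnalyticOnNhd ℂ f openStrip := hd.analyticOnNhd isOpen_openStrip
  have hmem : (-Complex.I / 2 : ℂ) ∈ openStrip := by constructor <;> simp <;> norm_num
  have hfreq : ∃ᶠ w in nhdsWithin (-Complex.I / 2 : ℂ) {-Complex.I / 2}ᶜ, f w = 0 := by
    have ht : Tendsto (fun n : ℕ => (((1 / ((n : ℝ) + 1) : ℝ) : ℂ) - Complex.I / 2)) atTop
        (nhdsWithin (-Complex.I / 2 : ℂ) {-Complex.I / 2}ᶜ) := by
      refine tendsto_nhdsWithin_iff.2 ⟨?_, ?_⟩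
      · have h1 := (Complex.continuous_ofReal.tendsto 0).comp
          (tendsto_one_div_add_atTop_nhds_zero_nat (𝕜 := ℝ))
        have h2 := h1.sub_const (Complex.I / 2)
        simpa [Function.comp_def, neg_div] using h2
      · refine Eventually.of_forall fun n hn => ?_
        have := congrArg Complex.re hn
        have hn0 : ((n : ℝ) + 1) ≠ 0 := by positivity
        norm_num [Complex.div_re, Complex.div_im] at this
        rcases this with h | h <;> exact hn0 (by exact_mod_cast h)
    exact ht.frequently (Frequently.of_forall fun n => eq_zero_center hc hd h0 _)
  have h1 := han.eqOn_zero_of_preconnected_of_frequently_eq_zero isPreconnected_openStrip hmem hfreq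
  exact Set.EqOn.of_subset_closure h1 hc continuousOn_const openStrip_subset
    closure_openStrip.ge hz

variable [InnerProductSpace ℂ V]

theorem strip_eq_zero {f : ℂ → V} (hc : ContinuousOn f closedStrip)
    (hd : DifferentiableOn ℂ f openStrip) (h0 : ∀ t : ℝ, f t = 0) {z : ℂ} (hz : z ∈ closedStrip) :
    f z = 0 := by
  have := strip_eq_zero_scalar (f := fun w => ⟪f z, f w⟫_ℂ)
    ((innerSL ℂ (f z)).continuous.comp_continuousOn hc)
    ((innerSL ℂ (f z)).differentiable.comp_differentiableOn hd) (by simp [h0]) hz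
  exact inner_self_eq_zero.1 this

theorem strip_eq {f g : ℂ → V} (hc : ContinuousOn f closedStrip)
    (hd : DifferentiableOn ℂ f openStrip) (hc' : ContinuousOn g closedStrip)
    (hd' : DifferentiableOn ℂ g openStrip) (h0 : ∀ t : ℝ, f t = g t) {z : ℂ}
    (hz : z ∈ closedStrip) : f z = g z :=
  sub_eq_zero.1 (strip_eq_zero (f := fun z => f z - g z) (hc.sub hc') (hd.sub hd')
    (fun t => sub_eq_zero.2 (h0 t)) hz)

end Strip

/-! ### The generator of a unitary group -/

/-- A strongly continuous one-parameter group of isometries of a complex Hilbert space. -/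
structure UnitaryGroup (H : Type*) [NormedAddCommGroup H] [InnerProductSpace ℂ H] where
  /-- The operator `V_t`. -/
  toFun : ℝ → (H →ₗᵢ[ℂ] H)
  map_add : ∀ (s t : ℝ) (x : H), toFun (s + t) x = toFun s (toFun t x)
  continuous_apply : ∀ x : H, Continuous fun t => toFun t x

namespace UnitaryGroup

variable {H : Type*} [NormedAddCommGroup H] [InnerProductSpace ℂ H] (V : UnitaryGroup H)

theorem map_zero_apply (x : H) : V.toFun 0 x = x := by
  have := V.map_add 0 0 x
  rw [add_zero] at this
  exact ((V.toFun 0).injective this).symm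

theorem apply_neg_apply (t : ℝ) (x : H) : V.toFun t (V.toFun (-t) x) = x := by
  rw [← V.map_add, add_neg_cancel, V.map_zero_apply]

theorem inner_apply_left (t : ℝ) (x y : H) : ⟪V.toFun t x, y⟫_ℂ = ⟪x, V.toFun (-t) y⟫_ℂ := by
  conv_lhs => rw [← V.apply_neg_apply t y]
  exact (V.toFun t).inner_map_map _ _

/-- `F` is a continuous extension of the orbit of `x` to the closed strip, holomorphic inside. -/
structure IsOrbit (F : ℂ → H) (x : H) : Prop where
  cont : ContinuousOn F closedStrip
  diff : DifferentiableOn ℂ F openStrip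
  real : ∀ t : ℝ, F t = V.toFun t x

variable {V} {F G : ℂ → H} {x y : H}

theorem mem_shift_closed {z : ℂ} (hz : z ∈ closedStrip) (t : ℝ) : z + t ∈ closedStrip := by
  simpa [closedStrip] using hz

theorem mem_shift_open {z : ℂ} (hz : z ∈ openStrip) (t : ℝ) : z + t ∈ openStrip := by
  simpa [openStrip] using hz

/-- Both sides are continuations of the same function of a real variable, by the group law.
Consequently ‖F z‖ depends only on Im z. -/
theorem IsOrbit.apply_add (hF : V.IsOrbit F x) {z : ℂ} (hz : z ∈ closedStrip) (t : ℝ) :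
    F (z + t) = V.toFun t (F z) := by
  refine strip_eq (f := fun z => F (z + t)) (g := fun z => V.toFun t (F z))
    (hF.cont.comp (by fun_prop) fun z hz => mem_shift_closed hz t)
    (hF.diff.comp (by fun_prop) fun z hz => mem_shift_open hz t)
    ((V.toFun t).continuous.comp_continuousOn hF.cont)
    ((V.toFun t).toContinuousLinearMap.differentiable.comp_differentiableOn hF.diff) ?_ hz
  intro s
  have := hF.real (s + t)
  push_cast at this
  rw [this, hF.real, ← V.map_add, add_comm]

theorem IsOrbit.norm_eq (hF : V.IsOrbit F x) {z : ℂ} (hz : z ∈ closedStrip) :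
    ‖F z‖ = ‖F (z.im * Complex.I)‖ := by
  have h1 : (z.im * Complex.I : ℂ) ∈ closedStrip := by simpa [closedStrip] using hz
  have h2 := hF.apply_add h1 z.re
  rw [show (z.im * Complex.I + z.re : ℂ) = z by rw [add_comm]; exact Complex.re_add_im z] at h2
  rw [h2, LinearIsometry.norm_map]

/-- Three lines principle. The required growth bound is automatic: the norm depends only on Im z,
which ranges over a compact interval. -/
theorem IsOrbit.norm_le (hF : V.IsOrbit F x) {z : ℂ} (hz : z ∈ closedStrip) :
    ‖F z‖ ≤ max ‖x‖ ‖F (-Complex.I)‖ := by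
  have hcomp : IsCompact (Set.Icc (-1 : ℝ) 0) := isCompact_Icc
  have hc : ContinuousOn (fun y : ℝ => F (y * Complex.I)) (Set.Icc (-1 : ℝ) 0) :=
    hF.cont.comp (by fun_prop) fun y hy => by simpa [closedStrip] using hy
  obtain ⟨M, hM⟩ := hcomp.exists_bound_of_continuousOn hc
  have hcl : closure (Complex.im ⁻¹' Set.Ioo (-1) 0) = closedStrip := closure_openStrip
  refine PhragmenLindelof.horizontal_strip (a := -1) (b := 0) ⟨hF.diff, ?_⟩ ?_ ?_ ?_ hz.1 hz.2
  · rw [hcl]; exact hF.cont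
  · refine ⟨0, by simp [Real.pi_pos], 0, ?_⟩
    refine Asymptotics.IsBigO.of_bound M ?_
    refine eventually_inf_principal.2 (Eventually.of_forall fun w hw => ?_)
    have hw' : w ∈ closedStrip := openStrip_subset hw
    rw [hF.norm_eq hw']
    simpa using hM w.im ⟨hw'.1, hw'.2⟩
  · intro w hw
    rw [hF.norm_eq (z := w) ⟨hw.ge, by rw [hw]; norm_num⟩, hw]
    simp
  · intro w hw
    rw [hF.norm_eq (z := w) ⟨by rw [hw]; norm_num, hw.le⟩, hw]
    have := hF.real 0
    simp only [Complex.ofReal_zero] at this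
    simp [this]

theorem IsOrbit.unique (hF : V.IsOrbit F x) (hG : V.IsOrbit G x) {z : ℂ} (hz : z ∈ closedStrip) :
    F z = G z :=
  strip_eq hF.cont hF.diff hG.cont hG.diff (fun t => by rw [hF.real, hG.real]) hz

theorem IsOrbit.add (hF : V.IsOrbit F x) (hG : V.IsOrbit G y) :
    V.IsOrbit (fun z => F z + G z) (x + y) :=
  ⟨hF.cont.add hG.cont, hF.diff.add hG.diff, fun t => by rw [hF.real, hG.real, LinearIsometry.map_add]⟩

theorem IsOrbit.smul (c : ℂ) (hF : V.IsOrbit F x) : V.IsOrbit (fun z => c • F z) (c • x) :=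
  ⟨hF.cont.const_smul c, hF.diff.const_smul c, fun t => by rw [hF.real, map_smul]⟩

theorem neg_I_mem : -Complex.I ∈ closedStrip := by constructor <;> simp

theorem half_mem {z : ℂ} (hz : z ∈ closedStrip) : z / 2 ∈ closedStrip := by
  obtain ⟨h1, h2⟩ := hz
  constructor <;> simp <;> linarith

/-- The quadratic form of the generator is the square of the norm in the middle of the strip. -/
theorem IsOrbit.inner_eq (hF : V.IsOrbit F x) :
    ⟪x, F (-Complex.I)⟫_ℂ = (‖F (-Complex.I / 2)‖ : ℂ) ^ 2 := by
  have hm : (-Complex.I / 2 : ℂ) ∈ closedStrip := half_mem neg_I_mem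
  have hmaps : ∀ z ∈ closedStrip, -(starRingEnd ℂ z) / 2 ∈ closedStrip := by
    intro z hz
    obtain ⟨h1, h2⟩ := hz
    constructor <;> simp <;> linarith
  have hadd : ∀ z ∈ closedStrip, z / 2 + -Complex.I / 2 ∈ closedStrip := by
    intro z hz
    obtain ⟨h1, h2⟩ := hz
    constructor <;> simp <;> linarith
  -- The two conjugations in the first function make it holomorphic. For real z the functions agree
  -- because the adjoint of V_t is V_{−t}; the formula is their equality at −i.
  have h := strip_eq (V := ℂ)
    (f := fun z => starRingEnd ℂ ⟪F (-Complex.I / 2), F (-(starRingEnd ℂ z) / 2)⟫_ℂ)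
    (g := fun z => ⟪x, F (z / 2 + -Complex.I / 2)⟫_ℂ) ?_ ?_ ?_ ?_ ?_ neg_I_mem
  · have e1 : -(starRingEnd ℂ (-Complex.I)) / 2 = -Complex.I / 2 := by simp
    have e2 : (-Complex.I / 2 + -Complex.I / 2 : ℂ) = -Complex.I := by ring
    simp only [e1, e2, inner_conj_symm] at h
    rw [← h, inner_self_eq_norm_sq_to_K]; rfl
  · refine Complex.continuous_conj.comp_continuousOn
      ((innerSL ℂ _).continuous.comp_continuousOn (hF.cont.comp ?_ hmaps))
    exact ((Complex.continuous_conj.neg).div_const 2).continuousOn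
  · intro z hz
    have hz' : -(starRingEnd ℂ z) / 2 ∈ openStrip := by
      obtain ⟨h1, h2⟩ := hz
      constructor <;> simp <;> linarith
    have hd : DifferentiableAt ℂ (fun w => ⟪F (-Complex.I / 2), F (-w / 2)⟫_ℂ) (starRingEnd ℂ z) := by
      refine (innerSL ℂ (F (-Complex.I / 2))).differentiableAt.comp _ ?_
      exact DifferentiableAt.comp _ (hF.diff.differentiableAt (isOpen_openStrip.mem_nhds hz'))
        (by fun_prop)
    have := hd.conj_conj
    rw [Complex.conj_conj] at this
    exact this.differentiableWithinAt
  · refine (innerSL ℂ x).continuous.comp_continuousOn (hF.cont.comp (by fun_prop) hadd)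
  · refine (innerSL ℂ x).differentiable.comp_differentiableOn (hF.diff.comp (by fun_prop) ?_)
    intro z hz
    obtain ⟨h1, h2⟩ := hz
    constructor <;> simp <;> linarith
  · intro t
    have e1 : (-(starRingEnd ℂ (t : ℂ)) / 2 : ℂ) = ((-(t / 2) : ℝ) : ℂ) := by
      rw [Complex.conj_ofReal]; push_cast; ring
    have e2 : ((t : ℂ) / 2 + -Complex.I / 2) = -Complex.I / 2 + ((t / 2 : ℝ) : ℂ) := by
      push_cast; ring
    show starRingEnd ℂ ⟪F (-Complex.I / 2), F (-(starRingEnd ℂ (t : ℂ)) / 2)⟫_ℂ =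
      ⟪x, F ((t : ℂ) / 2 + -Complex.I / 2)⟫_ℂ
    rw [inner_conj_symm, e1, e2, hF.real, hF.apply_add hm, V.inner_apply_left, neg_neg]

variable (V) in
/-- The graph of the generator. -/
def graph : Submodule ℂ (H × H) where
  carrier := {p | ∃ F : ℂ → H, V.IsOrbit F p.1 ∧ F (-Complex.I) = p.2}
  add_mem' := by
    rintro p q ⟨F, hF, hF'⟩ ⟨G, hG, hG'⟩
    exact ⟨_, hF.add hG, by simp [hF', hG']⟩
  zero_mem' := ⟨fun _ => 0, ⟨continuousOn_const, differentiableOn_const _, by simp⟩, rfl⟩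
  smul_mem' := by
    rintro c p ⟨F, hF, hF'⟩
    exact ⟨_, hF.smul c, by simp [hF']⟩

theorem mem_graph {p : H × H} :
    p ∈ V.graph ↔ ∃ F : ℂ → H, V.IsOrbit F p.1 ∧ F (-Complex.I) = p.2 := Iff.rfl

theorem graph_unique {u v v' : H} (h : (u, v) ∈ V.graph) (h' : (u, v') ∈ V.graph) : v = v' := by
  obtain ⟨F, hF, hF'⟩ := mem_graph.1 h
  obtain ⟨G, hG, hG'⟩ := mem_graph.1 h'
  simp only at hF' hG'
  rw [← hF', ← hG', hF.unique hG neg_I_mem]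

theorem inner_graph {u v : H} (h : (u, v) ∈ V.graph) : ∃ r : ℝ, 0 ≤ r ∧ ⟪u, v⟫_ℂ = r := by
  obtain ⟨F, hF, hF'⟩ := mem_graph.1 h
  simp only at hF'
  exact ⟨‖F (-Complex.I / 2)‖ ^ 2, by positivity, by rw [← hF', hF.inner_eq]; push_cast; rfl⟩

/-- The cross term ⟪u, A u⟫ is nonnegative. This makes 1 + A bounded below on the graph. -/
theorem norm_add_sq_graph {u v : H} (h : (u, v) ∈ V.graph) :
    ‖u‖ ^ 2 + ‖v‖ ^ 2 ≤ ‖u + v‖ ^ 2 := by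
  obtain ⟨r, hr, hr'⟩ := inner_graph h
  rw [norm_add_sq (𝕜 := ℂ), hr']
  simp
  linarith

/-- By `IsOrbit.norm_le` the two boundary values control the continuation on the whole strip.
Convergence in the graph therefore forces uniform convergence of the continuations, and the limit is
again continuous and holomorphic inside. -/
theorem isClosed_graph [CompleteSpace H] : IsClosed (V.graph : Set (H × H)) := by
  rw [← isSeqClosed_iff_isClosed]
  intro p q hp hpq
  choose F hF hF' using fun n => mem_graph.1 (hp n)
  have hcauchy : UniformCauchySeqOn F atTop closedStrip := by
    rw [Metric.uniformCauchySeqOn_iff]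
    intro ε hε
    have hc := hpq.cauchySeq
    rw [Metric.cauchySeq_iff] at hc
    obtain ⟨N, hN⟩ := hc ε hε
    refine ⟨N, fun m hm n hn z hz => lt_of_le_of_lt ?_ (hN m hm n hn)⟩
    have h1 := ((hF m).add ((hF n).smul (-1))).norm_le hz
    simp only [neg_smul, one_smul, ← sub_eq_add_neg, hF'] at h1
    rw [dist_eq_norm, Prod.dist_eq, dist_eq_norm, dist_eq_norm]
    exact h1
  have hlim : ∀ z : ℂ, ∃ w : H, z ∈ closedStrip → Tendsto (fun n => F n z) atTop (nhds w) := by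
    intro z
    by_cases hz : z ∈ closedStrip
    · obtain ⟨w, hw⟩ := cauchySeq_tendsto_of_complete (hcauchy.cauchySeq hz)
      exact ⟨w, fun _ => hw⟩
    · exact ⟨0, fun h => absurd h hz⟩
  choose G hG using hlim
  have hunif : TendstoUniformlyOn F G atTop closedStrip :=
    hcauchy.tendstoUniformlyOn_of_tendsto fun z hz => hG z hz
  refine mem_graph.2 ⟨G, ⟨?_, ?_, ?_⟩, ?_⟩
  · exact hunif.continuousOn (Frequently.of_forall fun n => (hF n).cont)
  · exact ((hunif.mono openStrip_subset).tendstoLocallyUniformlyOn).differentiableOn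
      (Eventually.of_forall fun n => (hF n).diff) isOpen_openStrip
  · intro t
    have ht : (t : ℂ) ∈ closedStrip := by constructor <;> simp
    refine tendsto_nhds_unique (hG t ht) ?_
    simp only [(hF _).real]
    exact ((V.toFun t).continuous.tendsto _).comp ((continuous_fst.tendsto _).comp hpq)
  · refine tendsto_nhds_unique (hG _ neg_I_mem) ?_
    simp only [hF']
    exact (continuous_snd.tendsto _).comp hpq

end UnitaryGroup

/-! ### Gaussian regularization of orbits and invertibility of 1 + A -/

namespace UnitaryGroup

open MeasureTheory

variable {H : Type*} [NormedAddCommGroup H] [InnerProductSpace ℂ H] [CompleteSpace H]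
  (V : UnitaryGroup H)

theorem norm_cexp_gaussian (a t : ℝ) (z : ℂ) :
    ‖Complex.exp (-a * (t - z) ^ 2)‖ = Real.exp (-a * ((t - z.re) ^ 2 - z.im ^ 2)) := by
  rw [Complex.norm_exp]
  congr 1
  simp [pow_two]

/-- The Gaussian regularization of the orbit of `x`. -/
def gaussianOrbit (a : ℝ) (x : H) (z : ℂ) : H :=
  ∫ t : ℝ, Complex.exp (-a * (t - z) ^ 2) • V.toFun t x

variable {V} {a : ℝ} (ha : 0 < a) (x : H)

include ha in
theorem integrable_gaussian_shift (s : ℝ) : Integrable fun t : ℝ => Real.exp (-a * (t - s) ^ 2) :=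
  (integrable_exp_neg_mul_sq ha).comp_sub_right s

theorem continuous_gaussian_smul (z : ℂ) :
    Continuous fun t : ℝ => Complex.exp (-a * (t - z) ^ 2) • V.toFun t x :=
  Continuous.smul (by fun_prop) (V.continuous_apply x)

include ha in
theorem integrable_gaussian_smul (z : ℂ) :
    Integrable fun t : ℝ => Complex.exp (-a * (t - z) ^ 2) • V.toFun t x := by
  refine Integrable.mono' (((integrable_gaussian_shift ha z.re).mul_const
    (Real.exp (a * z.im ^ 2))).mul_const ‖x‖) (continuous_gaussian_smul x z).aestronglyMeasurable ?_
  refine Eventually.of_forall fun t => le_of_eq ?_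
  rw [norm_smul, LinearIsometry.norm_map, norm_cexp_gaussian, ← Real.exp_add]
  congr 2; ring

include ha in
theorem norm_gaussianOrbit_le (z : ℂ) :
    ‖V.gaussianOrbit a x z‖ ≤ Real.exp (a * z.im ^ 2) * (√(Real.pi / a) * ‖x‖) := by
  refine (norm_integral_le_integral_norm _).trans (le_of_eq ?_)
  have : ∀ t : ℝ, ‖Complex.exp (-a * (t - z) ^ 2) • V.toFun t x‖ =
      Real.exp (-a * (t - z.re) ^ 2) * (Real.exp (a * z.im ^ 2) * ‖x‖) := by
    intro t
    rw [norm_smul, LinearIsometry.norm_map, norm_cexp_gaussian, ← mul_assoc, ← Real.exp_add]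
    congr 2; ring
  simp_rw [this]
  rw [integral_mul_const, integral_sub_right_eq_self (fun t => Real.exp (-a * t ^ 2)),
    integral_gaussian]
  ring

include ha in
theorem differentiable_gaussianOrbit : Differentiable ℂ (V.gaussianOrbit a x) := by
  intro z₀
  -- On the unit ball around z₀ one has (t − Re z)² ≥ (t − Re z₀)²/2 − 1 and |Im z| ≤ |Im z₀| + 1.
  -- Half of the Gaussian exponent is given up to get a bound uniform in z, and C absorbs the rest.
  set C : ℝ := Real.exp (a * (1 + (|z₀.im| + 1) ^ 2)) with hC
  have hb : (0 : ℝ) < a / 2 := by positivity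
  have hint : Integrable fun t : ℝ => (2 * a * (|t - z₀.re| + (|z₀.im| + 1))) *
      (Real.exp (-(a / 2) * (t - z₀.re) ^ 2) * C) * ‖x‖ := by
    have h1 : Integrable fun t : ℝ => |t| * Real.exp (-(a / 2) * t ^ 2) := by
      have := (integrable_mul_exp_neg_mul_sq hb).abs
      simpa [abs_mul, abs_of_pos (Real.exp_pos _)] using this
    have h2 := ((h1.add ((integrable_exp_neg_mul_sq hb).const_mul (|z₀.im| + 1))).comp_sub_right
      z₀.re).const_mul (2 * a * C * ‖x‖)
    refine h2.congr (Eventually.of_forall fun t => ?_)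
    simp only [Pi.add_apply]; ring
  refine (hasDerivAt_integral_of_dominated_loc_of_deriv_le (μ := volume)
    (F := fun z (t : ℝ) => Complex.exp (-a * (t - z) ^ 2) • V.toFun t x)
    (F' := fun z (t : ℝ) => (Complex.exp (-a * (t - z) ^ 2) * (2 * a * (t - z))) • V.toFun t x)
    (Metric.ball_mem_nhds z₀ one_pos) ?_ ?_ ?_ ?_ hint ?_).2.differentiableAt
  · exact Eventually.of_forall fun z => (continuous_gaussian_smul x z).aestronglyMeasurable
  · exact integrable_gaussian_smul ha x z₀
  · exact (Continuous.smul (by fun_prop) (V.continuous_apply x)).aestronglyMeasurable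
  · refine Eventually.of_forall fun t z hz => ?_
    rw [norm_smul, LinearIsometry.norm_map, norm_mul, norm_cexp_gaussian, mul_comm (Real.exp _)]
    have hz1 : ‖z - z₀‖ < 1 := by simpa [dist_eq_norm] using hz
    have hre : |z.re - z₀.re| ≤ 1 := (Complex.abs_re_le_norm (z - z₀)).trans hz1.le
    have him : |z.im - z₀.im| ≤ 1 := (Complex.abs_im_le_norm (z - z₀)).trans hz1.le
    have him' : |z.im| ≤ |z₀.im| + 1 := by
      have := abs_sub_abs_le_abs_sub z.im z₀.im
      linarith
    have hnorm : ‖(2 * a * (t - z) : ℂ)‖ ≤ 2 * a * (|t - z₀.re| + (|z₀.im| + 1)) := by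
      have h1 : ‖(t - z : ℂ)‖ ≤ |t - z₀.re| + (|z₀.im| + 1) := by
        have h2 : (t - z : ℂ) = ((t - z₀.re : ℝ) : ℂ) + (-(z₀.im * Complex.I) + (z₀ - z)) := by
          apply Complex.ext
          · simp
          · simp; ring
        rw [h2]
        refine (norm_add_le _ _).trans (add_le_add (Complex.norm_real _).le ((norm_add_le _ _).trans ?_))
        rw [norm_sub_rev]
        exact add_le_add (by simp) hz1.le
      rw [norm_mul, norm_mul, Complex.norm_real, Real.norm_of_nonneg ha.le]
      simp only [Complex.norm_ofNat]
      gcongr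
    have hexp : Real.exp (-a * ((t - z.re) ^ 2 - z.im ^ 2)) ≤
        Real.exp (-(a / 2) * (t - z₀.re) ^ 2) * C := by
      rw [hC, ← Real.exp_add]
      apply Real.exp_le_exp.2
      have e1 : z.im ^ 2 ≤ (|z₀.im| + 1) ^ 2 := by
        rw [← sq_abs z.im]; gcongr
      have e2 : (z.re - z₀.re) ^ 2 ≤ 1 := by
        rw [← sq_abs]; nlinarith [abs_nonneg (z.re - z₀.re)]
      have e3 : (t - z₀.re) ^ 2 / 2 - 1 ≤ (t - z.re) ^ 2 := by
        nlinarith [sq_nonneg ((t - z.re) - (z.re - z₀.re))]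
      nlinarith
    gcongr
  · refine Eventually.of_forall fun t z _ => ?_
    refine HasDerivAt.smul_const ?_ _
    have h1 : HasDerivAt (fun z : ℂ => -(a : ℂ) * ((t : ℂ) - z) ^ 2) (2 * a * (t - z)) z := by
      have := (((hasDerivAt_id z).const_sub (t : ℂ)).pow 2).const_mul (-(a : ℂ))
      exact this.congr_deriv (by simp only [id]; push_cast; ring)
    exact h1.cexp

theorem gaussianOrbit_add_real (z : ℂ) (s : ℝ) :
    V.gaussianOrbit a x (z + s) = V.toFun s (V.gaussianOrbit a x z) := by
  rw [gaussianOrbit, gaussianOrbit, ← LinearIsometry.integral_comp_comm,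
    ← integral_sub_right_eq_self (fun t : ℝ => V.toFun s _) s]
  congr 1; ext t
  rw [LinearIsometry.map_smul, ← V.map_add, add_sub_cancel]
  congr 2
  push_cast; ring

include ha in
theorem isOrbit_gaussianOrbit (z : ℂ) :
    V.IsOrbit (fun w => V.gaussianOrbit a x (z + w)) (V.gaussianOrbit a x z) where
  cont := ((differentiable_gaussianOrbit ha x).continuous.comp (by fun_prop)).continuousOn
  diff := ((differentiable_gaussianOrbit ha x).comp (by fun_prop)).differentiableOn
  real t := gaussianOrbit_add_real x z t

include ha in
theorem gaussianOrbit_mem_graph (z : ℂ) :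
    (V.gaussianOrbit a x z, V.gaussianOrbit a x (z - Complex.I)) ∈ V.graph :=
  mem_graph.2 ⟨_, isOrbit_gaussianOrbit ha x z, by simp [sub_eq_add_neg]⟩

variable (y : H)

include ha in
-- Let g(z) be the pairing of y with the regularized orbit, an entire function. Since A takes the
-- regularized orbit from z to z − i, orthogonality to the range of 1 + A says g(z − i) = −g(z). So
-- g has period 2i, and as its bound depends only on Im z it is bounded. By Liouville it is
-- constant, and the sign change makes the constant 0.
theorem inner_gaussianOrbit_eq_zero (hy : ∀ p ∈ V.graph, ⟪y, p.1 + p.2⟫_ℂ = 0) :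
    ⟪y, V.gaussianOrbit a x 0⟫_ℂ = 0 := by
  set g : ℂ → ℂ := fun z => ⟪y, V.gaussianOrbit a x z⟫_ℂ with hg
  have hd : Differentiable ℂ g :=
    (innerSL ℂ y).differentiable.comp (differentiable_gaussianOrbit ha x)
  have hanti : ∀ z, g (z - Complex.I) = - g z := by
    intro z
    have := hy _ (gaussianOrbit_mem_graph ha x z)
    simp only [inner_add_right] at this
    exact eq_neg_of_add_eq_zero_right this
  have hper : ∀ s : ℝ, Function.Periodic (fun τ : ℝ => g (s + τ * Complex.I)) 2 := by
    intro s τ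
    have h1 := hanti (s + (τ + 2) * Complex.I)
    have h2 := hanti (s + (τ + 2) * Complex.I - Complex.I)
    rw [h1, neg_neg] at h2
    simp only
    push_cast
    rw [← h2]
    congr 1; ring
  have hbd : Bornology.IsBounded (Set.range g) := by
    rw [isBounded_iff_forall_norm_le]
    refine ⟨‖y‖ * (Real.exp (a * 2 ^ 2) * (√(Real.pi / a) * ‖x‖)), ?_⟩
    rintro _ ⟨z, rfl⟩
    obtain ⟨τ, hτ, hτ'⟩ := (hper z.re).exists_mem_Ico₀ (by norm_num) z.im
    simp only [Complex.re_add_im] at hτ'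
    rw [hτ']
    refine (norm_inner_le_norm _ _).trans ?_
    gcongr
    refine (norm_gaussianOrbit_le ha x _).trans ?_
    gcongr
    · simpa using hτ.1
    · simpa using hτ.2.le
  have h1 := hd.apply_eq_apply_of_bounded hbd (0 - Complex.I) 0
  rw [hanti] at h1
  have h2 : g 0 = 0 := by linear_combination (-1 / 2 : ℂ) * h1
  exact h2

/-- Take x = y and Gaussians of parameter (n+1)², which concentrate at time 0. After rescaling, the
vanishing pairings converge to √π ‖y‖². -/
theorem eq_zero_of_orthogonal_range (hy : ∀ p ∈ V.graph, ⟪y, p.1 + p.2⟫_ℂ = 0) : y = 0 := by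
  have key : ∀ n : ℕ, ∫ s : ℝ, (Real.exp (-s ^ 2) : ℂ) * ⟪y, V.toFun (s / ((n : ℝ) + 1)) y⟫_ℂ = 0 := by
    intro n
    set c : ℝ := (n : ℝ) + 1 with hc
    have hc0 : 0 < c := by positivity
    have h := inner_gaussianOrbit_eq_zero (a := c ^ 2) (by positivity) y y hy
    have h1 : ∫ t : ℝ, (Real.exp (-(t * c) ^ 2) : ℂ) * ⟪y, V.toFun (t * c / c) y⟫_ℂ = 0 := by
      rw [← h, gaussianOrbit, ← integral_inner (integrable_gaussian_smul (by positivity) y 0)]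
      congr 1; ext t
      rw [inner_smul_right, mul_div_cancel_right₀ _ hc0.ne']
      congr 1
      push_cast; congr 1; ring
    rw [Measure.integral_comp_mul_right (fun s : ℝ =>
      (Real.exp (-s ^ 2) : ℂ) * ⟪y, V.toFun (s / c) y⟫_ℂ) c] at h1
    rcases smul_eq_zero.1 h1 with h2 | h2
    · simp [hc0.ne'] at h2
    · exact h2
  have hlim : Tendsto (fun n : ℕ => ∫ s : ℝ, (Real.exp (-s ^ 2) : ℂ) *
      ⟪y, V.toFun (s / ((n : ℝ) + 1)) y⟫_ℂ) atTop
      (nhds (∫ s : ℝ, (Real.exp (-s ^ 2) : ℂ) * ⟪y, V.toFun 0 y⟫_ℂ)) := by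
    refine tendsto_integral_of_dominated_convergence
      (fun s => Real.exp (-1 * s ^ 2) * (‖y‖ * ‖y‖)) ?_ ?_ ?_ ?_
    · intro n
      refine Continuous.aestronglyMeasurable (Continuous.mul (by fun_prop) ?_)
      exact continuous_const.inner ((V.continuous_apply y).comp (by fun_prop))
    · exact (integrable_exp_neg_mul_sq one_pos).mul_const _
    · refine fun n => Eventually.of_forall fun s => ?_
      rw [norm_mul, Complex.norm_real, Real.norm_of_nonneg (Real.exp_pos _).le, neg_one_mul]
      gcongr
      refine (norm_inner_le_norm _ _).trans (le_of_eq ?_)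
      rw [LinearIsometry.norm_map]
    · refine Eventually.of_forall fun s => Tendsto.const_mul _ ?_
      have h1 : Tendsto (fun n : ℕ => s / ((n : ℝ) + 1)) atTop (nhds 0) := by
        have := (tendsto_one_div_add_atTop_nhds_zero_nat (𝕜 := ℝ)).const_mul s
        simpa [div_eq_mul_inv] using this
      exact ((continuous_const.inner (V.continuous_apply y)).tendsto 0).comp h1
  simp only [key] at hlim
  have h0 := tendsto_nhds_unique hlim tendsto_const_nhds
  rw [integral_mul_const, integral_complex_ofReal, V.map_zero_apply] at h0
  have hpi : ∫ s : ℝ, Real.exp (-s ^ 2) = √Real.pi := by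
    have := integral_gaussian 1
    simpa using this
  rw [hpi] at h0
  rcases mul_eq_zero.1 h0 with h | h
  · have : √Real.pi ≠ 0 := (Real.sqrt_pos.2 Real.pi_pos).ne'
    exact absurd (by exact_mod_cast h) this
  · exact inner_self_eq_zero.1 h

variable (V) in
/-- The sum map `(u, A u) ↦ u + A u` on the graph. -/
def graphSum : V.graph →L[ℂ] H :=
  (ContinuousLinearMap.fst ℂ H H + ContinuousLinearMap.snd ℂ H H).comp V.graph.subtypeL

theorem graphSum_apply (p : V.graph) : V.graphSum p = p.1.1 + p.1.2 := rfl

theorem norm_le_graphSum (p : V.graph) : ‖p‖ ≤ ‖V.graphSum p‖ := by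
  have h := norm_add_sq_graph (V := V) (u := p.1.1) (v := p.1.2) p.2
  rw [graphSum_apply]
  show max ‖p.1.1‖ ‖p.1.2‖ ≤ _
  refine max_le ?_ ?_ <;> refine le_of_sq_le_sq ?_ (norm_nonneg _) <;> nlinarith [sq_nonneg ‖p.1.1‖, sq_nonneg ‖p.1.2‖]

/-- The sum map is bounded below on a complete space, so it is injective with closed range. The
range is dense by `eq_zero_of_orthogonal_range`. -/
theorem graphSum_bijective : Function.Bijective V.graphSum := by
  have hanti : AntilipschitzWith 1 V.graphSum :=
    AddMonoidHomClass.antilipschitz_of_bound V.graphSum fun p => by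
      simpa using norm_le_graphSum p
  refine ⟨hanti.injective, ?_⟩
  have : CompleteSpace V.graph := (isClosed_graph (V := V)).completeSpace_coe
  have hcl : IsClosed (Set.range V.graphSum) := hanti.isClosed_range V.graphSum.uniformContinuous
  have hcl' : IsClosed ((LinearMap.range (V.graphSum : V.graph →ₗ[ℂ] H) : Submodule ℂ H) : Set H) := by
    rw [LinearMap.coe_range]; exact hcl
  have : CompleteSpace (LinearMap.range (V.graphSum : V.graph →ₗ[ℂ] H)) := hcl'.completeSpace_coe
  have htop : LinearMap.range (V.graphSum : V.graph →ₗ[ℂ] H) = ⊤ := by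
    rw [← Submodule.orthogonal_eq_bot_iff, Submodule.eq_bot_iff]
    intro y hy
    refine eq_zero_of_orthogonal_range (V := V) y fun p hp => ?_
    have := (Submodule.mem_orthogonal' _ _).1 hy (V.graphSum ⟨p, hp⟩) ⟨⟨p, hp⟩, rfl⟩
    exact this
  exact LinearMap.range_eq_top.1 htop

/-- The equation v = A(2x − v) is solved by v = 2A(1+A)⁻¹x; this is the form in which
`IsEmbeddingOperator` refers to A. -/
theorem exists_graph (x : H) : ∃ v : H, ((2 : ℂ) • x - v, v) ∈ V.graph := by
  obtain ⟨p, hp⟩ := (graphSum_bijective (V := V)).2 ((2 : ℂ) • x)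
  refine ⟨p.1.2, ?_⟩
  rw [← hp, graphSum_apply, add_sub_cancel_right]
  exact p.2

theorem graph_resolvent_unique {x v v' : H} (h : ((2 : ℂ) • x - v, v) ∈ V.graph)
    (h' : ((2 : ℂ) • x - v', v') ∈ V.graph) : v = v' := by
  have : (⟨_, h⟩ : V.graph) = ⟨_, h'⟩ := graphSum_bijective.1 (by simp [graphSum_apply])
  exact congrArg (fun p : V.graph => p.1.2) this

variable (V) in
/-- The bounded operator `2 A (1 + A)⁻¹`. -/
def resolvent : H →L[ℂ] H :=
  LinearMap.mkContinuous
    { toFun := fun x => (exists_graph (V := V) x).choose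
      map_add' := fun x y => graph_resolvent_unique (V := V) (x := x + y)
        (exists_graph (V := V) (x + y)).choose_spec (by
          have := V.graph.add_mem (exists_graph (V := V) x).choose_spec
            (exists_graph (V := V) y).choose_spec
          rw [Prod.mk_add_mk] at this
          convert this using 2
          module)
      map_smul' := fun c x => graph_resolvent_unique (V := V) (x := c • x)
        (exists_graph (V := V) (c • x)).choose_spec (by
          have := V.graph.smul_mem c (exists_graph (V := V) x).choose_spec
          rw [Prod.smul_mk] at this
          rw [smul_sub, smul_comm] at this
          exact this) }
    2 (by
      intro x
      have h := norm_add_sq_graph (V := V) (exists_graph (V := V) x).choose_spec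
      rw [sub_add_cancel, norm_smul] at h
      simp only [Complex.norm_ofNat] at h
      exact le_of_sq_le_sq (by simp only [LinearMap.coe_mk, AddHom.coe_mk]; nlinarith [sq_nonneg ‖(2 : ℂ) • x - (exists_graph (V := V) x).choose‖]) (by positivity))

theorem resolvent_mem (x : H) : ((2 : ℂ) • x - V.resolvent x, V.resolvent x) ∈ V.graph :=
  (exists_graph (V := V) x).choose_spec

/-- With v the image of x and u = 2x − v, so that v = A u, one has ⟪x, v⟫ = (⟪u, v⟫ + ‖v‖²)/2, and
⟪u, A u⟫ ≥ 0. -/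
theorem resolvent_isPositive : V.resolvent.IsPositive := by
  rw [ContinuousLinearMap.isPositive_iff_complex]
  intro x
  obtain ⟨r, hr, hr'⟩ := inner_graph (resolvent_mem (V := V) x)
  set v := V.resolvent x
  have h2 : ⟪x, v⟫_ℂ = (((r + ‖v‖ ^ 2) / 2 : ℝ) : ℂ) := by
    rw [inner_sub_left, inner_smul_left, inner_self_eq_norm_sq_to_K] at hr'
    simp only [map_ofNat] at hr'
    push_cast
    have : (2 : ℂ) * ⟪x, v⟫_ℂ = r + (‖v‖ : ℂ) ^ 2 := by
      rw [← hr']; simp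
    linear_combination this / 2
  have h3 : ⟪v, x⟫_ℂ = (((r + ‖v‖ ^ 2) / 2 : ℝ) : ℂ) := by
    rw [← inner_conj_symm, h2, Complex.conj_ofReal]
  rw [h3]
  refine ⟨by rw [RCLike.re_to_complex, Complex.ofReal_re], ?_⟩
  rw [RCLike.re_to_complex, Complex.ofReal_re]
  positivity

end UnitaryGroup

/-! ### The embedding operator -/

namespace Complexification

variable {E : Type u} [NormedAddCommGroup E] [InnerProductSpace ℝ E]

theorem inner_re (z w : Complexification E) :
    (⟪z, w⟫_ℂ).re = ⟪re z, re w⟫_ℝ + ⟪im z, im w⟫_ℝ := rfl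

theorem inner_im (z w : Complexification E) :
    (⟪z, w⟫_ℂ).im = ⟪re z, im w⟫_ℝ - ⟪im z, re w⟫_ℝ := rfl

/-- The conjugation `x + i y ↦ x - i y`. -/
def conj (z : Complexification E) : Complexification E := mk (re z) (-im z)

@[simp] theorem re_conj (z : Complexification E) : re (conj z) = re z := rfl

@[simp] theorem im_conj (z : Complexification E) : im (conj z) = -im z := rfl

@[simp] theorem re_ofReal (x : E) : re (ofReal x) = x := rfl

@[simp] theorem im_ofReal (x : E) : im (ofReal x) = 0 := rfl

@[simp] theorem conj_conj (z : Complexification E) : conj (conj z) = z := by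
  apply ext <;> simp

theorem conj_add (z w : Complexification E) : conj (z + w) = conj z + conj w := by
  apply ext <;> simp [add_comm]

theorem conj_smul (c : ℂ) (z : Complexification E) :
    conj (c • z) = starRingEnd ℂ c • conj z := by
  apply ext <;> simp
  module

@[simp] theorem conj_ofReal (x : E) : conj (ofReal x) = ofReal x := by
  apply ext <;> simp

theorem conj_sub (z w : Complexification E) : conj (z - w) = conj z - conj w := by
  rw [sub_eq_add_neg, ← neg_one_smul ℂ w, conj_add, conj_smul]
  simp [sub_eq_add_neg]

theorem norm_conj (z : Complexification E) : ‖conj z‖ = ‖z‖ := by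
  have : ‖conj z‖ ^ 2 = ‖z‖ ^ 2 := by rw [norm_sq, norm_sq]; simp
  exact (sq_eq_sq₀ (norm_nonneg _) (norm_nonneg _)).1 this

theorem inner_conj_conj (z w : Complexification E) :
    ⟪conj z, conj w⟫_ℂ = starRingEnd ℂ ⟪z, w⟫_ℂ := by
  apply Complex.ext
  · rw [Complex.conj_re, inner_re, inner_re]; simp
  · rw [Complex.conj_im, inner_im, inner_im]; simp; ring

theorem ofReal_add (x y : E) : ofReal (x + y) = ofReal x + ofReal y := by
  apply ext <;> simp

theorem ofReal_smul (c : ℝ) (x : E) : ofReal (c • x) = (c : ℂ) • ofReal x := by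
  apply ext
  · rw [re_smul]; simp
  · rw [im_smul]; simp

theorem eq_ofReal_add (z : Complexification E) :
    z = ofReal (re z) + Complex.I • ofReal (im z) := by
  apply ext <;> simp

theorem ofReal_injective : Function.Injective (ofReal : E → Complexification E) := fun x y h => by
  simpa using congrArg re h

theorem continuous_conj : Continuous (conj : Complexification E → Complexification E) := by
  refine AddMonoidHomClass.continuous_of_bound
    (⟨⟨conj, by apply ext <;> simp⟩, conj_add⟩ : Complexification E →+ Complexification E) 1 ?_
  intro z
  simpa using (norm_conj z).le

theorem hasDerivAt_conj {F : ℂ → Complexification E} {F' : Complexification E} {z : ℂ}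
    (h : HasDerivAt F F' (starRingEnd ℂ z)) :
    HasDerivAt (fun w => conj (F (starRingEnd ℂ w))) (conj F') z := by
  rw [hasDerivAt_iff_isLittleO] at h ⊢
  have ht : Tendsto (starRingEnd ℂ) (nhds z) (nhds (starRingEnd ℂ z)) :=
    Complex.continuous_conj.tendsto z
  have h1 := (h.comp_tendsto ht).norm_norm
  refine Asymptotics.IsLittleO.of_norm_norm (h1.congr (fun w => ?_) fun w => ?_)
  · simp only [Function.comp_apply]
    rw [← norm_conj, conj_sub, conj_sub, conj_smul, map_sub, Complex.conj_conj, Complex.conj_conj]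
  · simp only [Function.comp_apply]
    rw [← map_sub, Complex.norm_conj]

end Complexification

theorem exists_isPositive_sqrt {H : Type*} [NormedAddCommGroup H] [InnerProductSpace ℂ H]
    [CompleteSpace H] {B : H →L[ℂ] H} (hB : B.IsPositive) :
    ∃ S : H →L[ℂ] H, S.IsPositive ∧ ∀ x, S (S x) = B x := by
  have hpos : 0 ≤ B := (ContinuousLinearMap.nonneg_iff_isPositive _).2 hB
  refine ⟨CFC.sqrt B, (ContinuousLinearMap.nonneg_iff_isPositive _).1 (CFC.sqrt_nonneg _),
    fun x => ?_⟩
  rw [← mul_apply_eq_comp, CFC.sqrt_mul_sqrt_self _ hpos]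

namespace OrthogonalGroup

open Complexification (re im ofReal conj)

variable {E : Type u} [NormedAddCommGroup E] [InnerProductSpace ℝ E] (U : OrthogonalGroup E)

/-- The complexified unitary group. -/
def unitary : UnitaryGroup (Complexification E) where
  toFun t :=
    { toFun := U.complexified t
      map_add' := fun z w => by
        apply Complexification.ext <;> simp [complexified]
      map_smul' := fun c z => by
        apply Complexification.ext <;> simp [complexified]
      norm_map' := fun z => by
        have : ‖U.complexified t z‖ ^ 2 = ‖z‖ ^ 2 := by
          rw [Complexification.norm_sq, Complexification.norm_sq]
          simp [complexified]
        exact (sq_eq_sq₀ (norm_nonneg _) (norm_nonneg _)).1 this }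
  map_add s t z := by
    apply Complexification.ext
    · exact U.map_add s t (re z)
    · exact U.map_add s t (im z)
  continuous_apply z := by
    have : Continuous fun t => WithLp.toLp 2 (U.toFun t (re z), U.toFun t (im z)) :=
      (WithLp.prod_continuous_toLp 2 E E).comp
        ((U.continuous_apply _).prodMk (U.continuous_apply _))
    exact this

theorem unitary_conj (t : ℝ) (z : Complexification E) :
    U.unitary.toFun t (conj z) = conj (U.unitary.toFun t z) := by
  apply Complexification.ext
  · rfl
  · exact (U.toFun t).map_neg (im z)

theorem mem_generatorGraph {p : Complexification E × Complexification E} :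
    p ∈ U.generatorGraph ↔ p ∈ U.unitary.graph := by
  constructor
  · rintro ⟨F, h1, h2, h3, h4⟩
    exact ⟨F, ⟨h1, h2, h3⟩, h4⟩
  · rintro ⟨F, ⟨h1, h2, h3⟩, h4⟩
    exact ⟨F, h1, h2, h3, h4⟩

/-- This is J A J = A⁻¹ for the conjugation J, which commutes with U_t and is antilinear. The
reflection z ↦ z̄ − i exchanges the two boundary lines of the strip and turns a continuation for u
into one for the conjugate of v. -/
theorem conj_mem_graph {u v : Complexification E} (h : (u, v) ∈ U.unitary.graph) :
    (conj v, conj u) ∈ U.unitary.graph := by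
  obtain ⟨F, hF, hF'⟩ := UnitaryGroup.mem_graph.1 h
  simp only at hF hF'
  have hm : ∀ z ∈ closedStrip, starRingEnd ℂ z - Complex.I ∈ closedStrip := by
    rintro z ⟨h1, h2⟩
    constructor <;> simp <;> linarith
  refine UnitaryGroup.mem_graph.2 ⟨fun z => conj (F (starRingEnd ℂ z - Complex.I)), ⟨?_, ?_, ?_⟩, ?_⟩
  · refine Complexification.continuous_conj.comp_continuousOn (hF.cont.comp ?_ hm)
    exact (Complex.continuous_conj.sub continuous_const).continuousOn
  · rintro z ⟨h1, h2⟩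
    have hz : starRingEnd ℂ z - Complex.I ∈ openStrip := by
      constructor <;> simp <;> linarith
    have hd := (hF.diff.differentiableAt (isOpen_openStrip.mem_nhds hz)).hasDerivAt
    have := Complexification.hasDerivAt_conj (F := fun w => F (w - Complex.I)) (z := z)
      (hd.comp_sub_const _ _)
    exact this.differentiableAt.differentiableWithinAt
  · intro t
    have := hF.apply_add UnitaryGroup.neg_I_mem t
    rw [hF'] at this
    rw [unitary_conj, ← this, Complex.conj_ofReal]
    congr 2; ring
  · have := hF.real 0
    rw [UnitaryGroup.map_zero_apply] at this
    simpa using congrArg conj this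

variable [CompleteSpace E]

theorem exists_isEmbeddingOperator : ∃ S, U.IsEmbeddingOperator S := by
  obtain ⟨S, hS, hS'⟩ := exists_isPositive_sqrt (UnitaryGroup.resolvent_isPositive (V := U.unitary))
  refine ⟨S, hS, fun x => ?_⟩
  rw [mem_generatorGraph, hS']
  exact UnitaryGroup.resolvent_mem x

theorem isEmbeddingOperator_embeddingOperator : U.IsEmbeddingOperator U.embeddingOperator :=
  Classical.epsilon_spec U.exists_isEmbeddingOperator

theorem embeddingOperator_mem (x : Complexification E) :
    ((2 : ℂ) • x - U.embeddingOperator (U.embeddingOperator x),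
      U.embeddingOperator (U.embeddingOperator x)) ∈ U.unitary.graph :=
  U.mem_generatorGraph.1 (U.isEmbeddingOperator_embeddingOperator.2 x)

theorem inner_embeddingOperator (x y : Complexification E) :
    ⟪U.embeddingOperator x, y⟫_ℂ = ⟪x, U.embeddingOperator y⟫_ℂ :=
  U.isEmbeddingOperator_embeddingOperator.1.isSymmetric x y

/-- Since S² = 2A(1+A)⁻¹ and conjugation replaces A by A⁻¹, it replaces S² by 2(1+A)⁻¹ = 2 − S². -/
theorem conj_embeddingOperator_sq (x : Complexification E) :
    U.embeddingOperator (U.embeddingOperator (conj x)) =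
      conj ((2 : ℂ) • x - U.embeddingOperator (U.embeddingOperator x)) := by
  refine UnitaryGroup.graph_resolvent_unique (V := U.unitary) (x := conj x)
    (U.embeddingOperator_mem _) ?_
  have := U.conj_mem_graph (U.embeddingOperator_mem x)
  convert this using 2
  rw [Complexification.conj_sub, Complexification.conj_smul, map_ofNat, sub_sub_cancel]

/-- If S x = 0 then A(2x) = 0. By the symmetry A ↔ A⁻¹ the conjugate of 2x is a value of A at 0, and
A is single-valued. -/
theorem embeddingOperator_injective : Function.Injective U.embeddingOperator := by
  rw [injective_iff_map_eq_zero]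
  intro x hx
  have h := U.conj_embeddingOperator_sq x
  have h0 := U.embeddingOperator_mem x
  rw [hx, map_zero, sub_zero] at h0
  have h1 := U.conj_mem_graph h0
  have hz : conj (0 : Complexification E) = 0 := by apply Complexification.ext <;> simp
  rw [hz] at h1
  have h2 := UnitaryGroup.graph_unique h1 (Submodule.zero_mem _)
  have h3 := congrArg conj h2
  rw [Complexification.conj_conj, hz] at h3
  exact (smul_eq_zero.1 h3).resolve_left two_ne_zero

theorem dense_range_of_symmetric {H : Type*} [NormedAddCommGroup H] [InnerProductSpace ℂ H]
    [CompleteSpace H] {A : H →L[ℂ] H} (hA : ∀ x y, ⟪A x, y⟫_ℂ = ⟪x, A y⟫_ℂ)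
    (hinj : Function.Injective A) : DenseRange A := by
  have h : (LinearMap.range (A : H →ₗ[ℂ] H))ᗮ = ⊥ := by
    rw [Submodule.eq_bot_iff]
    intro y hy
    have h1 := (Submodule.mem_orthogonal' _ _).1 hy (A (A y)) ⟨A y, rfl⟩
    rw [← hA] at h1
    have := inner_self_eq_zero.1 h1
    exact (map_eq_zero_iff A hinj).1 this
  rw [← Submodule.topologicalClosure_eq_top_iff] at h
  have := Submodule.dense_iff_topologicalClosure_eq_top.2 h
  rwa [LinearMap.coe_range] at this

theorem mem_complexSubspace {v : Complexification E} :
    v ∈ U.complexSubspace ↔ ∃ x, U.embeddingOperator x = v := by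
  constructor
  · rintro ⟨_, ⟨ξ, rfl⟩, _, ⟨η, rfl⟩, rfl⟩
    exact ⟨ofReal ξ + Complex.I • ofReal η, by simp [j]⟩
  · rintro ⟨x, rfl⟩
    refine ⟨_, ⟨re x, rfl⟩, _, ⟨im x, rfl⟩, ?_⟩
    conv_lhs => rw [Complexification.eq_ofReal_add x]
    simp [j]

/-- The operator `S (2 - S ^ 2)`, which maps real vectors to vectors having real inner products
with `K_ℝ`. -/
def dualOperator : Complexification E →L[ℂ] Complexification E :=
  U.embeddingOperator.comp ((2 : ℂ) • ContinuousLinearMap.id ℂ _ -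
    U.embeddingOperator.comp U.embeddingOperator)

theorem dualOperator_apply (x : Complexification E) :
    U.dualOperator x =
      U.embeddingOperator ((2 : ℂ) • x - U.embeddingOperator (U.embeddingOperator x)) := rfl

/-- A polynomial in S with real coefficients is symmetric, so injectivity is enough. The factor 2 −
S² is injective because it is conjugate to S². -/
theorem denseRange_dualOperator : DenseRange U.dualOperator := by
  refine dense_range_of_symmetric (fun x y => ?_) fun x y h => ?_
  · simp only [dualOperator_apply, inner_embeddingOperator, inner_sub_left, inner_sub_right,
      map_sub, map_smul, inner_smul_left, inner_smul_right, map_ofNat]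
  · rw [dualOperator_apply, dualOperator_apply] at h
    have h1 := congrArg conj (U.embeddingOperator_injective h)
    rw [← conj_embeddingOperator_sq, ← conj_embeddingOperator_sq] at h1
    have h2 := U.embeddingOperator_injective (U.embeddingOperator_injective h1)
    simpa using congrArg conj h2

/-- Moving S to the other side leaves S²(2 − S²). Conjugation interchanges the two commuting
factors, so this operator preserves real vectors, and real vectors have real inner products. -/
theorem inner_dualOperator_j (ζ η : E) :
    ⟪U.dualOperator (ofReal η), U.j ζ⟫_ℂ = ⟪U.j ζ, U.dualOperator (ofReal η)⟫_ℂ := by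
  have hreal : conj (U.embeddingOperator (U.dualOperator (ofReal η))) =
      U.embeddingOperator (U.dualOperator (ofReal η)) := by
    set x := ofReal η with hx
    have hxc : conj x = x := by simp [hx]
    have e1 := U.conj_embeddingOperator_sq x
    rw [hxc] at e1
    have e2 := congrArg conj e1
    rw [Complexification.conj_conj] at e2
    set b := U.embeddingOperator (U.embeddingOperator x) with hb
    have a1 : U.embeddingOperator (U.dualOperator x) =
        conj ((2 : ℂ) • b - U.embeddingOperator (U.embeddingOperator b)) := by
      rw [dualOperator_apply, ← e2, conj_embeddingOperator_sq]
    have a2 : U.embeddingOperator (U.dualOperator x) =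
        (2 : ℂ) • b - U.embeddingOperator (U.embeddingOperator b) := by
      rw [dualOperator_apply]; simp only [map_sub, map_smul, hb]
    calc _ = conj (conj ((2 : ℂ) • b - U.embeddingOperator (U.embeddingOperator b))) := by rw [a1]
      _ = _ := by rw [Complexification.conj_conj, a2]
  rw [← inner_conj_symm, j, inner_embeddingOperator, ← Complexification.inner_conj_conj, hreal,
    Complexification.conj_ofReal]

end OrthogonalGroup

/-! ### Basic properties of the full Fock space -/

section FockBasics

variable {H : Type u} [NormedAddCommGroup H] [InnerProductSpace ℂ H]

theorem tensorLeft_apply (ξ : H) (n : ℕ) (x : (tensorPower H n).carrier) :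
    tensorLeft ξ n x =
      (UniformSpace.Completion.toComplL (𝕜 := ℂ) (E := H ⊗[ℂ] (tensorPower H n).carrier))
        (TensorProduct.mkL ℂ H (tensorPower H n).carrier ξ x) := rfl

theorem tensorLeft_add (ξ ζ : H) (n : ℕ) (x : (tensorPower H n).carrier) :
    tensorLeft (ξ + ζ) n x = tensorLeft ξ n x + tensorLeft ζ n x := by
  rw [tensorLeft_apply, ContinuousLinearMap.map_add, add_apply,
    ContinuousLinearMap.map_add]
  rfl

theorem tensorLeft_smul (c : ℂ) (ξ : H) (n : ℕ) (x : (tensorPower H n).carrier) :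
    tensorLeft (c • ξ) n x = c • tensorLeft ξ n x := by
  rw [tensorLeft_apply, ContinuousLinearMap.map_smul, smul_apply,
    ContinuousLinearMap.map_smul]
  rfl

theorem inner_tensorLeft (ξ ζ : H) (n : ℕ) (x y : (tensorPower H n).carrier) :
    ⟪tensorLeft ξ n x, tensorLeft ζ n y⟫_ℂ = ⟪ξ, ζ⟫_ℂ * ⟪x, y⟫_ℂ :=
  (UniformSpace.Completion.inner_coe (𝕜 := ℂ) (E := H ⊗[ℂ] (tensorPower H n).carrier)
    (ξ ⊗ₜ[ℂ] x) (ζ ⊗ₜ[ℂ] y)).trans (TensorProduct.inner_tmul (𝕜 := ℂ) ξ ζ x y)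

theorem creation_apply_zero (ξ : H) (f : FockSpace H) : creation ξ f 0 = 0 := rfl

theorem creation_apply_succ (ξ : H) (f : FockSpace H) (n : ℕ) :
    creation ξ f (n + 1) = tensorLeft ξ n (f n) := rfl

theorem creation_add (ξ ζ : H) : creation (ξ + ζ) = creation ξ + creation ζ := by
  ext f n
  cases n with
  | zero => exact (add_zero (0 : (tensorPower H 0).carrier)).symm
  | succ n => exact tensorLeft_add ξ ζ n (f n)

theorem creation_smul (c : ℂ) (ξ : H) : creation (c • ξ) = c • creation ξ := by
  ext f n
  cases n with
  | zero => exact (smul_zero (A := (tensorPower H 0).carrier) c).symm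
  | succ n => exact tensorLeft_smul c ξ n (f n)

theorem inner_creation_creation (ξ ζ : H) (f g : FockSpace H) :
    ⟪creation ξ f, creation ζ g⟫_ℂ = ⟪ξ, ζ⟫_ℂ * ⟪f, g⟫_ℂ := by
  have h1 := lp.hasSum_inner (𝕜 := ℂ) (creation ξ f) (creation ζ g)
  have h2 := (lp.hasSum_inner (𝕜 := ℂ) f g).mul_left ⟪ξ, ζ⟫_ℂ
  refine h1.unique ?_
  rw [← hasSum_nat_add_iff' 1]
  simp only [Finset.range_one, Finset.sum_singleton, creation_apply_zero, inner_zero_left, sub_zero,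
    creation_apply_succ, inner_tensorLeft]
  exact h2

theorem norm_creation_apply (ξ : H) (f : FockSpace H) : ‖creation ξ f‖ = ‖ξ‖ * ‖f‖ := by
  have h := inner_creation_creation ξ ξ f f
  rw [inner_self_eq_norm_sq_to_K, inner_self_eq_norm_sq_to_K, inner_self_eq_norm_sq_to_K] at h
  have h' : ‖creation ξ f‖ ^ 2 = (‖ξ‖ * ‖f‖) ^ 2 := by rw [mul_pow]; exact_mod_cast h
  exact (sq_eq_sq₀ (norm_nonneg _) (by positivity)).1 h'

theorem norm_creation_le (ξ : H) : ‖creation ξ‖ ≤ ‖ξ‖ :=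
  ContinuousLinearMap.opNorm_le_bound _ (norm_nonneg _) fun f => (norm_creation_apply ξ f).le

variable (H) in
/-- Creation as a bounded linear map. -/
def creationL : H →L[ℂ] (FockSpace H →L[ℂ] FockSpace H) :=
  LinearMap.mkContinuous ⟨⟨creation, creation_add⟩, creation_smul⟩ 1 fun ξ => by
    simpa using norm_creation_le ξ

@[simp] theorem creationL_apply (ξ : H) : creationL H ξ = creation ξ := rfl

theorem star_creation_creation (ξ ζ : H) (f : FockSpace H) :
    star (creation ξ) (creation ζ f) = ⟪ξ, ζ⟫_ℂ • f := by
  refine ext_inner_left ℂ fun g => ?_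
  rw [ContinuousLinearMap.star_eq_adjoint, ContinuousLinearMap.adjoint_inner_right,
    inner_creation_creation, inner_smul_right]

theorem inner_star_creation (ξ : H) (f g : FockSpace H) :
    ⟪star (creation ξ) f, g⟫_ℂ = ⟪f, creation ξ g⟫_ℂ := by
  rw [ContinuousLinearMap.star_eq_adjoint, ContinuousLinearMap.adjoint_inner_left]

theorem inner_vacuum_creation (ξ : H) (f : FockSpace H) :
    ⟪vacuum H, creation ξ f⟫_ℂ = 0 := by
  rw [vacuum, lp.inner_single_left, creation_apply_zero, inner_zero_right]

theorem star_creation_vacuum (ξ : H) : star (creation ξ) (vacuum H) = 0 := by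
  refine ext_inner_right ℂ fun g => ?_
  rw [inner_star_creation, inner_vacuum_creation, inner_zero_left]

theorem inner_vacuum_vacuum : ⟪vacuum H, vacuum H⟫_ℂ = 1 := by
  rw [vacuum, lp.inner_single_left, lp.single_apply_self]
  show ⟪(EuclideanSpace.single PUnit.unit (1 : ℂ) : EuclideanSpace ℂ PUnit),
    (EuclideanSpace.single PUnit.unit (1 : ℂ) : EuclideanSpace ℂ PUnit)⟫_ℂ = 1
  simp

theorem creation_single (ξ : H) (n : ℕ) (x : (tensorPower H n).carrier) :
    creation ξ (lp.single 2 n x) = lp.single 2 (n + 1) (tensorLeft ξ n x) := by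
  ext m
  cases m with
  | zero => rw [creation_apply_zero, lp.single_apply_ne _ _ _ (by simp)]
  | succ m =>
    rw [creation_apply_succ]
    by_cases h : m = n
    · subst h; rw [lp.single_apply_self, lp.single_apply_self]
    · rw [lp.single_apply_ne _ _ _ h, lp.single_apply_ne _ _ _ (by simpa using h), map_zero]

/-- A closed subspace which contains the vacuum and is invariant under a total set of creation
operators is everything. -/
theorem eq_top_of_creation_invariant (M : Submodule ℂ (FockSpace H))
    (hM : IsClosed (M : Set (FockSpace H))) (h0 : vacuum H ∈ M)
    {s : Set H} (hs : Dense (Submodule.span ℂ s : Set H))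
    (h : ∀ ξ ∈ s, ∀ f ∈ M, creation ξ f ∈ M) : M = ⊤ := by
  have hspan : ∀ ξ ∈ Submodule.span ℂ s, ∀ f ∈ M, creation ξ f ∈ M := by
    intro ξ hξ f hf
    induction hξ using Submodule.span_induction with
    | mem ξ hξ => exact h ξ hξ f hf
    | zero =>
      have : creation (0 : H) f = 0 := by rw [← norm_eq_zero, norm_creation_apply]; simp
      rw [this]; exact M.zero_mem
    | add ξ ζ _ _ h1 h2 => rw [creation_add]; exact M.add_mem h1 h2
    | smul c ξ _ h1 => rw [creation_smul]; exact M.smul_mem c h1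
  have hall : ∀ (ξ : H), ∀ f ∈ M, creation ξ f ∈ M := by
    intro ξ f hf
    have hcl : IsClosed {ξ : H | creation ξ f ∈ M} := by
      refine hM.preimage (f := fun ξ : H => creation ξ f) ?_
      exact ((ContinuousLinearMap.apply ℂ (FockSpace H) f).comp (creationL H)).continuous
    have hsub : (Submodule.span ℂ s : Set H) ⊆ {ξ : H | creation ξ f ∈ M} :=
      fun ξ hξ => hspan ξ hξ f hf
    exact (hcl.closure_subset_iff.2 hsub) (hs ξ)
  have hsingle : ∀ (n : ℕ) (x : (tensorPower H n).carrier),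
      (lp.single 2 n x : FockSpace H) ∈ M := by
    intro n
    induction n with
    | zero =>
      intro x
      have key : ∀ y : EuclideanSpace ℂ PUnit.{u + 1},
          y = y PUnit.unit • EuclideanSpace.single PUnit.unit (1 : ℂ) := by
        intro y; ext i; cases i; simp
      have hx : x = (WithLp.ofLp (p := 2) (V := PUnit.{u + 1} → ℂ) x PUnit.unit) • tensorUnit H :=
        key x
      rw [hx, lp.single_smul]
      exact M.smul_mem _ h0
    | succ n ih =>
      intro x
      have hcl : IsClosed {x : (tensorPower H (n + 1)).carrier |
          (lp.single 2 (n + 1) x : FockSpace H) ∈ M} := by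
        refine hM.preimage (f := fun x => (lp.single 2 (n + 1) x : FockSpace H)) ?_
        exact (lp.isometry_single (E := fun n => (tensorPower H n).carrier) (p := 2) (n + 1)).continuous
      refine UniformSpace.Completion.induction_on (p := fun x =>
        (lp.single 2 (n + 1) x : FockSpace H) ∈ M) x hcl fun y => ?_
      induction y using TensorProduct.induction_on with
      | zero =>
        have : (lp.single 2 (n + 1) (0 : (tensorPower H (n + 1)).carrier) : FockSpace H) ∈ M := by
          rw [lp.single_zero]; exact M.zero_mem
        exact this
      | tmul ξ y =>
        have := hall ξ _ (ih y)
        rw [creation_single] at this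
        exact this
      | add y z hy hz =>
        have h1 : ∀ y z : (tensorPower H (n + 1)).carrier, (lp.single 2 (n + 1) y : FockSpace H) ∈ M →
            (lp.single 2 (n + 1) z : FockSpace H) ∈ M →
            (lp.single 2 (n + 1) (y + z) : FockSpace H) ∈ M := by
          intro y z hy hz
          rw [lp.single_add]
          exact M.add_mem hy hz
        have h2 := h1 _ _ hy hz
        rw [UniformSpace.Completion.coe_add]
        exact h2
  rw [eq_top_iff]
  intro f _
  have hf := lp.hasSum_single (p := 2) (by norm_num) f
  exact hM.mem_of_tendsto hf (Eventually.of_forall fun s => M.sum_mem fun n _ => hsingle n (f n))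

end FockBasics

/-! ### The Hilbert basis of words -/

section Basis

variable {H : Type u} [NormedAddCommGroup H] [InnerProductSpace ℂ H] {κ : Type*}

@[simp] theorem elementaryTensor_nil : elementaryTensor ([] : List H) = vacuum H := rfl

@[simp] theorem elementaryTensor_cons (ξ : H) (l : List H) :
    elementaryTensor (ξ :: l) = creation ξ (elementaryTensor l) := rfl

theorem orthonormal_words {b : κ → H} (hb : Orthonormal ℂ b) :
    Orthonormal ℂ fun w : List κ => elementaryTensor (w.map b) := by
  classical
  rw [orthonormal_iff_ite]
  intro w
  induction w with
  | nil =>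
    rintro (_ | ⟨i, w'⟩)
    · simpa using inner_vacuum_vacuum
    · simpa using inner_vacuum_creation _ _
  | cons i w ih =>
    rintro (_ | ⟨i', w'⟩)
    · have := inner_vacuum_creation (b i) (elementaryTensor (w.map b))
      rw [← inner_conj_symm]
      simp [this]
    · have h1 := orthonormal_iff_ite.1 hb i i'
      simp only [List.map_cons, elementaryTensor_cons, inner_creation_creation, ih, h1]
      by_cases h : i = i' <;> by_cases h' : w = w' <;> simp [h, h']

/-- The elementary tensors with entries in a total set are total. -/
theorem span_elementaryTensor_closure {s : Set H} (hs : Dense (Submodule.span ℂ s : Set H)) :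
    (Submodule.span ℂ {f | ∃ l : List H, (∀ v ∈ l, v ∈ s) ∧
      elementaryTensor l = f}).topologicalClosure = ⊤ := by
  set M := Submodule.span ℂ {f | ∃ l : List H, (∀ v ∈ l, v ∈ s) ∧ elementaryTensor l = f}
  refine eq_top_of_creation_invariant _ M.isClosed_topologicalClosure ?_ hs ?_
  · exact M.le_topologicalClosure (Submodule.subset_span ⟨[], by simp, rfl⟩)
  · intro ξ hξ f hf
    have hle : M ≤ M.topologicalClosure.comap (creation ξ : FockSpace H →ₗ[ℂ] FockSpace H) := by
      refine Submodule.span_le.2 ?_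
      rintro _ ⟨l, hl, rfl⟩
      exact M.le_topologicalClosure (Submodule.subset_span ⟨ξ :: l, by simpa using ⟨hξ, hl⟩, rfl⟩)
    have hcl : IsClosed ((M.topologicalClosure.comap
        (creation ξ : FockSpace H →ₗ[ℂ] FockSpace H) : Submodule ℂ (FockSpace H)) :
          Set (FockSpace H)) :=
      M.isClosed_topologicalClosure.preimage (creation ξ).continuous
    exact Submodule.topologicalClosure_minimal _ hle hcl hf

theorem span_words_closure (b : HilbertBasis κ ℂ H) :
    (Submodule.span ℂ (Set.range fun w : List κ => elementaryTensor (w.map b))).topologicalClosure =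
      ⊤ := by
  rw [← span_elementaryTensor_closure (s := Set.range b)
    (Submodule.dense_iff_topologicalClosure_eq_top.2 b.dense_span)]
  congr 2
  ext f
  constructor
  · rintro ⟨w, rfl⟩
    exact ⟨w.map b, by simp, rfl⟩
  · rintro ⟨l, hl, rfl⟩
    obtain ⟨w, rfl⟩ : l ∈ Set.range (List.map b) := by
      rw [Set.range_list_map]; exact hl
    exact ⟨w, rfl⟩

/-- The Hilbert basis of the Fock space given by the words in a Hilbert basis of `H`. -/
def fockBasis [CompleteSpace H] (b : HilbertBasis κ ℂ H) : HilbertBasis (List κ) ℂ (FockSpace H) :=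
  HilbertBasis.mk (orthonormal_words b.orthonormal) (span_words_closure b).ge

theorem fockBasis_apply [CompleteSpace H] (b : HilbertBasis κ ℂ H) (w : List κ) :
    fockBasis b w = elementaryTensor (w.map b) := by
  rw [fockBasis, HilbertBasis.coe_mk]

@[simp] theorem fockBasis_nil [CompleteSpace H] (b : HilbertBasis κ ℂ H) :
    fockBasis b [] = vacuum H := fockBasis_apply b []

theorem fockBasis_cons [CompleteSpace H] (b : HilbertBasis κ ℂ H) (i : κ) (w : List κ) :
    fockBasis b (i :: w) = creation (b i) (fockBasis b w) := by
  rw [fockBasis_apply, fockBasis_apply]; rfl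

theorem star_creation_fockBasis [CompleteSpace H] [DecidableEq κ] (b : HilbertBasis κ ℂ H)
    (i j : κ) (w : List κ) :
    star (creation (b i)) (fockBasis b (j :: w)) = if i = j then fockBasis b w else 0 := by
  rw [fockBasis_cons, star_creation_creation, orthonormal_iff_ite.1 b.orthonormal]
  split_ifs <;> simp

end Basis

/-! ### Isometries defined on a Hilbert basis -/

section BasisIsometry

variable {κ F G : Type*} [NormedAddCommGroup F] [InnerProductSpace ℂ F]
  [NormedAddCommGroup G] [InnerProductSpace ℂ G] [CompleteSpace G]

theorem exists_isometry_of_orthonormal (B : HilbertBasis κ ℂ F) {v : κ → G}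
    (hv : Orthonormal ℂ v) : ∃ T : F →ₗᵢ[ℂ] G, ∀ i, T (B i) = v i := by
  classical
  refine ⟨hv.orthogonalFamily.linearIsometry.comp B.repr.toLinearIsometry, fun i => ?_⟩
  simp [B.repr_self, OrthogonalFamily.linearIsometry_apply_single]

theorem clm_ext_basis {M : Type*} [TopologicalSpace M] [T2Space M] [AddCommMonoid M] [Module ℂ M]
    (B : HilbertBasis κ ℂ F) {S T : F →L[ℂ] M} (h : ∀ i, S (B i) = T (B i)) : S = T := by
  refine ContinuousLinearMap.ext_on
    (Submodule.dense_iff_topologicalClosure_eq_top.2 B.dense_span) ?_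
  rintro _ ⟨i, rfl⟩
  exact h i

end BasisIsometry

/-! ### Right creation operators -/

section Right

variable {H : Type u} [NormedAddCommGroup H] [InnerProductSpace ℂ H] [CompleteSpace H]

variable {κ : Type*} (b : HilbertBasis κ ℂ H)

/-- The tensor powers are built by tensoring on the left only. Right creation is obtained from left
creation by reversing words in a fixed basis. -/
theorem exists_flip : ∃ T : FockSpace H →ₗᵢ[ℂ] FockSpace H,
    ∀ w, T (fockBasis b w) = fockBasis b w.reverse :=
  exists_isometry_of_orthonormal (fockBasis b)
    ((fockBasis b).orthonormal.comp _ List.reverse_injective)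

/-- The unitary reversing words. -/
def flip : FockSpace H →L[ℂ] FockSpace H := (exists_flip b).choose.toContinuousLinearMap

@[simp] theorem flip_fockBasis (w : List κ) : flip b (fockBasis b w) = fockBasis b w.reverse :=
  (exists_flip b).choose_spec w

@[simp] theorem flip_vacuum : flip b (vacuum H) = vacuum H := by
  simpa using flip_fockBasis b []

@[simp] theorem flip_flip (f : FockSpace H) : flip b (flip b f) = f := by
  have : (flip b).comp (flip b) = ContinuousLinearMap.id ℂ _ :=
    clm_ext_basis (fockBasis b) fun w => by simp
  exact congrArg (fun T : FockSpace H →L[ℂ] FockSpace H => T f) this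

theorem inner_flip (f g : FockSpace H) : ⟪flip b f, g⟫_ℂ = ⟪f, flip b g⟫_ℂ := by
  conv_lhs => rw [← flip_flip b g]
  exact (exists_flip b).choose.inner_map_map _ _

theorem star_flip : star (flip b) = flip b := by
  rw [ContinuousLinearMap.star_eq_adjoint, eq_comm, ContinuousLinearMap.eq_adjoint_iff]
  exact inner_flip b

/-- The right creation operators. -/
def rightCreation (η : H) : FockSpace H →L[ℂ] FockSpace H := flip b * creation η * flip b

theorem star_rightCreation (η : H) :
    star (rightCreation b η) = flip b * star (creation η) * flip b := by
  rw [rightCreation, star_mul, star_mul, star_flip, mul_assoc]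

theorem rightCreation_fockBasis (i : κ) (w : List κ) :
    rightCreation b (b i) (fockBasis b w) = fockBasis b (w ++ [i]) := by
  show flip b (creation (b i) (flip b (fockBasis b w))) = _
  rw [flip_fockBasis, ← fockBasis_cons, flip_fockBasis]
  simp

theorem star_rightCreation_fockBasis [DecidableEq κ] (i j : κ) (w : List κ) :
    star (rightCreation b (b i)) (fockBasis b (w ++ [j])) = if i = j then fockBasis b w else 0 := by
  rw [star_rightCreation]
  show flip b (star (creation (b i)) (flip b (fockBasis b (w ++ [j])))) = _
  rw [flip_fockBasis, List.reverse_append, List.reverse_singleton, List.singleton_append,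
    star_creation_fockBasis]
  split_ifs <;> simp

theorem star_rightCreation_vacuum (η : H) : star (rightCreation b η) (vacuum H) = 0 := by
  rw [star_rightCreation]
  show flip b (star (creation η) (flip b (vacuum H))) = _
  rw [flip_vacuum, star_creation_vacuum, map_zero]

/-- Right creation as a bounded linear map. -/
def rightCreationL : H →L[ℂ] (FockSpace H →L[ℂ] FockSpace H) :=
  (((ContinuousLinearMap.mul ℂ (FockSpace H →L[ℂ] FockSpace H)).flip (flip b)).comp
    (ContinuousLinearMap.mul ℂ (FockSpace H →L[ℂ] FockSpace H) (flip b))).comp (creationL H)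

theorem creation_mul_rightCreation (ξ η : H) :
    creation ξ * rightCreation b η = rightCreation b η * creation ξ := by
  have key : ∀ i j, creation (b i) * rightCreation b (b j) =
      rightCreation b (b j) * creation (b i) := by
    intro i j
    refine clm_ext_basis (fockBasis b) fun w => ?_
    show creation (b i) (rightCreation b (b j) _) = rightCreation b (b j) (creation (b i) _)
    rw [rightCreation_fockBasis, ← fockBasis_cons, ← fockBasis_cons, rightCreation_fockBasis]
    rfl
  have key2 : ∀ j, creation ξ * rightCreation b (b j) = rightCreation b (b j) * creation ξ := by
    intro j
    have : ((ContinuousLinearMap.mul ℂ (FockSpace H →L[ℂ] FockSpace H)).flip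
        (rightCreation b (b j))).comp (creationL H) =
        (ContinuousLinearMap.mul ℂ (FockSpace H →L[ℂ] FockSpace H)
        (rightCreation b (b j))).comp (creationL H) := clm_ext_basis b fun i => key i j
    exact congrArg (fun T : H →L[ℂ] (FockSpace H →L[ℂ] FockSpace H) => T ξ) this
  have : (ContinuousLinearMap.mul ℂ (FockSpace H →L[ℂ] FockSpace H)
      (creation ξ)).comp (rightCreationL b) =
      ((ContinuousLinearMap.mul ℂ (FockSpace H →L[ℂ] FockSpace H)).flip
      (creation ξ)).comp (rightCreationL b) := clm_ext_basis b fun j => key2 j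
  exact congrArg (fun T : H →L[ℂ] (FockSpace H →L[ℂ] FockSpace H) => T η) this

variable (H) in
/-- The projection onto the vacuum. -/
def vacuumProj : FockSpace H →L[ℂ] FockSpace H := (innerSL ℂ (vacuum H)).smulRight (vacuum H)

theorem vacuumProj_apply (f : FockSpace H) : vacuumProj H f = ⟪vacuum H, f⟫_ℂ • vacuum H := rfl

theorem star_vacuumProj : star (vacuumProj H) = vacuumProj H := by
  rw [ContinuousLinearMap.star_eq_adjoint, eq_comm, ContinuousLinearMap.eq_adjoint_iff]
  intro f g
  rw [vacuumProj_apply, vacuumProj_apply, inner_smul_left, inner_smul_right, inner_conj_symm,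
    mul_comm]

/-- Adding a first letter and removing the last one commute unless the word is empty, when the
letter just added is the one removed. This is checked on basis vectors and extended in ξ and η. -/
theorem star_rightCreation_mul_creation (ξ η : H) :
    star (rightCreation b η) * creation ξ =
      creation ξ * star (rightCreation b η) + ⟪η, ξ⟫_ℂ • vacuumProj H := by
  classical
  have key : ∀ i j, star (rightCreation b (b j)) * creation (b i) =
      creation (b i) * star (rightCreation b (b j)) + ⟪b j, b i⟫_ℂ • vacuumProj H := by
    intro i j
    refine clm_ext_basis (fockBasis b) fun w => ?_
    show star (rightCreation b (b j)) (creation (b i) _) =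
      creation (b i) (star (rightCreation b (b j)) _) + ⟪b j, b i⟫_ℂ • vacuumProj H _
    rw [← fockBasis_cons, vacuumProj_apply, ← fockBasis_nil b,
      orthonormal_iff_ite.1 (fockBasis b).orthonormal, orthonormal_iff_ite.1 b.orthonormal]
    rcases List.eq_nil_or_concat w with rfl | ⟨w, k, rfl⟩
    · have := star_rightCreation_fockBasis b j i []
      rw [List.nil_append] at this
      rw [this, fockBasis_nil, star_rightCreation_vacuum]
      split_ifs <;> simp_all
    · rw [List.concat_eq_append, ← List.cons_append, star_rightCreation_fockBasis,
        star_rightCreation_fockBasis, fockBasis_cons]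
      split_ifs <;> simp_all
  have key2 : ∀ j, star (rightCreation b (b j)) * creation ξ =
      creation ξ * star (rightCreation b (b j)) + ⟪b j, ξ⟫_ℂ • vacuumProj H := by
    intro j
    have : (ContinuousLinearMap.mul ℂ (FockSpace H →L[ℂ] FockSpace H)
        (star (rightCreation b (b j)))).comp (creationL H) =
        ((ContinuousLinearMap.mul ℂ (FockSpace H →L[ℂ] FockSpace H)).flip
        (star (rightCreation b (b j)))).comp (creationL H) +
          (innerSL ℂ (b j)).smulRight (vacuumProj H) := clm_ext_basis b fun i => key i j
    exact congrArg (fun T : H →L[ℂ] (FockSpace H →L[ℂ] FockSpace H) => T ξ) this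
  -- The adjoint relation is linear in the right vector, whereas the original one is antilinear in
  -- it; only a linear relation can be extended from the basis by `clm_ext_basis`.
  have key3 : ∀ j, star (creation ξ) * rightCreation b (b j) =
      rightCreation b (b j) * star (creation ξ) + ⟪ξ, b j⟫_ℂ • vacuumProj H := by
    intro j
    have := congrArg star (key2 j)
    rw [star_mul, star_add, star_mul, star_star, star_smul, star_vacuumProj] at this
    rw [this]
    congr 2
    exact inner_conj_symm _ _
  have key4 : star (creation ξ) * rightCreation b η =
      rightCreation b η * star (creation ξ) + ⟪ξ, η⟫_ℂ • vacuumProj H := by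
    have : (ContinuousLinearMap.mul ℂ (FockSpace H →L[ℂ] FockSpace H)
        (star (creation ξ))).comp (rightCreationL b) =
        ((ContinuousLinearMap.mul ℂ (FockSpace H →L[ℂ] FockSpace H)).flip
        (star (creation ξ))).comp (rightCreationL b) +
          (innerSL ℂ ξ).smulRight (vacuumProj H) := clm_ext_basis b fun j => key3 j
    exact congrArg (fun T : H →L[ℂ] (FockSpace H →L[ℂ] FockSpace H) => T η) this
  have := congrArg star key4
  rw [star_mul, star_add, star_mul, star_star, star_smul, star_vacuumProj] at this
  rw [this]
  congr 2
  exact inner_conj_symm _ _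

/-- Left and right field operators commute if the inner product of the vectors is real. -/
theorem commute_field {ξ η : H} (h : ⟪ξ, η⟫_ℂ = ⟪η, ξ⟫_ℂ) :
    Commute (creation ξ + star (creation ξ)) (rightCreation b η + star (rightCreation b η)) := by
  have h1 := creation_mul_rightCreation b ξ η
  have h2 := congrArg star h1
  rw [star_mul, star_mul] at h2
  have h3 := star_rightCreation_mul_creation b ξ η
  have h4 := congrArg star h3
  rw [star_mul, star_add, star_mul, star_star, star_smul, star_vacuumProj] at h4
  -- Each of the two products of fields acquires one multiple of the vacuum projection. The
  -- coefficients are ⟪η, ξ⟫ and its conjugate, so reality is exactly what is needed.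
  have e : star ⟪η, ξ⟫_ℂ = ⟪η, ξ⟫_ℂ := (inner_conj_symm ξ η).trans h
  rw [e] at h4
  rw [Commute, SemiconjBy, add_mul, mul_add, mul_add, add_mul, mul_add, mul_add, h3, h4, h1, h2]
  abel

/-- An operator commuting with sufficiently many right field operators is determined by its value
on the vacuum. -/
theorem eq_zero_of_commute {s : Set H} (hs : Dense (Submodule.span ℂ s : Set H))
    {x : FockSpace H →L[ℂ] FockSpace H}
    (hx : ∀ η ∈ s, Commute x (rightCreation b η + star (rightCreation b η)))
    (h0 : x (vacuum H) = 0) : x = 0 := by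
  have key : ∀ l : List H, (∀ v ∈ l, v ∈ s) → x (flip b (elementaryTensor l)) = 0 := by
    -- The field of η sends the reversed tensor of l to that of η :: l plus a multiple of that of
    -- the tail of l, so the induction needs two consecutive words.
    suffices h : ∀ l : List H, (∀ v ∈ l, v ∈ s) → x (flip b (elementaryTensor l)) = 0 ∧
        x (flip b (elementaryTensor l.tail)) = 0 from fun l hl => (h l hl).1
    intro l
    induction l with
    | nil => intro _; simp [h0]
    | cons η l ih =>
      intro hl
      have hη : η ∈ s := hl η (by simp)
      obtain ⟨ih1, ih2⟩ := ih fun v hv => hl v (by simp [hv])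
      refine ⟨?_, ih1⟩
      have hcomm := congrArg (fun T : FockSpace H →L[ℂ] FockSpace H =>
        T (flip b (elementaryTensor l))) (hx η hη).eq
      have e1 : (rightCreation b η + star (rightCreation b η)) (flip b (elementaryTensor l)) =
          flip b (elementaryTensor (η :: l)) + flip b (star (creation η) (elementaryTensor l)) := by
        rw [star_rightCreation]
        show flip b (creation η (flip b (flip b _))) + flip b (star (creation η) (flip b (flip b _))) = _
        rw [flip_flip]; rfl
      have e2 : x (flip b (star (creation η) (elementaryTensor l))) = 0 := by
        cases l with
        | nil => simp [star_creation_vacuum]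
        | cons ζ l =>
          rw [elementaryTensor_cons, star_creation_creation, map_smul, map_smul]
          rw [List.tail_cons] at ih2
          rw [ih2, smul_zero]
      have e3 : x ((rightCreation b η + star (rightCreation b η)) (flip b (elementaryTensor l))) =
          (rightCreation b η + star (rightCreation b η)) (x (flip b (elementaryTensor l))) := hcomm
      rw [ih1, map_zero, e1, map_add, e2, add_zero] at e3
      exact e3
  have hz : x * flip b = 0 := by
    refine ContinuousLinearMap.ext_on
      (Submodule.dense_iff_topologicalClosure_eq_top.2 (span_elementaryTensor_closure hs)) ?_
    rintro _ ⟨l, hl, rfl⟩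
    exact key l hl
  ext1 f
  have := congrArg (fun T : FockSpace H →L[ℂ] FockSpace H => T (flip b f)) hz
  simpa using this

end Right

/-! ### Wick words -/

section CreationWords

variable {H : Type u} [NormedAddCommGroup H] [InnerProductSpace ℂ H] [CompleteSpace H]

/-- The product `ℓ(ξ₁) ⋯ ℓ(ξₙ)`. -/
def creationWord : List H → (FockSpace H →L[ℂ] FockSpace H)
  | [] => 1
  | ξ :: l => creation ξ * creationWord l

/-- The product `ℓ(ξ₁)^* ⋯ ℓ(ξₙ)^*`. -/
def annihilationWord : List H → (FockSpace H →L[ℂ] FockSpace H)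
  | [] => 1
  | ξ :: l => star (creation ξ) * annihilationWord l

theorem creationWord_append (l l' : List H) :
    creationWord (l ++ l') = creationWord l * creationWord l' := by
  induction l with
  | nil => simp [creationWord]
  | cons ξ l ih => rw [List.cons_append, creationWord, ih, creationWord, mul_assoc]

theorem annihilationWord_vacuum (ξ : H) (l : List H) :
    annihilationWord (ξ :: l) (vacuum H) = 0 := by
  induction l generalizing ξ with
  | nil => simpa [annihilationWord] using star_creation_vacuum ξ
  | cons ζ l ih =>
    rw [annihilationWord]
    show star (creation ξ) (annihilationWord (ζ :: l) (vacuum H)) = 0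
    rw [ih, map_zero]

theorem star_creation_mul_creation (ξ ζ : H) :
    star (creation ξ) * creation ζ = ⟪ξ, ζ⟫_ℂ • (1 : FockSpace H →L[ℂ] FockSpace H) := by
  ext1 f
  exact star_creation_creation ξ ζ f

end CreationWords

/-! ### Wick words in the free Araki-Woods algebra and the separating vacuum -/

namespace OrthogonalGroup

open Complexification (re im ofReal conj)

variable {E : Type u} [NormedAddCommGroup E] [InnerProductSpace ℝ E] [CompleteSpace E]
  (U : OrthogonalGroup E)

/-- The Wick word `W(S x₁ ⊗ ⋯ ⊗ S xₙ)`. -/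
def wick : List (Complexification E) →
    (FockSpace (Complexification E) →L[ℂ] FockSpace (Complexification E))
  | [] => 1
  | x :: l => creation (U.embeddingOperator x) * wick l +
      annihilationWord ((x :: l).map fun y => U.embeddingOperator (conj y))

@[simp] theorem wick_nil : U.wick [] = 1 := rfl

theorem wick_cons (x : Complexification E) (l : List (Complexification E)) :
    U.wick (x :: l) = creation (U.embeddingOperator x) * U.wick l +
      annihilationWord ((x :: l).map fun y => U.embeddingOperator (conj y)) := rfl

theorem wick_vacuum (l : List (Complexification E)) :
    U.wick l (vacuum _) = elementaryTensor (l.map U.embeddingOperator) := by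
  induction l with
  | nil => rfl
  | cons x l ih =>
    rw [wick_cons, List.map_cons]
    show creation (U.embeddingOperator x) (U.wick l (vacuum _)) + annihilationWord _ (vacuum _) = _
    rw [annihilationWord_vacuum, add_zero, ih]
    rfl

/-- The complex linear extension of the field operator. -/
def field (x : Complexification E) :
    FockSpace (Complexification E) →L[ℂ] FockSpace (Complexification E) :=
  creation (U.embeddingOperator x) + star (creation (U.embeddingOperator (conj x)))

theorem field_mul_wick_nil (x : Complexification E) : U.field x * U.wick [] = U.wick [x] := by
  simp [wick_cons, field, annihilationWord]

/-- The annihilation part of the field contracts with the leading creator and otherwise lengthens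
the purely annihilating term. Read in one direction, the formula puts Wick words into the algebra;
in the other, it makes their span invariant under the fields. -/
theorem field_mul_wick_cons (x y : Complexification E) (l : List (Complexification E)) :
    U.field x * U.wick (y :: l) = U.wick (x :: y :: l) +
      ⟪U.embeddingOperator (conj x), U.embeddingOperator y⟫_ℂ • U.wick l := by
  have h : star (creation (U.embeddingOperator (conj x))) * U.wick (y :: l) =
      ⟪U.embeddingOperator (conj x), U.embeddingOperator y⟫_ℂ • U.wick l +
        annihilationWord ((x :: y :: l).map fun y => U.embeddingOperator (conj y)) := by
    rw [wick_cons, mul_add, ← mul_assoc, star_creation_mul_creation, smul_mul_assoc, one_mul]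
    rfl
  rw [field, add_mul, h, wick_cons U x]
  abel

theorem field_eq (x : Complexification E) :
    U.field x = (2 : ℂ) • realPart (U.j (re x)) + (2 * Complex.I) • realPart (U.j (im x)) := by
  have h1 : U.embeddingOperator x = U.j (re x) + Complex.I • U.j (im x) := by
    conv_lhs => rw [Complexification.eq_ofReal_add x]
    simp [j]
  have h2 : U.embeddingOperator (conj x) = U.j (re x) + (-Complex.I) • U.j (im x) := by
    conv_lhs => rw [Complexification.eq_ofReal_add (conj x)]
    have : ofReal (-im x) = -ofReal (im x) := by
      rw [← neg_one_smul ℝ (im x), Complexification.ofReal_smul]; simp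
    simp [j, this]
  rw [field, h1, h2, creation_add, creation_add, creation_smul, creation_smul, star_add, star_smul,
    realPart, realPart]
  simp only [smul_add, smul_smul, Complex.star_def, map_neg, Complex.conj_I, neg_neg]
  rw [show (2 : ℂ) * (1 / 2) = 1 by norm_num, show 2 * Complex.I * (1 / 2) = Complex.I by ring,
    one_smul, one_smul]
  abel

theorem field_ofReal (ζ : E) : U.field (ofReal ζ) = creation (U.j ζ) + star (creation (U.j ζ)) := by
  rw [field, Complexification.conj_ofReal]; rfl

theorem star_realPart {H : Type u} [NormedAddCommGroup H] [InnerProductSpace ℂ H] [CompleteSpace H]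
    (ξ : H) : star (realPart ξ) = realPart ξ := by
  rw [realPart, star_smul, star_add, star_star, add_comm]
  congr 1
  simp

theorem mem_adjoin_iff {a : FockSpace (Complexification E) →L[ℂ] FockSpace (Complexification E)} :
    a ∈ StarAlgebra.adjoin ℂ (realPart '' U.realSubspace) ↔
      a ∈ Algebra.adjoin ℂ (realPart '' U.realSubspace) := by
  have hs : star (realPart '' U.realSubspace) = realPart '' U.realSubspace := by
    ext a
    constructor
    · rintro ⟨ξ, hξ, h⟩
      refine ⟨ξ, hξ, ?_⟩
      rw [← star_realPart, h, star_star]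
    · rintro ⟨ξ, hξ, rfl⟩
      exact ⟨ξ, hξ, (star_realPart ξ).symm⟩
  rw [← StarSubalgebra.mem_toSubalgebra, StarAlgebra.adjoin_toSubalgebra, hs, Set.union_self]

theorem field_mem_adjoin (x : Complexification E) :
    U.field x ∈ StarAlgebra.adjoin ℂ (realPart '' U.realSubspace) := by
  rw [field_eq]
  refine add_mem (SMulMemClass.smul_mem _ ?_) (SMulMemClass.smul_mem _ ?_)
  · exact StarAlgebra.subset_adjoin ℂ _ ⟨_, ⟨_, rfl⟩, rfl⟩
  · exact StarAlgebra.subset_adjoin ℂ _ ⟨_, ⟨_, rfl⟩, rfl⟩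

theorem wick_mem_adjoin (l : List (Complexification E)) :
    U.wick l ∈ StarAlgebra.adjoin ℂ (realPart '' U.realSubspace) := by
  suffices h : U.wick l ∈ StarAlgebra.adjoin ℂ (realPart '' U.realSubspace) ∧
      U.wick l.tail ∈ StarAlgebra.adjoin ℂ (realPart '' U.realSubspace) from h.1
  induction l with
  | nil => exact ⟨one_mem _, one_mem _⟩
  | cons x l ih =>
    refine ⟨?_, ih.1⟩
    have hf := mul_mem (U.field_mem_adjoin x) ih.1
    cases l with
    | nil => rwa [field_mul_wick_nil] at hf
    | cons y l =>
      have h2 := sub_mem hf (SMulMemClass.smul_mem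
        ⟪U.embeddingOperator (conj x), U.embeddingOperator y⟫_ℂ ih.2)
      rw [field_mul_wick_cons] at h2
      simpa using h2

theorem wick_mem (l : List (Complexification E)) : U.wick l ∈ ArakiWoodsAlgebra U :=
  StarSubalgebra.le_topologicalClosure _ (U.wick_mem_adjoin l)

/-- The span of the Wick words contains 1 and is invariant under left multiplication by the
generators. -/
theorem mem_span_wick {a : FockSpace (Complexification E) →L[ℂ] FockSpace (Complexification E)}
    (ha : a ∈ StarAlgebra.adjoin ℂ (realPart '' U.realSubspace)) :
    a ∈ Submodule.span ℂ (Set.range U.wick) := by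
  rw [mem_adjoin_iff] at ha
  have hfield : ∀ x, ∀ w ∈ Submodule.span ℂ (Set.range U.wick),
      U.field x * w ∈ Submodule.span ℂ (Set.range U.wick) := by
    intro x w hw
    induction hw using Submodule.span_induction with
    | mem w hw =>
      obtain ⟨l, rfl⟩ := hw
      cases l with
      | nil => rw [field_mul_wick_nil]; exact Submodule.subset_span ⟨_, rfl⟩
      | cons y l =>
        rw [field_mul_wick_cons]
        exact Submodule.add_mem _ (Submodule.subset_span ⟨_, rfl⟩)
          (Submodule.smul_mem _ _ (Submodule.subset_span ⟨_, rfl⟩))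
    | zero => rw [mul_zero]; exact Submodule.zero_mem _
    | add v w _ _ h1 h2 => rw [mul_add]; exact Submodule.add_mem _ h1 h2
    | smul c w _ h => rw [mul_smul_comm]; exact Submodule.smul_mem _ _ h
  suffices h : ∀ w ∈ Submodule.span ℂ (Set.range U.wick),
      a * w ∈ Submodule.span ℂ (Set.range U.wick) by
    simpa using h 1 (Submodule.subset_span ⟨[], rfl⟩)
  induction ha using Algebra.adjoin_induction with
  | mem a ha =>
    obtain ⟨_, ⟨ζ, rfl⟩, rfl⟩ := ha
    intro w hw
    have : realPart (U.j ζ) = (1 / 2 : ℂ) • U.field (ofReal ζ) := by rw [field_ofReal]; rfl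
    rw [this, smul_mul_assoc]
    exact Submodule.smul_mem _ _ (hfield _ w hw)
  | algebraMap r =>
    intro w hw
    rw [← Algebra.smul_def]
    exact Submodule.smul_mem _ _ hw
  | add a c _ _ h1 h2 =>
    intro w hw
    rw [add_mul]
    exact Submodule.add_mem _ (h1 w hw) (h2 w hw)
  | mul a c _ _ h1 h2 =>
    intro w hw
    rw [mul_assoc]
    exact h1 _ (h2 w hw)

theorem mem_closure_span_wick
    {a : FockSpace (Complexification E) →L[ℂ] FockSpace (Complexification E)}
    (ha : a ∈ ArakiWoodsAlgebra U) :
    a ∈ closure (Submodule.span ℂ (Set.range U.wick) :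
      Set (FockSpace (Complexification E) →L[ℂ] FockSpace (Complexification E))) :=
  closure_mono (fun _ h => U.mem_span_wick h) ha

theorem dense_span_dual : Dense (Submodule.span ℂ (Set.range fun η : E =>
    U.dualOperator (ofReal η)) : Set (Complexification E)) := by
  refine U.denseRange_dualOperator.mono ?_
  rintro _ ⟨x, rfl⟩
  rw [Complexification.eq_ofReal_add x, ContinuousLinearMap.map_add, ContinuousLinearMap.map_smul]
  exact Submodule.add_mem _ (Submodule.subset_span ⟨_, rfl⟩)
    (Submodule.smul_mem _ _ (Submodule.subset_span ⟨_, rfl⟩))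

/-- The vacuum is separating for the free Araki-Woods algebra. -/
theorem eq_zero_of_vacuum
    {a : FockSpace (Complexification E) →L[ℂ] FockSpace (Complexification E)}
    (ha : a ∈ ArakiWoodsAlgebra U) (h0 : a (vacuum _) = 0) : a = 0 := by
  obtain ⟨s, b, -⟩ := exists_hilbertBasis ℂ (Complexification E)
  refine eq_zero_of_commute b U.dense_span_dual ?_ h0
  rintro _ ⟨η, rfl⟩
  set R := rightCreation b (U.dualOperator (ofReal η)) +
    star (rightCreation b (U.dualOperator (ofReal η))) with hR
  have hcl : IsClosed {a : FockSpace (Complexification E) →L[ℂ] FockSpace (Complexification E) |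
      Commute a R} := isClosed_eq (by fun_prop) (by fun_prop)
  refine hcl.closure_subset_iff.2 ?_ ha
  intro a ha
  have ha' := U.mem_adjoin_iff.1 ha
  clear ha
  -- Right fields of the vectors S(2 − S²)η, with η real, commute with every generator because the
  -- inner products involved are real; by `dense_span_dual` there are enough of them.
  show Commute a R
  induction ha' using Algebra.adjoin_induction with
  | mem a ha =>
    obtain ⟨_, ⟨ζ, rfl⟩, rfl⟩ := ha
    exact (commute_field b (U.inner_dualOperator_j ζ η).symm).smul_left _
  | algebraMap r => exact Algebra.commutes r R
  | add a c ha hc h1 h2 =>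
    exact h1.add_left h2
  | mul a c ha hc h1 h2 =>
    exact h1.mul_left h2

theorem exists_map_embeddingOperator {e : List (Complexification E)}
    (he : ∀ v ∈ e, v ∈ U.complexSubspace) :
    ∃ l : List (Complexification E), l.map U.embeddingOperator = e := by
  have : e ∈ Set.range (List.map U.embeddingOperator) := by
    rw [Set.range_list_map]
    exact fun v hv => U.mem_complexSubspace.1 (he v hv)
  exact this

/-- The explicit Wick word has the prescribed vacuum vector, and the vacuum is separating, so
nothing else in the algebra has it. -/
theorem isWickWord_iff {l : List (Complexification E)} {x : ArakiWoodsAlgebra U} :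
    IsWickWord U (l.map U.embeddingOperator) x ↔ (x : FockSpace (Complexification E) →L[ℂ] _) = U.wick l := by
  constructor
  · intro h
    have := U.eq_zero_of_vacuum (sub_mem x.2 (U.wick_mem l)) (by
      rw [sub_apply, wick_vacuum, h, sub_self])
    exact sub_eq_zero.1 this
  · intro h
    rw [IsWickWord, h, wick_vacuum]

end OrthogonalGroup

/-! ### Amplifications -/

section Amplification

variable {ι F : Type*} [NormedAddCommGroup F] [InnerProductSpace ℂ F] [CompleteSpace F]

variable (ι F) in
/-- The Hilbert space direct sum of copies of `F`. -/
abbrev Amp : Type _ := lp (fun _ : ι => F) 2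

variable (ι) in
/-- The diagonal action of an operator. -/
def ampl (a : F →L[ℂ] F) : Amp ι F →L[ℂ] Amp ι F :=
  lp.mapCLM 2 (fun _ => a) (norm_nonneg a) fun _ => le_rfl

@[simp] theorem ampl_apply (a : F →L[ℂ] F) (f : Amp ι F) (i : ι) : ampl ι a f i = a (f i) := rfl

theorem ampl_mul (a b : F →L[ℂ] F) : ampl ι (a * b) = ampl ι a * ampl ι b := by
  ext f i; rfl

theorem ampl_one : ampl ι (1 : F →L[ℂ] F) = 1 := by
  ext f i; rfl

theorem ampl_add (a b : F →L[ℂ] F) : ampl ι (a + b) = ampl ι a + ampl ι b := by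
  ext f i; rfl

theorem ampl_smul (c : ℂ) (a : F →L[ℂ] F) : ampl ι (c • a) = c • ampl ι a := by
  ext f i; rfl

theorem ampl_star (a : F →L[ℂ] F) : ampl ι (star a) = star (ampl ι a) := by
  rw [ContinuousLinearMap.star_eq_adjoint (ampl ι a), ContinuousLinearMap.eq_adjoint_iff]
  intro f g
  rw [lp.inner_eq_tsum, lp.inner_eq_tsum]
  congr 1; ext i
  rw [ampl_apply, ampl_apply, ContinuousLinearMap.star_eq_adjoint,
    ContinuousLinearMap.adjoint_inner_left]

theorem adjoint_ampl (a : F →L[ℂ] F) :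
    ContinuousLinearMap.adjoint (ampl ι a) = ampl ι (star a) :=
  (ampl_star a).symm

variable (ι F) in
/-- The diagonal action as a bounded linear map. -/
def amplL : (F →L[ℂ] F) →L[ℂ] (Amp ι F →L[ℂ] Amp ι F) :=
  LinearMap.mkContinuous ⟨⟨ampl ι, ampl_add⟩, ampl_smul⟩ 1 fun a => by
    rw [one_mul]
    exact lp.norm_mapCLM_le 2 (fun _ => a) (norm_nonneg a) fun _ => le_rfl

@[simp] theorem amplL_apply (a : F →L[ℂ] F) : amplL ι F a = ampl ι a := rfl

theorem ampl_single [DecidableEq ι] (a : F →L[ℂ] F) (i : ι) (x : F) :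
    ampl ι a (lp.single 2 i x) = lp.single 2 i (a x) := by
  ext k
  rw [ampl_apply]
  by_cases h : k = i
  · subst h; rw [lp.single_apply_self, lp.single_apply_self]
  · rw [lp.single_apply_ne _ _ _ h, lp.single_apply_ne _ _ _ h, map_zero]

end Amplification

/-! ### The isometries `V_t` -/

section Dilation

variable {H : Type u} [NormedAddCommGroup H] [InnerProductSpace ℂ H] [CompleteSpace H]
  {κ : Type u} (b : HilbertBasis κ ℂ H)

open Classical in
/-- The vectors `V_t u`, for a word `u`: the word `u` is cut after `t` letters. -/
def dilationVector (t : ℕ) (u : List κ) : Amp (List κ ⊕ ℕ) (FockSpace H) :=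
  if t ≤ u.length then lp.single 2 (Sum.inl (u.drop t)) (fockBasis b (u.take t))
  else lp.single 2 (Sum.inr (t - u.length - 1)) (fockBasis b u)

theorem inner_single_single {ι F : Type*} [DecidableEq ι] [NormedAddCommGroup F]
    [InnerProductSpace ℂ F] (i i' : ι) (x y : F) :
    ⟪(lp.single 2 i x : lp (fun _ : ι => F) 2), lp.single 2 i' y⟫_ℂ = if i = i' then ⟪x, y⟫_ℂ else 0 := by
  rw [lp.inner_single_left]
  split_ifs with h
  · subst h; rw [lp.single_apply_self]
  · rw [lp.single_apply_ne _ _ _ h, inner_zero_right]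

open Classical in
-- The pair (t, u) can be read off from its vector. The removed tail labels the copy of the Fock
-- space if u has at least t letters; otherwise the copy in the second family records how many
-- letters are missing. This second family is what keeps V_t isometric and orthogonal to the others
-- on short words.
theorem inner_dilationVector (t t' : ℕ) (u u' : List κ) :
    ⟪dilationVector b t u, dilationVector b t' u'⟫_ℂ = if t = t' ∧ u = u' then 1 else 0 := by
  have hB := orthonormal_iff_ite.1 (fockBasis b).orthonormal
  unfold dilationVector
  split_ifs with h1 h2 h3 h3 h2 h3 h3
  · obtain ⟨rfl, rfl⟩ := h3
    rw [inner_single_single, if_pos rfl, hB, if_pos rfl]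
  · rw [inner_single_single, hB]
    split_ifs with h4 h5
    · refine absurd ⟨?_, ?_⟩ h3
      · have := congrArg List.length h5
        simpa [h1, h2] using this
      · rw [← List.take_append_drop t u, h5, Sum.inl.inj h4, List.take_append_drop]
    · rfl
    · rfl
  · obtain ⟨rfl, rfl⟩ := h3
    exact absurd h1 h2
  · simp [inner_single_single]
  · obtain ⟨rfl, rfl⟩ := h3
    exact absurd h2 h1
  · simp [inner_single_single]
  · obtain ⟨rfl, rfl⟩ := h3
    rw [inner_single_single, if_pos rfl, hB, if_pos rfl]
  · rw [inner_single_single, hB]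
    split_ifs with h4 h5
    · subst h5
      refine absurd ⟨?_, rfl⟩ h3
      have := Sum.inr.inj h4
      omega
    · rfl
    · rfl

theorem exists_dilation (t : ℕ) : ∃ T : FockSpace H →ₗᵢ[ℂ] Amp (List κ ⊕ ℕ) (FockSpace H),
    ∀ w, T (fockBasis b w) = dilationVector b t w := by
  classical
  refine exists_isometry_of_orthonormal (fockBasis b) (orthonormal_iff_ite.2 fun u u' => ?_)
  rw [inner_dilationVector]
  simp

/-- The isometry `V_t`. -/
def dilation (t : ℕ) : FockSpace H →L[ℂ] Amp (List κ ⊕ ℕ) (FockSpace H) :=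
  (exists_dilation b t).choose.toContinuousLinearMap

theorem dilation_fockBasis (t : ℕ) (w : List κ) :
    dilation b t (fockBasis b w) = dilationVector b t w :=
  (exists_dilation b t).choose_spec w

theorem inner_dilation (t t' : ℕ) (f g : FockSpace H) :
    ⟪dilation b t f, dilation b t' g⟫_ℂ = if t = t' then ⟪f, g⟫_ℂ else 0 := by
  classical
  split_ifs with h
  · subst h
    exact (exists_dilation b t).choose.inner_map_map f g
  · have key : ∀ u, (innerSL ℂ (dilation b t (fockBasis b u))).comp (dilation b t') = 0 := by
      intro u
      refine clm_ext_basis (fockBasis b) fun u' => ?_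
      show ⟪dilation b t (fockBasis b u), dilation b t' (fockBasis b u')⟫_ℂ = 0
      rw [dilation_fockBasis, dilation_fockBasis, inner_dilationVector, if_neg (by simp [h])]
    have key2 : (innerSL ℂ (dilation b t' g)).comp (dilation b t) = 0 := by
      refine clm_ext_basis (fockBasis b) fun u => ?_
      show ⟪dilation b t' g, dilation b t (fockBasis b u)⟫_ℂ = 0
      have := congrArg (fun T : FockSpace H →L[ℂ] ℂ => T g) (key u)
      rw [← inner_conj_symm]
      have h2 : ⟪dilation b t (fockBasis b u), dilation b t' g⟫_ℂ = 0 := this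
      rw [h2, map_zero]
    have := congrArg (fun T : FockSpace H →L[ℂ] ℂ => T f) key2
    have h2 : ⟪dilation b t' g, dilation b t f⟫_ℂ = 0 := this
    rw [← inner_conj_symm, h2, map_zero]

/-- Cutting after t letters and then removing the first letter is the same as removing it and
cutting after t − 1 letters; the label of the copy is unchanged. For t = 0 only the vacuum is left
of the cut, and it is annihilated. -/
theorem ampl_annihilation_dilation_basis (t : ℕ) (i : κ) :
    (ampl (List κ ⊕ ℕ) (star (creation (b i)))).comp (dilation b t) =
      if t = 0 then 0 else (dilation b (t - 1)).comp (star (creation (b i))) := by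
  classical
  refine clm_ext_basis (fockBasis b) fun u => ?_
  show ampl (List κ ⊕ ℕ) (star (creation (b i))) (dilation b t (fockBasis b u)) = _
  have e : (if t = 0 then 0 else (dilation b (t - 1)).comp (star (creation (b i)))) (fockBasis b u) =
      if t = 0 then 0 else dilation b (t - 1) (star (creation (b i)) (fockBasis b u)) := by
    split_ifs <;> rfl
  rw [e, dilation_fockBasis, dilationVector]
  cases u with
  | nil =>
    rw [fockBasis_nil, star_creation_vacuum, map_zero, ite_self]
    split_ifs <;> simp [ampl_single, star_creation_vacuum, lp.single_zero]
  | cons j u =>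
    rw [star_creation_fockBasis]
    cases t with
    | zero => simp [ampl_single, star_creation_vacuum, lp.single_zero]
    | succ t =>
      simp only [List.length_cons, Nat.add_le_add_iff_right, List.drop_succ_cons,
        List.take_succ_cons, Nat.add_sub_add_right, Nat.add_sub_cancel, Nat.succ_ne_zero, if_false]
      by_cases hij : i = j
      · rw [if_pos hij, dilation_fockBasis, dilationVector]
        split_ifs <;> rw [ampl_single, star_creation_fockBasis, if_pos hij]
      · rw [if_neg hij, map_zero]
        split_ifs <;> rw [ampl_single, star_creation_fockBasis, if_neg hij, lp.single_zero]

/-- The vector ξ enters antilinearly through ℓ(ξ)*. Taking adjoints makes the relation linear and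
continuous in ξ, so it follows from the basis. -/
theorem ampl_annihilation_comp {ι : Type*} {V W : FockSpace H →L[ℂ] Amp ι (FockSpace H)}
    (h : ∀ i, (ampl ι (star (creation (b i)))).comp V = W.comp (star (creation (b i)))) (ξ : H) :
    (ampl ι (star (creation ξ))).comp V = W.comp (star (creation ξ)) := by
  have h1 : ((ContinuousLinearMap.compL ℂ _ _ _ (ContinuousLinearMap.adjoint V)).comp
      ((amplL ι (FockSpace H)).comp (creationL H))) =
      ((ContinuousLinearMap.compL ℂ _ _ _).flip (ContinuousLinearMap.adjoint W)).comp
        (creationL H) := by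
    refine clm_ext_basis b fun i => ?_
    have := congrArg ContinuousLinearMap.adjoint (h i)
    rw [ContinuousLinearMap.adjoint_comp, ContinuousLinearMap.adjoint_comp, adjoint_ampl,
      star_star, ← ContinuousLinearMap.star_eq_adjoint (star (creation (b i))), star_star] at this
    exact this
  have h2 : (ContinuousLinearMap.adjoint V).comp (ampl ι (creation ξ)) =
      (creation ξ).comp (ContinuousLinearMap.adjoint W) :=
    congrArg (fun T : H →L[ℂ] (Amp ι (FockSpace H) →L[ℂ] FockSpace H) => T ξ) h1
  have h3 := congrArg ContinuousLinearMap.adjoint h2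
  rw [ContinuousLinearMap.adjoint_comp, ContinuousLinearMap.adjoint_comp,
    ContinuousLinearMap.adjoint_adjoint, ContinuousLinearMap.adjoint_adjoint, adjoint_ampl,
    ← ContinuousLinearMap.star_eq_adjoint (creation ξ)] at h3
  exact h3

theorem ampl_annihilation_dilation_zero (ξ : H) :
    (ampl (List κ ⊕ ℕ) (star (creation ξ))).comp (dilation b 0) = 0 := by
  have := ampl_annihilation_comp b (V := dilation b 0) (W := 0) (fun i => by
    rw [ampl_annihilation_dilation_basis, if_pos rfl, ContinuousLinearMap.zero_comp]) ξ
  rwa [ContinuousLinearMap.zero_comp] at this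

theorem ampl_annihilation_dilation_succ (t : ℕ) (ξ : H) :
    (ampl (List κ ⊕ ℕ) (star (creation ξ))).comp (dilation b (t + 1)) =
      (dilation b t).comp (star (creation ξ)) :=
  ampl_annihilation_comp b (fun i => by
    rw [ampl_annihilation_dilation_basis, if_neg (by simp), Nat.add_sub_cancel]) ξ

end Dilation

/-! ### Matrices of operators -/

section MatrixNorm

variable {F : Type u} [NormedAddCommGroup F] [InnerProductSpace ℂ F] [CompleteSpace F] {n : ℕ}

theorem matrixOperator_apply (X : Matrix (Fin n) (Fin n) (F →L[ℂ] F))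
    (w : PiLp 2 (fun _ : Fin n => F)) (i : Fin n) :
    matrixOperator X w i = ∑ k, X i k (w k) := by
  simp [matrixOperator]

theorem norm_matrixOperator_sq (X : Matrix (Fin n) (Fin n) (F →L[ℂ] F))
    (w : PiLp 2 (fun _ : Fin n => F)) :
    ‖matrixOperator X w‖ ^ 2 = ∑ i, ‖∑ k, X i k (w k)‖ ^ 2 := by
  rw [PiLp.norm_sq_eq_of_L2]
  simp_rw [matrixOperator_apply]

theorem matrixOperator_bound (X : Matrix (Fin n) (Fin n) (F →L[ℂ] F)) (w : Fin n → F) :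
    ∑ i, ‖∑ k, X i k (w k)‖ ^ 2 ≤ ‖matrixOperator X‖ ^ 2 * ∑ k, ‖w k‖ ^ 2 := by
  have h := (matrixOperator X).le_opNorm (WithLp.toLp 2 w)
  have h2 := pow_le_pow_left₀ (norm_nonneg _) h 2
  rw [mul_pow, norm_matrixOperator_sq, PiLp.norm_sq_eq_of_L2] at h2
  exact h2

theorem norm_matrixOperator_le {X : Matrix (Fin n) (Fin n) (F →L[ℂ] F)} {c : ℝ} (hc : 0 ≤ c)
    (h : ∀ w : Fin n → F, ∑ i, ‖∑ k, X i k (w k)‖ ^ 2 ≤ c ^ 2 * ∑ k, ‖w k‖ ^ 2) :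
    ‖matrixOperator X‖ ≤ c := by
  refine ContinuousLinearMap.opNorm_le_bound _ hc fun w => ?_
  refine le_of_sq_le_sq ?_ (by positivity)
  rw [mul_pow, norm_matrixOperator_sq, PiLp.norm_sq_eq_of_L2]
  exact h w

theorem matrixOperator_add (X Y : Matrix (Fin n) (Fin n) (F →L[ℂ] F)) :
    matrixOperator (X + Y) = matrixOperator X + matrixOperator Y := by
  ext w i
  rw [matrixOperator_apply, add_apply, PiLp.add_apply, matrixOperator_apply, matrixOperator_apply,
    ← Finset.sum_add_distrib]
  rfl

theorem matrixOperator_smul (c : ℂ) (X : Matrix (Fin n) (Fin n) (F →L[ℂ] F)) :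
    matrixOperator (c • X) = c • matrixOperator X := by
  ext w i
  rw [matrixOperator_apply, smul_apply, PiLp.smul_apply, matrixOperator_apply, Finset.smul_sum]
  rfl

theorem norm_matrixOperator_sum_le {σ : Type*} (s : Finset σ) (c : σ → ℂ)
    (X : σ → Matrix (Fin n) (Fin n) (F →L[ℂ] F)) {r : ℝ} (h : ∀ a ∈ s, ‖matrixOperator (X a)‖ ≤ r) :
    ‖matrixOperator (∑ a ∈ s, c a • X a)‖ ≤ (∑ a ∈ s, ‖c a‖) * r := by
  classical
  induction s using Finset.induction_on with
  | empty =>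
    have : matrixOperator (0 : Matrix (Fin n) (Fin n) (F →L[ℂ] F)) = 0 := by
      ext w i
      rw [matrixOperator_apply]
      simp
    simp [this]
  | insert a s ha ih =>
    rw [Finset.sum_insert ha, Finset.sum_insert ha, matrixOperator_add, matrixOperator_smul, add_mul]
    refine (norm_add_le _ _).trans (add_le_add ?_ (ih fun b hb => h b (by simp [hb])))
    rw [norm_smul]
    exact mul_le_mul_of_nonneg_left (h a (by simp)) (norm_nonneg _)

variable {ι : Type*}

theorem hasSum_norm_sq_amp (f : Amp ι F) : HasSum (fun i => ‖f i‖ ^ 2) (‖f‖ ^ 2) := by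
  simpa using lp.hasSum_norm (p := 2) (by norm_num) f

theorem sum_ampl_bound (X : Matrix (Fin n) (Fin n) (F →L[ℂ] F)) (g : Fin n → Amp ι F) :
    ∑ i, ‖∑ k, ampl ι (X i k) (g k)‖ ^ 2 ≤ ‖matrixOperator X‖ ^ 2 * ∑ k, ‖g k‖ ^ 2 := by
  have h1 : HasSum (fun β : ι => ∑ i, ‖∑ k, X i k (g k β)‖ ^ 2)
      (∑ i, ‖∑ k, ampl ι (X i k) (g k)‖ ^ 2) := by
    refine hasSum_sum fun i _ => ?_
    have := hasSum_norm_sq_amp (∑ k, ampl ι (X i k) (g k))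
    refine this.congr_fun fun β => ?_
    rw [lp.coeFn_sum, Finset.sum_apply]
    rfl
  have h2 : HasSum (fun β : ι => ‖matrixOperator X‖ ^ 2 * ∑ k, ‖g k β‖ ^ 2)
      (‖matrixOperator X‖ ^ 2 * ∑ k, ‖g k‖ ^ 2) :=
    (hasSum_sum fun k _ => hasSum_norm_sq_amp (g k)).mul_left _
  exact hasSum_le (fun β => matrixOperator_bound X fun k => g k β) h1 h2

/-- The map `a ↦ V^* (a ⊕ a ⊕ ⋯) W`. -/
def compress (V W : F →L[ℂ] Amp ι F) : (F →L[ℂ] F) →L[ℂ] (F →L[ℂ] F) :=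
  ((ContinuousLinearMap.compL ℂ F (Amp ι F) F (ContinuousLinearMap.adjoint V)).comp
    ((ContinuousLinearMap.compL ℂ F (Amp ι F) (Amp ι F)).flip W)).comp (amplL ι F)

theorem compress_apply (V W : F →L[ℂ] Amp ι F) (a : F →L[ℂ] F) :
    compress V W a = (ContinuousLinearMap.adjoint V).comp ((ampl ι a).comp W) := rfl

theorem norm_matrixOperator_compress_le {V W : F →L[ℂ] Amp ι F} (hV : ‖V‖ ≤ 1) (hW : ‖W‖ ≤ 1)
    (X : Matrix (Fin n) (Fin n) (F →L[ℂ] F)) :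
    ‖matrixOperator (X.map (compress V W))‖ ≤ ‖matrixOperator X‖ := by
  refine norm_matrixOperator_le (norm_nonneg _) fun w => ?_
  have h1 : ∀ i, ‖∑ k, (X.map (compress V W)) i k (w k)‖ ^ 2 ≤
      ‖∑ k, ampl ι (X i k) (W (w k))‖ ^ 2 := by
    intro i
    have : ∑ k, (X.map (compress V W)) i k (w k) =
        ContinuousLinearMap.adjoint V (∑ k, ampl ι (X i k) (W (w k))) := by
      rw [map_sum]; rfl
    rw [this]
    refine pow_le_pow_left₀ (norm_nonneg _) ?_ 2
    refine (ContinuousLinearMap.le_opNorm _ _).trans ?_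
    have hV' : ‖ContinuousLinearMap.adjoint V‖ ≤ 1 := by
      rw [LinearIsometryEquiv.norm_map]; exact hV
    exact mul_le_of_le_one_left (norm_nonneg _) hV'
  refine (Finset.sum_le_sum fun i _ => h1 i).trans ((sum_ampl_bound X fun k => W (w k)).trans ?_)
  refine mul_le_mul_of_nonneg_left (Finset.sum_le_sum fun k _ => ?_) (by positivity)
  refine pow_le_pow_left₀ (norm_nonneg _) ?_ 2
  exact (W.le_opNorm _).trans (mul_le_of_le_one_left (norm_nonneg _) hW)

end MatrixNorm

/-! ### The word length truncation on all operators -/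

section Truncation

variable {H : Type u} [NormedAddCommGroup H] [InnerProductSpace ℂ H] [CompleteSpace H]
  {κ : Type u} (b : HilbertBasis κ ℂ H)

theorem ampl_annihilationWord_dilation (l : List H) (t : ℕ) :
    (ampl (List κ ⊕ ℕ) (annihilationWord l)).comp (dilation b t) =
      if l.length ≤ t then (dilation b (t - l.length)).comp (annihilationWord l) else 0 := by
  induction l with
  | nil => simp only [annihilationWord, ampl_one]; rfl
  | cons ξ l ih =>
    rw [annihilationWord, ampl_mul, ContinuousLinearMap.mul_def, ContinuousLinearMap.comp_assoc, ih]
    by_cases h : l.length ≤ t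
    · rw [if_pos h, ← ContinuousLinearMap.comp_assoc]
      by_cases h2 : (ξ :: l).length ≤ t
      · rw [if_pos h2]
        have h3 : t - l.length = (t - (ξ :: l).length) + 1 := by
          rw [List.length_cons] at h2 ⊢; omega
        rw [h3, ampl_annihilation_dilation_succ]
        rfl
      · rw [if_neg h2]
        have h3 : t - l.length = 0 := by
          rw [List.length_cons] at h2; omega
        rw [h3, ampl_annihilation_dilation_zero, ContinuousLinearMap.zero_comp]
    · rw [if_neg h, if_neg (by rw [List.length_cons]; omega), ContinuousLinearMap.comp_zero]

theorem annihilationWord_append (l l' : List H) :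
    annihilationWord (l ++ l') = annihilationWord l * annihilationWord l' := by
  induction l with
  | nil => simp [annihilationWord]
  | cons ξ l ih => rw [List.cons_append, annihilationWord, ih, annihilationWord, mul_assoc]

theorem star_creationWord (l : List H) : star (creationWord l) = annihilationWord l.reverse := by
  induction l with
  | nil => simp [creationWord, annihilationWord]
  | cons ξ l ih =>
    rw [creationWord, star_mul, ih, List.reverse_cons, annihilationWord_append]
    simp [annihilationWord]

theorem star_annihilationWord (l : List H) : star (annihilationWord l) = creationWord l.reverse := by
  rw [← star_star (creationWord l.reverse), star_creationWord, List.reverse_reverse]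

theorem adjoint_dilation_ampl_creationWord (l : List H) (t : ℕ) :
    (ContinuousLinearMap.adjoint (dilation b t)).comp (ampl (List κ ⊕ ℕ) (creationWord l)) =
      if l.length ≤ t then
        (creationWord l).comp (ContinuousLinearMap.adjoint (dilation b (t - l.length))) else 0 := by
  have h := congrArg ContinuousLinearMap.adjoint (ampl_annihilationWord_dilation b l.reverse t)
  rw [ContinuousLinearMap.adjoint_comp, adjoint_ampl, star_annihilationWord,
    List.reverse_reverse, List.length_reverse] at h
  rw [h]
  split_ifs
  · rw [ContinuousLinearMap.adjoint_comp, ← ContinuousLinearMap.star_eq_adjoint (annihilationWord _),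
      star_annihilationWord, List.reverse_reverse]
  · rw [map_zero]

theorem adjoint_dilation_dilation (t t' : ℕ) :
    (ContinuousLinearMap.adjoint (dilation b t)).comp (dilation b t') =
      if t = t' then ContinuousLinearMap.id ℂ _ else 0 := by
  ext1 g
  refine ext_inner_left ℂ fun f => ?_
  rw [ContinuousLinearMap.comp_apply, ContinuousLinearMap.adjoint_inner_right, inner_dilation]
  split_ifs <;> simp

/-- Annihilators move through V_{t'} and creators through V_t*, each lowering its index by one and
giving 0 if the index runs out. What remains between them is V_{t−k}* V_{t'−l}, which is 0 or 1. -/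
theorem compress_word (l l' : List H) (t t' : ℕ) :
    compress (dilation b t) (dilation b t') (creationWord l * annihilationWord l') =
      if l.length ≤ t ∧ l'.length ≤ t' ∧ t - l.length = t' - l'.length then
        creationWord l * annihilationWord l' else 0 := by
  rw [compress_apply, ampl_mul, ContinuousLinearMap.mul_def, ContinuousLinearMap.comp_assoc,
    ampl_annihilationWord_dilation, ← ContinuousLinearMap.comp_assoc,
    adjoint_dilation_ampl_creationWord]
  by_cases h1 : l.length ≤ t
  · by_cases h2 : l'.length ≤ t'
    · rw [if_pos h1, if_pos h2, ContinuousLinearMap.comp_assoc,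
        ← ContinuousLinearMap.comp_assoc _ _ (annihilationWord l'), adjoint_dilation_dilation]
      by_cases h3 : t - l.length = t' - l'.length
      · rw [if_pos h3, if_pos ⟨h1, h2, h3⟩, ContinuousLinearMap.id_comp]; rfl
      · rw [if_neg h3, if_neg (fun h => h3 h.2.2), ContinuousLinearMap.zero_comp,
          ContinuousLinearMap.comp_zero]
    · rw [if_neg h2, ContinuousLinearMap.comp_zero, if_neg (fun h => h2 h.2.1)]
  · rw [if_neg h1, ContinuousLinearMap.zero_comp, if_neg (fun h => h1 h.1)]

/-- The Hankel matrix of the truncation. -/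
def hankel (d t t' : ℕ) : ℝ := if t + t' = d ∨ t + t' + 1 = d then 1 else 0

/-- The truncation to words of length at most `d`. -/
def truncation (d : ℕ) : (FockSpace H →L[ℂ] FockSpace H) →L[ℂ] (FockSpace H →L[ℂ] FockSpace H) :=
  ∑ t ∈ Finset.range (d + 1), ∑ t' ∈ Finset.range (d + 1),
    (hankel d t t' : ℂ) • compress (dilation b t) (dilation b t')

theorem sum_hankel (d k l : ℕ) :
    ∑ t ∈ Finset.range (d + 1), ∑ t' ∈ Finset.range (d + 1),
      (if k ≤ t ∧ l ≤ t' ∧ t - k = t' - l then hankel d t t' else 0) = if k + l ≤ d then 1 else 0 := by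
  -- Only indices (k+r, l+r) contribute, and k + l + 2r ∈ {d−1, d} has exactly one solution r ≥ 0
  -- when k + l ≤ d. This is the telescoping of φ(k+l+2r) − φ(k+l+2r+2).
  set r := (d - (k + l)) / 2 with hr
  by_cases h : k + l ≤ d
  · rw [if_pos h, Finset.sum_eq_single (k + r), Finset.sum_eq_single (l + r)]
    · rw [if_pos (by omega), hankel, if_pos (by omega)]
    · intro t' _ ht'
      split_ifs with h1
      · omega
      · rfl
    · intro h1; simp at h1; omega
    · intro t ht ht'
      refine Finset.sum_eq_zero fun t' _ => ?_
      split_ifs with h1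
      · rw [hankel, if_neg (by omega)]
      · rfl
    · intro h1; simp at h1; omega
  · rw [if_neg h]
    refine Finset.sum_eq_zero fun t _ => Finset.sum_eq_zero fun t' _ => ?_
    split_ifs with h1
    · rw [hankel, if_neg (by omega)]
    · rfl

theorem truncation_word (d : ℕ) (l l' : List H) :
    truncation b d (creationWord l * annihilationWord l') =
      if l.length + l'.length ≤ d then creationWord l * annihilationWord l' else 0 := by
  have h := sum_hankel d l.length l'.length
  have h2 : truncation b d (creationWord l * annihilationWord l') =
      ((∑ t ∈ Finset.range (d + 1), ∑ t' ∈ Finset.range (d + 1),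
        (if l.length ≤ t ∧ l'.length ≤ t' ∧ t - l.length = t' - l'.length then hankel d t t'
          else 0) : ℝ) : ℂ) • (creationWord l * annihilationWord l') := by
    rw [truncation, sum_apply, Complex.ofReal_sum, Finset.sum_smul]
    refine Finset.sum_congr rfl fun t _ => ?_
    rw [sum_apply, Complex.ofReal_sum, Finset.sum_smul]
    refine Finset.sum_congr rfl fun t' _ => ?_
    rw [smul_apply, compress_word]
    split_ifs <;> simp
  rw [h2, h]
  split_ifs <;> simp

/-- The combination `∑ x_t V_t`. -/
def dilationSum (d : ℕ) (x : ℕ → ℝ) : FockSpace H →L[ℂ] Amp (List κ ⊕ ℕ) (FockSpace H) :=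
  ∑ t ∈ Finset.range (d + 1), (x t : ℂ) • dilation b t

theorem norm_dilationSum_le {d : ℕ} {x : ℕ → ℝ} (hx : ∑ t ∈ Finset.range (d + 1), x t ^ 2 ≤ 1) :
    ‖dilationSum b d x‖ ≤ 1 := by
  refine ContinuousLinearMap.opNorm_le_bound _ zero_le_one fun f => ?_
  refine le_of_sq_le_sq ?_ (by positivity)
  have h : ⟪dilationSum b d x f, dilationSum b d x f⟫_ℂ =
      ((∑ t ∈ Finset.range (d + 1), x t ^ 2 : ℝ) : ℂ) * ⟪f, f⟫_ℂ := by
    rw [dilationSum, sum_apply, sum_inner, Complex.ofReal_sum, Finset.sum_mul]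
    refine Finset.sum_congr rfl fun t ht => ?_
    rw [inner_sum, Finset.sum_eq_single t]
    · rw [smul_apply, inner_smul_left, inner_smul_right, inner_dilation, if_pos rfl,
        Complex.conj_ofReal]
      push_cast
      ring
    · intro t' _ ht'
      rw [smul_apply, smul_apply, inner_smul_left, inner_smul_right, inner_dilation,
        if_neg (Ne.symm ht')]
      simp
    · intro h; exact absurd ht h
  rw [inner_self_eq_norm_sq_to_K, inner_self_eq_norm_sq_to_K] at h
  have h' : ‖dilationSum b d x f‖ ^ 2 = (∑ t ∈ Finset.range (d + 1), x t ^ 2) * ‖f‖ ^ 2 := by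
    have h3 : ((‖dilationSum b d x f‖ ^ 2 : ℝ) : ℂ) =
        (((∑ t ∈ Finset.range (d + 1), x t ^ 2) * ‖f‖ ^ 2 : ℝ) : ℂ) := by
      rw [Complex.ofReal_mul, Complex.ofReal_pow, Complex.ofReal_pow]
      exact h
    exact Complex.ofReal_injective h3
  rw [h', one_mul]
  exact mul_le_of_le_one_left (by positivity) hx

theorem compress_dilationSum (d : ℕ) (x : ℕ → ℝ) :
    compress (dilationSum b d x) (dilationSum b d x) =
      ∑ t ∈ Finset.range (d + 1), ∑ t' ∈ Finset.range (d + 1),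
        ((x t * x t' : ℝ) : ℂ) • compress (dilation b t) (dilation b t') := by
  ext1 a
  ext1 f
  refine ext_inner_left ℂ fun g => ?_
  rw [compress_apply, ContinuousLinearMap.comp_apply, ContinuousLinearMap.adjoint_inner_right]
  simp only [dilationSum, sum_apply, ContinuousLinearMap.comp_apply, map_sum,
    sum_inner, inner_sum, smul_apply, map_smul, inner_smul_left, inner_smul_right, compress_apply,
    ContinuousLinearMap.adjoint_inner_right, Complex.conj_ofReal]
  simp_rw [Finset.mul_sum]
  rw [Finset.sum_comm]
  refine Finset.sum_congr rfl fun t _ => Finset.sum_congr rfl fun t' _ => ?_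
  push_cast
  ring

/-- A decomposition h = Σ λ_a x_a x_aᵀ rewrites the truncation as Σ λ_a W_a*(·⊗1)W_a, where W_a = Σ
x_a(t) V_t is a contraction because the V_t have orthogonal ranges. -/
theorem norm_truncation_le {d : ℕ} {σ : Type*} (s : Finset σ) (lam : σ → ℝ) (x : σ → ℕ → ℝ)
    (hx : ∀ a ∈ s, ∑ t ∈ Finset.range (d + 1), x a t ^ 2 ≤ 1)
    (hh : ∀ t ∈ Finset.range (d + 1), ∀ t' ∈ Finset.range (d + 1),
      ∑ a ∈ s, lam a * (x a t * x a t') = hankel d t t')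
    {n : ℕ} (X : Matrix (Fin n) (Fin n) (FockSpace H →L[ℂ] FockSpace H)) :
    ‖matrixOperator (X.map (truncation b d))‖ ≤ (∑ a ∈ s, |lam a|) * ‖matrixOperator X‖ := by
  have h1 : truncation b d =
      ∑ a ∈ s, (lam a : ℂ) • compress (dilationSum b d (x a)) (dilationSum b d (x a)) := by
    simp_rw [compress_dilationSum, Finset.smul_sum]
    rw [Finset.sum_comm, truncation]
    refine Finset.sum_congr rfl fun t ht => ?_
    rw [Finset.sum_comm]
    refine Finset.sum_congr rfl fun t' ht' => ?_
    rw [← hh t ht t' ht']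
    rw [Complex.ofReal_sum]
    refine (Finset.sum_smul (R := ℂ) (x := compress (dilation b t) (dilation b t'))).trans (Finset.sum_congr rfl fun a _ => ?_)
    rw [Complex.ofReal_mul]
    exact mul_smul _ _ _
  have h2 : X.map (truncation b d) = ∑ a ∈ s, (lam a : ℂ) •
      X.map (compress (dilationSum b d (x a)) (dilationSum b d (x a))) := by
    ext1 i k
    rw [Matrix.map_apply, h1, sum_apply, Matrix.sum_apply]
    rfl
  rw [h2]
  refine (norm_matrixOperator_sum_le s _ _ fun a ha => norm_matrixOperator_compress_le
    (norm_dilationSum_le b (hx a ha)) (norm_dilationSum_le b (hx a ha)) X).trans (le_of_eq ?_)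
  congr 1
  simp

end Truncation

/-! ### Spectral decomposition of the Hankel matrix -/

section Trigonometry

open Real

theorem two_sin_mul_sum_cos (n : ℕ) (φ : ℝ) :
    2 * sin (φ / 2) * ∑ t ∈ Finset.range n, cos ((t + 1) * φ) =
      sin ((n + 1 / 2) * φ) - sin (φ / 2) := by
  induction n with
  | zero => simp; ring_nf
  | succ n ih =>
    rw [Finset.sum_range_succ, mul_add, ih]
    have h1 : ((n : ℝ) + 1 + 1 / 2) * φ = (n + 1) * φ + φ / 2 := by ring
    have h2 : ((n : ℝ) + 1 / 2) * φ = (n + 1) * φ - φ / 2 := by ring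
    push_cast
    rw [h1, h2, sin_add, sin_sub]
    ring

theorem sum_cos_eq (d : ℕ) {c : ℕ} (hc : 0 < c) (hc' : c < 2 * d + 3) :
    ∑ t ∈ Finset.range (d + 1), cos ((t + 1) * (c * (2 * π / (2 * d + 3)))) = -1 / 2 := by
  have hM : (0 : ℝ) < 2 * d + 3 := by positivity
  have h := two_sin_mul_sum_cos (d + 1) (c * (2 * π / (2 * d + 3)))
  -- The modulus 2d + 3 is chosen so that the endpoint term of the Dirichlet kernel vanishes at
  -- these frequencies.
  have h1 : (((d + 1 : ℕ) : ℝ) + 1 / 2) * (c * (2 * π / (2 * d + 3))) = c * π := by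
    push_cast; field_simp; ring
  have h2 : (c : ℝ) * (2 * π / (2 * d + 3)) / 2 = c * π / (2 * d + 3) := by ring
  rw [h1, sin_nat_mul_pi, h2, zero_sub] at h
  have hpos : 0 < sin (c * π / (2 * d + 3)) := by
    refine sin_pos_of_pos_of_lt_pi (by positivity) ?_
    rw [div_lt_iff₀ hM, mul_comm]
    have : (c : ℝ) < 2 * d + 3 := by exact_mod_cast hc'
    exact mul_lt_mul_of_pos_left this pi_pos
  have h3 : sin (c * π / (2 * d + 3)) *
      (2 * ∑ t ∈ Finset.range (d + 1), cos ((t + 1) * (c * (2 * π / (2 * d + 3)))) + 1) = 0 := by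
    linarith
  have h4 := (mul_eq_zero.1 h3).resolve_left hpos.ne'
  linarith

/-- The eigenvectors of the Hankel matrix. -/
def hankelVec (d s t : ℕ) : ℝ :=
  2 / √(2 * d + 3) * sin ((t + 1) * ((s + 1) * (2 * π / (2 * d + 3))))

/-- The eigenvalues of the Hankel matrix. -/
def hankelVal (d s : ℕ) : ℝ := (-1) ^ s * (2 * cos (π * (s + 1) / (2 * d + 3)))

theorem hankelVec_comm (d s t : ℕ) : hankelVec d s t = hankelVec d t s := by
  unfold hankelVec; congr 2; ring

/-- Products of sines are differences of cosines with frequencies s − s' and s + s' + 2, both below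
2d + 3. Each cosine sum is −1/2, so they cancel, unless s = s', when the first is d + 1 and the
difference (2d+3)/2 matches the normalization. -/
theorem hankelVec_orthonormal {d s s' : ℕ} (hs : s ∈ Finset.range (d + 1))
    (hs' : s' ∈ Finset.range (d + 1)) :
    ∑ t ∈ Finset.range (d + 1), hankelVec d s t * hankelVec d s' t = if s = s' then 1 else 0 := by
  wlog h : s' ≤ s generalizing s s'
  · have := this hs' hs (by omega)
    simp_rw [mul_comm (hankelVec d s _), this, eq_comm]
  rw [Finset.mem_range] at hs hs'
  have hM : (0 : ℝ) < 2 * d + 3 := by positivity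
  set θ := 2 * π / (2 * d + 3) with hθ
  have h1 : ∀ t : ℕ, hankelVec d s t * hankelVec d s' t = 2 / (2 * d + 3) *
      (cos ((t + 1) * ((s - s' : ℕ) * θ)) - cos ((t + 1) * ((s + s' + 2 : ℕ) * θ))) := by
    intro t
    unfold hankelVec
    have e1 : ((t : ℝ) + 1) * ((s - s' : ℕ) * θ) = (t + 1) * ((s + 1) * θ) - (t + 1) * ((s' + 1) * θ) := by
      rw [Nat.cast_sub h]; ring
    have e2 : ((t : ℝ) + 1) * ((s + s' + 2 : ℕ) * θ) = (t + 1) * ((s + 1) * θ) + (t + 1) * ((s' + 1) * θ) := by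
      push_cast; ring
    rw [e1, e2, cos_sub, cos_add]
    have e3 : (2 / √(2 * d + 3)) * (2 / √(2 * d + 3)) = 4 / (2 * (d : ℝ) + 3) := by
      rw [div_mul_div_comm, mul_self_sqrt hM.le]; norm_num
    linear_combination (sin ((t + 1) * ((s + 1) * θ)) * sin ((t + 1) * ((s' + 1) * θ))) * e3
  simp_rw [h1]
  rw [← Finset.mul_sum, Finset.sum_sub_distrib, sum_cos_eq d (c := s + s' + 2) (by omega) (by omega)]
  split_ifs with hss
  · subst hss
    simp
    field_simp
    ring
  · rw [sum_cos_eq d (c := s - s') (by omega) (by omega)]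
    ring

/-- Row t has its ones at d − t and d − t − 1. The sum of the two neighbouring sines is twice the
sine at the midpoint times cos(α/2), and (d − t + 1/2)α = (s+1)π − (t+1)α turns the midpoint sine
back into the t-th one up to the sign (−1)^s. -/
theorem hankel_eigen {d s t : ℕ} (ht : t ∈ Finset.range (d + 1)) :
    ∑ t' ∈ Finset.range (d + 1), hankel d t t' * hankelVec d s t' =
      hankelVal d s * hankelVec d s t := by
  rw [Finset.mem_range] at ht
  have hM : (0 : ℝ) < 2 * d + 3 := by positivity
  set α := ((s : ℝ) + 1) * (2 * π / (2 * d + 3)) with hα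
  have h1 : ∑ t' ∈ Finset.range (d + 1), hankel d t t' * hankelVec d s t' =
      2 / √(2 * d + 3) * (sin ((d - t + 1) * α) + sin ((d - t) * α)) := by
    -- The guard t < d is needed because d − t − 1 is truncated to 0 at t = d. There the missing
    -- term is consistent with the formula, since its sine is sin 0.
    have e1 : ∀ t' : ℕ, hankel d t t' = (if t' = d - t then 1 else 0) +
        (if t' = d - t - 1 ∧ t < d then 1 else 0) := by
      intro t'
      unfold hankel
      split_ifs <;> first | omega | norm_num
    simp_rw [e1, add_mul]
    rw [Finset.sum_add_distrib, mul_add (2 / √(2 * (d : ℝ) + 3))]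
    congr 1
    · rw [Finset.sum_eq_single (d - t)]
      · rw [if_pos rfl, one_mul, hankelVec, Nat.cast_sub (by omega), ← hα]
        congr 2; ring
      · intro t' _ h; rw [if_neg h, zero_mul]
      · intro h; exact absurd (Finset.mem_range.2 (by omega)) h
    · by_cases htd : t < d
      · rw [Finset.sum_eq_single (d - t - 1)]
        · rw [if_pos ⟨rfl, htd⟩, one_mul, hankelVec, Nat.cast_sub (by omega), Nat.cast_sub (by omega)]
          congr 2; push_cast; ring
        · intro t' _ h; rw [if_neg (fun hh => h hh.1), zero_mul]
        · intro h; exact absurd (Finset.mem_range.2 (by omega)) h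
      · have : t = d := by omega
        subst this
        simp
  have h2 : sin ((d - t + 1) * α) + sin ((d - t) * α) =
      2 * sin ((d - t + 1 / 2) * α) * cos (α / 2) := by
    have e1 : ((d : ℝ) - t + 1) * α = (d - t + 1 / 2) * α + α / 2 := by ring
    have e2 : ((d : ℝ) - t) * α = (d - t + 1 / 2) * α - α / 2 := by ring
    rw [e1, e2, sin_add, sin_sub]; ring
  have h3 : ((d : ℝ) - t + 1 / 2) * α = (s + 1 : ℕ) * π - (t + 1) * α := by
    rw [hα]; push_cast; field_simp; ring
  have h4 : sin ((d - t + 1 / 2) * α) = (-1) ^ s * sin ((t + 1) * α) := by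
    rw [h3, sin_nat_mul_pi_sub]
    ring
  have h5 : α / 2 = π * (s + 1) / (2 * d + 3) := by rw [hα]; ring
  rw [h1, h2, h4, h5, hankelVal, hankelVec]
  ring

/-- The matrix of eigenvectors is symmetric, so orthonormality of its rows also gives completeness.
-/
theorem hankel_spectral {d t t' : ℕ} (ht : t ∈ Finset.range (d + 1))
    (ht' : t' ∈ Finset.range (d + 1)) :
    ∑ s ∈ Finset.range (d + 1), hankelVal d s * (hankelVec d s t * hankelVec d s t') =
      hankel d t t' := by
  have h1 : ∀ s, hankelVal d s * (hankelVec d s t * hankelVec d s t') =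
      ∑ r ∈ Finset.range (d + 1), hankel d t r * (hankelVec d r s * hankelVec d t' s) := by
    intro s
    rw [← mul_assoc, ← hankel_eigen ht, Finset.sum_mul]
    refine Finset.sum_congr rfl fun r _ => ?_
    rw [hankelVec_comm d s r, hankelVec_comm d s t']
    ring
  simp_rw [h1]
  rw [Finset.sum_comm]
  simp_rw [← Finset.mul_sum]
  rw [Finset.sum_eq_single t']
  · rw [hankelVec_orthonormal ht' ht', if_pos rfl, mul_one]
  · intro r hr hne
    rw [hankelVec_orthonormal hr ht', if_neg hne, mul_zero]
  · intro h; exact absurd ht' h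

/-- The trace norm of the Hankel matrix. -/
def hankelNorm (d : ℕ) : ℝ := ∑ s ∈ Finset.range (d + 1), |hankelVal d s|

theorem abs_hankelVal {d s : ℕ} (hs : s ∈ Finset.range (d + 1)) :
    |hankelVal d s| = 2 * cos (π * (s + 1) / (2 * d + 3)) := by
  rw [Finset.mem_range] at hs
  have hM : (0 : ℝ) < 2 * d + 3 := by positivity
  rw [hankelVal, abs_mul, abs_pow, abs_neg, abs_one, one_pow, one_mul, abs_of_nonneg]
  refine mul_nonneg zero_le_two (cos_nonneg_of_mem_Icc ⟨?_, ?_⟩)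
  · have : 0 ≤ π * (s + 1) / (2 * d + 3) := by positivity
    linarith [pi_pos]
  · rw [div_le_iff₀ hM]
    have : (s : ℝ) ≤ d := by exact_mod_cast Nat.lt_succ_iff.1 hs
    nlinarith [pi_pos]

/-- All the cosines are nonnegative, so the trace norm is a Dirichlet sum at angle π/(2d+3). Its
endpoint term is sin(π/2) = 1. -/
theorem hankelNorm_eq (d : ℕ) : hankelNorm d = 1 / sin (π / (4 * d + 6)) - 1 := by
  have hM : (0 : ℝ) < 2 * d + 3 := by positivity
  have h := two_sin_mul_sum_cos (d + 1) (π / (2 * d + 3))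
  have h1 : (((d + 1 : ℕ) : ℝ) + 1 / 2) * (π / (2 * d + 3)) = π / 2 := by
    push_cast; field_simp; ring
  have h2 : π / (2 * d + 3) / 2 = π / (4 * (d : ℝ) + 6) := by
    rw [div_div]; congr 1; ring
  rw [h1, sin_pi_div_two, h2] at h
  have hpos : 0 < sin (π / (4 * (d : ℝ) + 6)) := by
    refine sin_pos_of_pos_of_lt_pi (by positivity) ?_
    rw [div_lt_iff₀ (by positivity)]
    nlinarith [pi_pos, (Nat.cast_nonneg d : (0 : ℝ) ≤ d)]
  have h3 : hankelNorm d = 2 * ∑ t ∈ Finset.range (d + 1), cos ((t + 1) * (π / (2 * d + 3))) := by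
    rw [hankelNorm, Finset.mul_sum]
    refine Finset.sum_congr rfl fun s hs => ?_
    rw [abs_hankelVal hs]
    congr 2; ring
  rw [h3, eq_sub_iff_add_eq, eq_div_iff hpos.ne']
  linarith

/-- With x = π/(4d+6), the quotient by 4d/π equals (x / sin x)(1 + 3/(2d)) − π/(4d). -/
theorem hankelNorm_isEquivalent :
    hankelNorm ~[atTop] (fun d : ℕ => 4 / π * (d : ℝ)) := by
  rw [Asymptotics.isEquivalent_iff_tendsto_one]
  · have hx : Tendsto (fun d : ℕ => π / (4 * (d : ℝ) + 6)) atTop (nhdsWithin 0 {0}ᶜ) := by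
      refine tendsto_nhdsWithin_iff.2 ⟨?_, Eventually.of_forall fun d => ?_⟩
      · refine Tendsto.const_div_atTop ?_ _
        exact tendsto_atTop_add_const_right _ _
          (tendsto_natCast_atTop_atTop.const_mul_atTop (by norm_num))
      · have : (0 : ℝ) < π / (4 * d + 6) := by positivity
        exact this.ne'
    have hsinc : Tendsto (fun x : ℝ => x / sin x) (nhdsWithin 0 {0}ᶜ) (nhds 1) := by
      have h1 : HasDerivAt sin 1 0 := by simpa using hasDerivAt_sin 0
      have h2 := (hasDerivAt_iff_tendsto_slope.1 h1).inv₀ one_ne_zero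
      rw [inv_one] at h2
      refine h2.congr fun x => ?_
      simp [slope_def_field]
    have h1 := hsinc.comp hx
    have h2 : Tendsto (fun d : ℕ => 1 + 3 / 2 * ((d : ℝ))⁻¹) atTop (nhds (1 + 3 / 2 * 0)) :=
      (tendsto_inv_atTop_nhds_zero_nat.const_mul _).const_add _
    have h3 : Tendsto (fun d : ℕ => π / 4 * ((d : ℝ))⁻¹) atTop (nhds (π / 4 * 0)) :=
      tendsto_inv_atTop_nhds_zero_nat.const_mul _
    have h4 := (h1.mul h2).sub h3
    simp only [mul_zero, add_zero, mul_one, sub_zero] at h4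
    refine h4.congr' ?_
    filter_upwards [eventually_gt_atTop 0] with d hd
    have hd' : (0 : ℝ) < d := by exact_mod_cast hd
    have hpos : 0 < sin (π / (4 * (d : ℝ) + 6)) := by
      refine sin_pos_of_pos_of_lt_pi (by positivity) ?_
      rw [div_lt_iff₀ (by positivity)]
      nlinarith [pi_pos]
    have hpi := pi_pos
    simp only [Pi.div_apply, Function.comp_apply, hankelNorm_eq]
    set S := sin (π / (4 * (d : ℝ) + 6))
    field_simp
    ring
  · filter_upwards [eventually_gt_atTop 0] with d hd
    have hd' : (0 : ℝ) < d := by exact_mod_cast hd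
    have := pi_pos
    positivity

end Trigonometry

/-! ### The word length projection -/

namespace OrthogonalGroup

open Complexification (re im ofReal conj)

variable {E : Type u} [NormedAddCommGroup E] [InnerProductSpace ℝ E] [CompleteSpace E]
  (U : OrthogonalGroup E)

/-- The prefix of creators is what makes the induction close: the Wick recursion moves the first
letter into it, and leaves a pure product of creators and annihilators of the same total length. -/
theorem truncation_creationWord_mul_wick {κ : Type u} (b : HilbertBasis κ ℂ (Complexification E))
    (d : ℕ) (l' l : List (Complexification E)) :
    truncation b d (creationWord l' * U.wick l) =
      if l'.length + l.length ≤ d then creationWord l' * U.wick l else 0 := by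
  induction l generalizing l' with
  | nil => simpa [annihilationWord] using truncation_word b d l' []
  | cons x l ih =>
    have h := ih (l' ++ [U.embeddingOperator x])
    rw [creationWord_append, List.length_append] at h
    simp only [creationWord, mul_one, List.length_singleton] at h
    rw [wick_cons, mul_add, ← mul_assoc, _root_.map_add, h, truncation_word, List.length_map,
      List.length_cons, show l'.length + 1 + l.length = l'.length + (l.length + 1) by omega]
    split_ifs <;> simp

theorem truncation_wick {κ : Type u} (b : HilbertBasis κ ℂ (Complexification E))
    (d : ℕ) (l : List (Complexification E)) :
    truncation b d (U.wick l) = if l.length ≤ d then U.wick l else 0 := by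
  simpa [creationWord] using U.truncation_creationWord_mul_wick b d [] l

theorem isClosed_arakiWoodsAlgebra : IsClosed (ArakiWoodsAlgebra U :
    Set (FockSpace (Complexification E) →L[ℂ] FockSpace (Complexification E))) :=
  StarSubalgebra.isClosed_topologicalClosure _

theorem truncation_mem {κ : Type u} (b : HilbertBasis κ ℂ (Complexification E)) (d : ℕ)
    {a : FockSpace (Complexification E) →L[ℂ] FockSpace (Complexification E)}
    (ha : a ∈ ArakiWoodsAlgebra U) : truncation b d a ∈ ArakiWoodsAlgebra U := by
  have hcl : IsClosed (truncation b d ⁻¹' (ArakiWoodsAlgebra U :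
      Set (FockSpace (Complexification E) →L[ℂ] FockSpace (Complexification E)))) :=
    U.isClosed_arakiWoodsAlgebra.preimage (truncation b d).continuous
  refine hcl.closure_subset_iff.2 ?_ (U.mem_closure_span_wick ha)
  intro a ha
  show truncation b d a ∈ ArakiWoodsAlgebra U
  induction ha using Submodule.span_induction with
  | mem w hw =>
    obtain ⟨l, rfl⟩ := hw
    rw [truncation_wick]
    split_ifs
    · exact U.wick_mem l
    · exact zero_mem _
  | zero => rw [map_zero]; exact zero_mem _
  | add v w _ _ h1 h2 => rw [_root_.map_add]; exact add_mem h1 h2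
  | smul c w _ h => rw [map_smul]; exact SMulMemClass.smul_mem c h

/-- The projection onto words of length at most `d`. -/
def wordProjection {κ : Type u} (b : HilbertBasis κ ℂ (Complexification E)) (d : ℕ) :
    ArakiWoodsAlgebra U →L[ℂ] ArakiWoodsAlgebra U :=
  LinearMap.mkContinuous
    { toFun := fun a => ⟨truncation b d a, U.truncation_mem b d a.2⟩
      map_add' := fun a c => Subtype.ext ((truncation b d).map_add a c)
      map_smul' := fun c a => Subtype.ext ((truncation b d).map_smul c a) }
    ‖truncation b d‖ fun a => (truncation b d).le_opNorm a

theorem coe_wordProjection {κ : Type u} (b : HilbertBasis κ ℂ (Complexification E)) (d : ℕ)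
    (a : ArakiWoodsAlgebra U) :
    (U.wordProjection b d a : FockSpace (Complexification E) →L[ℂ] FockSpace (Complexification E)) =
      truncation b d a := rfl

/-- The Wick word as an element of the algebra. -/
def wickElement (l : List (Complexification E)) : ArakiWoodsAlgebra U := ⟨U.wick l, U.wick_mem l⟩

theorem wordProjection_wickElement {κ : Type u} (b : HilbertBasis κ ℂ (Complexification E)) (d : ℕ)
    (l : List (Complexification E)) :
    U.wordProjection b d (U.wickElement l) = if l.length ≤ d then U.wickElement l else 0 := by
  refine Subtype.ext ?_
  rw [coe_wordProjection]
  refine (U.truncation_wick b d l).trans ?_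
  split_ifs <;> rfl

theorem ext_wickElement {Φ Ψ : ArakiWoodsAlgebra U →L[ℂ] ArakiWoodsAlgebra U}
    (h : ∀ l, Φ (U.wickElement l) = Ψ (U.wickElement l)) : Φ = Ψ := by
  have hd : Dense (Submodule.span ℂ (Set.range U.wickElement) : Set (ArakiWoodsAlgebra U)) := by
    intro a
    rw [closure_subtype]
    refine closure_mono ?_ (U.mem_closure_span_wick a.2)
    have : Submodule.span ℂ (Set.range U.wick) ≤
        (Submodule.span ℂ (Set.range U.wickElement)).map
          (ArakiWoodsAlgebra U).toSubalgebra.toSubmodule.subtype := by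
      rw [Submodule.span_le]
      rintro _ ⟨l, rfl⟩
      exact ⟨U.wickElement l, Submodule.subset_span ⟨l, rfl⟩, rfl⟩
    exact this
  have h2 : Set.EqOn (Φ : ArakiWoodsAlgebra U →ₗ[ℂ] ArakiWoodsAlgebra U)
      (Ψ : ArakiWoodsAlgebra U →ₗ[ℂ] ArakiWoodsAlgebra U)
      (Submodule.span ℂ (Set.range U.wickElement) : Set (ArakiWoodsAlgebra U)) := by
    refine LinearMap.eqOn_span ?_
    rintro _ ⟨l, rfl⟩
    exact h l
  exact DFunLike.coe_injective (Continuous.ext_on hd Φ.continuous Ψ.continuous h2)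

theorem isWordProjection_iff {κ : Type u} (b : HilbertBasis κ ℂ (Complexification E)) (d : ℕ)
    (Φ : ArakiWoodsAlgebra U →L[ℂ] ArakiWoodsAlgebra U) :
    IsWordProjection U d Φ ↔ Φ = U.wordProjection b d := by
  constructor
  · intro h
    refine U.ext_wickElement fun l => ?_
    rw [wordProjection_wickElement]
    have := h (l.map U.embeddingOperator) (fun v hv => by
      obtain ⟨x, _, rfl⟩ := List.mem_map.1 hv
      exact U.mem_complexSubspace.2 ⟨x, rfl⟩) (U.wickElement l) (U.isWickWord_iff.2 rfl)
    rw [this, List.length_map]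
    by_cases hl : l.length ≤ d
    · simp only [if_pos hl, one_smul]
    · simp only [if_neg hl, zero_smul]
  · rintro rfl e he x hx
    obtain ⟨l, rfl⟩ := U.exists_map_embeddingOperator he
    have hx' : x = U.wickElement l := Subtype.ext (U.isWickWord_iff.1 hx)
    rw [hx', wordProjection_wickElement, List.length_map]
    by_cases hl : l.length ≤ d
    · simp only [if_pos hl, one_smul]
    · simp only [if_neg hl, zero_smul]

theorem cbNorm_wordProjection_le {κ : Type u} (b : HilbertBasis κ ℂ (Complexification E)) (d : ℕ) :
    cbNorm (U.wordProjection b d) ≤ ENNReal.ofReal (hankelNorm d) := by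
  refine iSup_le fun n => iSup_le fun X => iSup_le fun hX => ?_
  have h := norm_truncation_le b (d := d) (Finset.range (d + 1)) (hankelVal d) (hankelVec d)
    (fun s hs => by
      have := hankelVec_orthonormal hs hs
      rw [if_pos rfl] at this
      simp_rw [sq]
      exact this.le)
    (fun t ht t' ht' => hankel_spectral ht ht')
    (X.map fun x => (x : FockSpace (Complexification E) →L[ℂ] FockSpace (Complexification E)))
  rw [← ofReal_norm]
  refine ENNReal.ofReal_le_ofReal ?_
  refine (h.trans (mul_le_of_le_one_right ?_ hX))
  exact Finset.sum_nonneg fun _ _ => abs_nonneg _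

end OrthogonalGroup

/-! ### Entries of operators on amplifications -/

section Entries

variable {ι F : Type*} [DecidableEq ι] [NormedAddCommGroup F] [InnerProductSpace ℂ F]
  [CompleteSpace F]

/-- The matrix entries of an operator on a direct sum of copies of `F`. -/
def entry (T : Amp ι F →L[ℂ] Amp ι F) (i k : ι) : F →L[ℂ] F :=
  (lp.evalCLM ℂ (fun _ : ι => F) 2 i).comp
    (T.comp (lp.singleContinuousLinearMap ℂ (fun _ : ι => F) 2 k))

theorem entry_apply (T : Amp ι F →L[ℂ] Amp ι F) (i k : ι) (x : F) :
    entry T i k x = T (lp.single 2 k x) i := rfl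

theorem inner_entry (T : Amp ι F →L[ℂ] Amp ι F) (i k : ι) (x y : F) :
    ⟪y, entry T i k x⟫_ℂ = ⟪(lp.single 2 i y : Amp ι F), T (lp.single 2 k x)⟫_ℂ := by
  rw [lp.inner_single_left, entry_apply]

theorem entry_star (T : Amp ι F →L[ℂ] Amp ι F) (i k : ι) :
    entry (star T) i k = star (entry T k i) := by
  ext1 x
  refine ext_inner_left ℂ fun y => ?_
  rw [inner_entry, ContinuousLinearMap.star_eq_adjoint T, ContinuousLinearMap.adjoint_inner_right,
    ContinuousLinearMap.star_eq_adjoint, ContinuousLinearMap.adjoint_inner_right,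
    ← inner_conj_symm, ← inner_entry, inner_conj_symm]

theorem entry_add (T T' : Amp ι F →L[ℂ] Amp ι F) (i k : ι) :
    entry (T + T') i k = entry T i k + entry T' i k := rfl

theorem entry_one (i k : ι) :
    entry (1 : Amp ι F →L[ℂ] Amp ι F) i k = if i = k then 1 else 0 := by
  ext1 x
  rw [entry_apply]
  show (lp.single 2 k x : Amp ι F) i = _
  split_ifs with h
  · subst h; rw [lp.single_apply_self]; rfl
  · rw [lp.single_apply_ne _ _ _ h]; rfl

theorem entry_zero (i k : ι) : entry (0 : Amp ι F →L[ℂ] Amp ι F) i k = 0 := rfl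

theorem entry_sum {σ : Type*} (s : Finset σ) (T : σ → Amp ι F →L[ℂ] Amp ι F) (i k : ι) :
    entry (∑ a ∈ s, T a) i k = ∑ a ∈ s, entry (T a) i k := by
  classical
  induction s using Finset.induction_on with
  | empty => rw [Finset.sum_empty, Finset.sum_empty, entry_zero]
  | insert a s ha ih => rw [Finset.sum_insert ha, Finset.sum_insert ha, entry_add, ih]

variable {n : ℕ}

theorem norm_sq_sum_single (σ : Fin n ↪ ι) (w : Fin n → F) :
    ‖∑ k, (lp.single 2 (σ k) (w k) : Amp ι F)‖ ^ 2 = ∑ k, ‖w k‖ ^ 2 := by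
  have h : ⟪∑ k, (lp.single 2 (σ k) (w k) : Amp ι F), ∑ k, (lp.single 2 (σ k) (w k) : Amp ι F)⟫_ℂ =
      ((∑ k, ‖w k‖ ^ 2 : ℝ) : ℂ) := by
    rw [sum_inner, Complex.ofReal_sum]
    refine Finset.sum_congr rfl fun i _ => ?_
    rw [inner_sum, Finset.sum_eq_single i]
    · rw [inner_single_single, if_pos rfl, inner_self_eq_norm_sq_to_K]
      push_cast; rfl
    · intro k _ hk
      rw [inner_single_single, if_neg (fun h => hk (σ.injective h).symm)]
    · intro h; exact absurd (Finset.mem_univ _) h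
  rw [inner_self_eq_norm_sq_to_K] at h
  refine Complex.ofReal_injective ?_
  rw [Complex.ofReal_pow]
  exact h

theorem sum_entry_apply (σ : Fin n ↪ ι) (T : Amp ι F →L[ℂ] Amp ι F) (w : Fin n → F) (i : ι) :
    ∑ k, entry T i (σ k) (w k) = T (∑ k, lp.single 2 (σ k) (w k)) i := by
  rw [map_sum, lp.coeFn_sum, Finset.sum_apply]
  rfl

theorem norm_matrixOperator_entry_le {F : Type u} [NormedAddCommGroup F] [InnerProductSpace ℂ F]
    [CompleteSpace F] (σ : Fin n ↪ ι) (T : Amp ι F →L[ℂ] Amp ι F) :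
    ‖matrixOperator (Matrix.of fun i k => entry T (σ i) (σ k))‖ ≤ ‖T‖ := by
  refine norm_matrixOperator_le (norm_nonneg _) fun w => ?_
  simp only [Matrix.of_apply, sum_entry_apply]
  have h1 := sum_le_hasSum (Finset.univ.map σ) (fun _ _ => sq_nonneg _)
    (hasSum_norm_sq_amp (T (∑ k, lp.single 2 (σ k) (w k))))
  rw [Finset.sum_map] at h1
  refine h1.trans ?_
  rw [← norm_sq_sum_single σ w, ← mul_pow]
  exact pow_le_pow_left₀ (norm_nonneg _) (T.le_opNorm _) 2

/-- The cb norm sees only finite matrices, while the test operator acts on infinitely many copies.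
Finitely supported vectors are dense, so finite compressions control the quadratic form, and the
lower bound uses only a diagonal value ⟪v, T v⟫. -/
theorem norm_inner_le_of_entries {F : Type u} [NormedAddCommGroup F] [InnerProductSpace ℂ F]
    [CompleteSpace F] {T : Amp ι F →L[ℂ] Amp ι F} {c : ℝ}
    (h : ∀ (n : ℕ) (σ : Fin n ↪ ι),
      ‖matrixOperator (Matrix.of fun i k => entry T (σ i) (σ k))‖ ≤ c) (f : Amp ι F) :
    ‖⟪f, T f⟫_ℂ‖ ≤ c * ‖f‖ ^ 2 := by
  have hf := lp.hasSum_single (p := 2) (by norm_num) f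
  have hcl : IsClosed {g : Amp ι F | ‖⟪g, T g⟫_ℂ‖ ≤ c * ‖g‖ ^ 2} :=
    isClosed_le (by fun_prop) (by fun_prop)
  refine hcl.mem_of_tendsto hf (Eventually.of_forall fun S => ?_)
  set σ : Fin S.card ↪ ι := S.equivFin.symm.toEmbedding.trans (Function.Embedding.subtype _) with hσ
  have hS : ∑ i ∈ S, (lp.single 2 i (f i) : Amp ι F) =
      ∑ k, (lp.single 2 (σ k) (f (σ k)) : Amp ι F) := by
    rw [← Finset.sum_coe_sort S]
    exact (Equiv.sum_comp S.equivFin.symm fun i : S => (lp.single 2 (i : ι) (f i) : Amp ι F)).symm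
  show ‖⟪∑ i ∈ S, (lp.single 2 i (f i) : Amp ι F), T (∑ i ∈ S, lp.single 2 i (f i))⟫_ℂ‖ ≤
    c * ‖∑ i ∈ S, (lp.single 2 i (f i) : Amp ι F)‖ ^ 2
  rw [hS]
  set M := matrixOperator (Matrix.of fun i k => entry T (σ i) (σ k)) with hM
  set w : PiLp 2 (fun _ : Fin S.card => F) := WithLp.toLp 2 fun k => f (σ k) with hw
  have h1 : ⟪∑ k, (lp.single 2 (σ k) (f (σ k)) : Amp ι F),
      T (∑ k, lp.single 2 (σ k) (f (σ k)))⟫_ℂ = ⟪w, M w⟫_ℂ := by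
    rw [sum_inner, PiLp.inner_apply]
    refine Finset.sum_congr rfl fun i _ => ?_
    rw [lp.inner_single_left, ← sum_entry_apply, hM, matrixOperator_apply]
    rfl
  rw [h1, norm_sq_sum_single]
  have h2 : ∑ k, ‖f (σ k)‖ ^ 2 = ‖w‖ ^ 2 := by rw [PiLp.norm_sq_eq_of_L2]
  rw [h2]
  refine (norm_inner_le_norm _ _).trans ?_
  refine (mul_le_mul_of_nonneg_left (M.le_opNorm w) (norm_nonneg _)).trans ?_
  have := mul_le_mul_of_nonneg_right (h _ σ) (sq_nonneg ‖w‖)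
  linarith

end Entries

/-! ### Row operators on words -/

section RowOperators

variable {α F : Type*} [Fintype α] [DecidableEq α] [NormedAddCommGroup F] [InnerProductSpace ℂ F]
  [CompleteSpace F]

/-- The components of the shift by the letter `i`. -/
def shiftFun (i : α) (f : List α → F) : List α → F
  | [] => 0
  | k :: w => if k = i then f w else 0

theorem hasSum_shiftFun (i : α) (f : Amp (List α) F) :
    HasSum (fun w => ‖shiftFun i f w‖ ^ 2) (‖f‖ ^ 2) := by
  have hinj : Function.Injective (List.cons i) := List.cons_injective
  refine (hinj.hasSum_iff ?_).1 ((hasSum_norm_sq_amp f).congr_fun fun w => ?_)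
  · intro w hw
    cases w with
    | nil => simp [shiftFun]
    | cons k w =>
      have : k ≠ i := fun h => hw ⟨w, by rw [h]⟩
      simp [shiftFun, this]
  · simp [shiftFun]

variable (F) in
/-- The isometry which sends the copy of `F` at `w` to the copy at `i w`. -/
def shift (i : α) : Amp (List α) F →ₗᵢ[ℂ] Amp (List α) F where
  toFun f := ⟨shiftFun i f, memℓp_gen (by simpa using (hasSum_shiftFun i f).summable)⟩
  map_add' f g := by
    ext w
    cases w with
    | nil => exact (add_zero (0 : F)).symm
    | cons k w =>
      show (if k = i then f w + g w else 0) = (if k = i then f w else 0) + (if k = i then g w else 0)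
      split_ifs <;> simp
  map_smul' c f := by
    ext w
    cases w with
    | nil => exact (smul_zero c).symm
    | cons k w =>
      show (if k = i then c • f w else 0) = c • (if k = i then f w else 0)
      split_ifs <;> simp
  norm_map' f := by
    have h := (hasSum_norm_sq_amp (⟨shiftFun i f, memℓp_gen (by
      simpa using (hasSum_shiftFun i f).summable)⟩ : Amp (List α) F)).unique (hasSum_shiftFun i f)
    exact (sq_eq_sq₀ (norm_nonneg _) (norm_nonneg _)).1 h

theorem shift_apply_nil (i : α) (f : Amp (List α) F) : shift F i f [] = 0 := rfl

theorem shift_apply_cons (i k : α) (w : List α) (f : Amp (List α) F) :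
    shift F i f (k :: w) = if k = i then f w else 0 := rfl

theorem inner_shift (i k : α) (f g : Amp (List α) F) :
    ⟪shift F i f, shift F k g⟫_ℂ = if i = k then ⟪f, g⟫_ℂ else 0 := by
  split_ifs with h
  · subst h; exact (shift F i).inner_map_map f g
  · rw [lp.inner_eq_tsum]
    have : ∀ w, ⟪shift F i f w, shift F k g w⟫_ℂ = 0 := by
      intro w
      cases w with
      | nil => rw [shift_apply_nil, inner_zero_left]
      | cons j w =>
        rw [shift_apply_cons, shift_apply_cons]
        split_ifs with h1 h2
        · exact absurd (h1.symm.trans h2) h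
        all_goals simp
    simp [this]

/-- The operator `f ↦ (i w ↦ a_i f(w))`. -/
def rowOperator (a : α → F →L[ℂ] F) : Amp (List α) F →L[ℂ] Amp (List α) F :=
  ∑ i, (shift F i).toContinuousLinearMap.comp (ampl (List α) (a i))

theorem rowOperator_apply (a : α → F →L[ℂ] F) (f : Amp (List α) F) :
    rowOperator a f = ∑ i, shift F i (ampl (List α) (a i) f) := by
  rw [rowOperator, sum_apply]; rfl

theorem rowOperator_apply_nil (a : α → F →L[ℂ] F) (f : Amp (List α) F) :
    rowOperator a f [] = 0 := by
  rw [rowOperator_apply, lp.coeFn_sum, Finset.sum_apply]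
  exact Finset.sum_eq_zero fun i _ => rfl

theorem rowOperator_apply_cons (a : α → F →L[ℂ] F) (f : Amp (List α) F) (i : α) (w : List α) :
    rowOperator a f (i :: w) = a i (f w) := by
  rw [rowOperator_apply, lp.coeFn_sum, Finset.sum_apply, Finset.sum_eq_single i]
  · rw [shift_apply_cons, if_pos rfl, ampl_apply]
  · intro k _ hk; rw [shift_apply_cons, if_neg (Ne.symm hk)]
  · intro h; exact absurd (Finset.mem_univ _) h

/-- Different letters lead to orthogonal copies, so the cross terms vanish and the product of the
adjoint with the second operator is a diagonal action. -/
theorem inner_rowOperator (a b : α → F →L[ℂ] F) (f g : Amp (List α) F) :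
    ⟪rowOperator a f, rowOperator b g⟫_ℂ = ⟪f, ampl (List α) (∑ i, star (a i) * b i) g⟫_ℂ := by
  have h : ampl (List α) (∑ i, star (a i) * b i) = ∑ i, ampl (List α) (star (a i) * b i) := by
    rw [← amplL_apply, map_sum]; rfl
  rw [rowOperator_apply, rowOperator_apply, h, sum_apply, sum_inner, inner_sum]
  refine Finset.sum_congr rfl fun i _ => ?_
  rw [inner_sum, Finset.sum_eq_single i]
  · rw [inner_shift, if_pos rfl, ampl_mul, ContinuousLinearMap.mul_def,
      ContinuousLinearMap.comp_apply, ← adjoint_ampl, ContinuousLinearMap.adjoint_inner_right]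
  · intro k _ hk; rw [inner_shift, if_neg (Ne.symm hk)]
  · intro h; exact absurd (Finset.mem_univ _) h

theorem entry_rowOperator_mul_nil (a : α → F →L[ℂ] F) (T : Amp (List α) F →L[ℂ] Amp (List α) F)
    (w : List α) : entry (rowOperator a * T) [] w = 0 := by
  ext1 x
  exact rowOperator_apply_nil a _

theorem entry_rowOperator_mul_cons (a : α → F →L[ℂ] F)
    (T : Amp (List α) F →L[ℂ] Amp (List α) F) (i : α) (w w' : List α) :
    entry (rowOperator a * T) (i :: w) w' = a i * entry T w w' := by
  ext1 x
  exact rowOperator_apply_cons a _ i w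

theorem entry_mul_star_rowOperator_nil (a : α → F →L[ℂ] F)
    (T : Amp (List α) F →L[ℂ] Amp (List α) F) (w : List α) :
    entry (T * star (rowOperator a)) w [] = 0 := by
  rw [← star_star T, ← star_mul, entry_star, entry_rowOperator_mul_nil, star_zero]

theorem entry_mul_star_rowOperator_cons (a : α → F →L[ℂ] F)
    (T : Amp (List α) F →L[ℂ] Amp (List α) F) (i : α) (w w' : List α) :
    entry (T * star (rowOperator a)) w (i :: w') = entry T w w' * star (a i) := by
  rw [← star_star T, ← star_mul, entry_star, entry_rowOperator_mul_cons, star_mul, ← entry_star]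

end RowOperators

/-! ### Perturbations of the Toeplitz matrix units of an isometry -/

/-- The unitary part of the polar decomposition of the Hankel matrix. -/
def hankelSign (d k l : ℕ) : ℝ :=
  ∑ s ∈ Finset.range (d + 1), (-1) ^ s * (hankelVec d s k * hankelVec d s l)

/-- This is the trace of u h, namely Σ (−1)^s λ_s, and (−1)^s λ_s = |λ_s| because the cosines are
nonnegative. -/
theorem sum_hankelSign_mul_hankel (d : ℕ) :
    ∑ k ∈ Finset.range (d + 1), ∑ l ∈ Finset.range (d + 1), hankelSign d k l * hankel d k l =
      hankelNorm d := by
  have h1 : ∀ k ∈ Finset.range (d + 1),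
      ∑ l ∈ Finset.range (d + 1), hankelSign d k l * hankel d k l =
        ∑ s ∈ Finset.range (d + 1), (-1) ^ s * hankelVal d s * (hankelVec d s k * hankelVec d s k) := by
    intro k hk
    simp_rw [hankelSign, Finset.sum_mul]
    rw [Finset.sum_comm]
    refine Finset.sum_congr rfl fun s _ => ?_
    have := hankel_eigen (s := s) hk
    calc _ = (-1) ^ s * hankelVec d s k *
          ∑ l ∈ Finset.range (d + 1), hankel d k l * hankelVec d s l := by
          rw [Finset.mul_sum]
          exact Finset.sum_congr rfl fun l _ => by ring
      _ = _ := by rw [this]; ring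
  rw [Finset.sum_congr rfl h1, Finset.sum_comm, hankelNorm]
  refine Finset.sum_congr rfl fun s hs => ?_
  rw [← Finset.mul_sum, hankelVec_orthonormal hs hs, if_pos rfl, mul_one]
  have h2 : 0 ≤ (-1) ^ s * hankelVal d s := by
    have := abs_hankelVal hs
    have h3 : (-1 : ℝ) ^ s * hankelVal d s = 2 * Real.cos (Real.pi * (s + 1) / (2 * d + 3)) := by
      rw [hankelVal, ← mul_assoc, ← mul_assoc, ← mul_pow]; norm_num
    rw [h3, ← this]
    exact abs_nonneg _
  rw [← abs_of_nonneg h2, abs_mul, abs_pow, abs_neg, abs_one, one_pow, one_mul]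

section Grid

variable {K : Type*} [NormedAddCommGroup K] [InnerProductSpace ℂ K] [CompleteSpace K]

theorem sum_norm_sq_hankelVec (d : ℕ) (η : ℕ → K) :
    ∑ s ∈ Finset.range (d + 1), ‖∑ k ∈ Finset.range (d + 1), (hankelVec d s k : ℂ) • η k‖ ^ 2 =
      ∑ k ∈ Finset.range (d + 1), ‖η k‖ ^ 2 := by
  refine Complex.ofReal_injective ?_
  rw [Complex.ofReal_sum, Complex.ofReal_sum]
  have h1 : ∀ ζ : K, ((‖ζ‖ ^ 2 : ℝ) : ℂ) = ⟪ζ, ζ⟫_ℂ := by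
    intro ζ
    rw [inner_self_eq_norm_sq_to_K, Complex.ofReal_pow]; rfl
  simp_rw [h1, sum_inner, inner_sum, inner_smul_left, inner_smul_right, Complex.conj_ofReal]
  rw [Finset.sum_comm]
  refine Finset.sum_congr rfl fun k hk => ?_
  rw [Finset.sum_comm, Finset.sum_eq_single k]
  · have h := hankelVec_orthonormal hk hk
    rw [if_pos rfl] at h
    calc _ = ((∑ s ∈ Finset.range (d + 1), hankelVec d k s * hankelVec d k s : ℝ) : ℂ) *
          ⟪η k, η k⟫_ℂ := by
          rw [Complex.ofReal_sum, Finset.sum_mul]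
          refine Finset.sum_congr rfl fun s _ => ?_
          rw [hankelVec_comm d s k]; push_cast; ring
      _ = _ := by rw [h]; simp
  · intro l hl hkl
    have h := hankelVec_orthonormal hk hl
    rw [if_neg (Ne.symm hkl)] at h
    calc _ = ((∑ s ∈ Finset.range (d + 1), hankelVec d k s * hankelVec d l s : ℝ) : ℂ) *
          ⟪η k, η l⟫_ℂ := by
          rw [Complex.ofReal_sum, Finset.sum_mul]
          refine Finset.sum_congr rfl fun s _ => ?_
          rw [hankelVec_comm d s k, hankelVec_comm d s l]; push_cast; ring
      _ = _ := by rw [h]; simp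
  · intro h; exact absurd hk h

/-- The sine vectors diagonalize u with eigenvalues ±1 and preserve the square norm of tuples, so
Cauchy–Schwarz in the diagonalizing coordinates suffices. -/
theorem norm_inner_hankelSign_le (d : ℕ) (η ζ : ℕ → K) :
    ‖∑ k ∈ Finset.range (d + 1), ∑ l ∈ Finset.range (d + 1),
      (hankelSign d k l : ℂ) * ⟪η k, ζ l⟫_ℂ‖ ≤
      √(∑ k ∈ Finset.range (d + 1), ‖η k‖ ^ 2) * √(∑ k ∈ Finset.range (d + 1), ‖ζ k‖ ^ 2) := by
  have h1 : ∑ k ∈ Finset.range (d + 1), ∑ l ∈ Finset.range (d + 1),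
      (hankelSign d k l : ℂ) * ⟪η k, ζ l⟫_ℂ = ∑ s ∈ Finset.range (d + 1), (-1) ^ s *
        ⟪∑ k ∈ Finset.range (d + 1), (hankelVec d s k : ℂ) • η k,
          ∑ l ∈ Finset.range (d + 1), (hankelVec d s l : ℂ) • ζ l⟫_ℂ := by
    simp_rw [sum_inner, inner_sum, inner_smul_left, inner_smul_right, Complex.conj_ofReal,
      Finset.mul_sum]
    rw [Finset.sum_comm]
    conv_rhs => rw [Finset.sum_comm]
    rw [Finset.sum_comm]
    refine Finset.sum_congr rfl fun k _ => ?_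
    conv_rhs => rw [Finset.sum_comm]
    refine Finset.sum_congr rfl fun l _ => ?_
    rw [hankelSign, Complex.ofReal_sum, Finset.sum_mul]
    refine Finset.sum_congr rfl fun s _ => ?_
    push_cast; ring
  rw [h1]
  refine (norm_sum_le _ _).trans ?_
  refine (Finset.sum_le_sum fun s _ => ?_).trans ((Real.sum_mul_le_sqrt_mul_sqrt _
    (fun s => ‖∑ k ∈ Finset.range (d + 1), (hankelVec d s k : ℂ) • η k‖)
    (fun s => ‖∑ k ∈ Finset.range (d + 1), (hankelVec d s k : ℂ) • ζ k‖)).trans (le_of_eq ?_))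
  · rw [norm_mul, norm_pow, norm_neg, norm_one, one_pow, one_mul]
    exact norm_inner_le_norm _ _
  · rw [sum_norm_sq_hankelVec, sum_norm_sq_hankelVec]

variable {L G : K →L[ℂ] K}

theorem norm_star_apply_sq_add (hL : star L * L = 1) (ζ : K) :
    ‖(1 - L * star L) ζ‖ ^ 2 = ‖ζ‖ ^ 2 - ‖star L ζ‖ ^ 2 := by
  have h1 : ∀ f g, ⟪L f, g⟫_ℂ = ⟪f, star L g⟫_ℂ := fun f g =>
    (ContinuousLinearMap.adjoint_inner_right L f g).symm
  have h2 : star L (L (star L ζ)) = star L ζ :=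
    congrArg (fun T : K →L[ℂ] K => T (star L ζ)) hL
  have h3 : ⟪(1 - L * star L) ζ, (1 - L * star L) ζ⟫_ℂ = ⟪ζ, ζ⟫_ℂ - ⟪star L ζ, star L ζ⟫_ℂ := by
    show ⟪ζ - L (star L ζ), ζ - L (star L ζ)⟫_ℂ = _
    have h5 : ⟪ζ, L (star L ζ)⟫_ℂ = ⟪star L ζ, star L ζ⟫_ℂ :=
      (ContinuousLinearMap.adjoint_inner_left L (star L ζ) ζ).symm
    rw [inner_sub_left, inner_sub_right, inner_sub_right, h1, h1, h2, sub_self, sub_zero, h5]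
  have h4 : ∀ ζ : K, ((‖ζ‖ ^ 2 : ℝ) : ℂ) = ⟪ζ, ζ⟫_ℂ := by
    intro ζ
    rw [inner_self_eq_norm_sq_to_K, Complex.ofReal_pow]; rfl
  refine Complex.ofReal_injective ?_
  rw [Complex.ofReal_sub, h4, h4, h4, h3]

/-- The sum telescopes, because ‖(1 − LL*)ζ‖² = ‖ζ‖² − ‖L*ζ‖². -/
theorem sum_norm_sq_defect_le (hL : star L * L = 1) (ζ : K) (n : ℕ) :
    ∑ k ∈ Finset.range n, ‖(1 - L * star L) ((star L ^ k) ζ)‖ ^ 2 ≤ ‖ζ‖ ^ 2 := by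
  have h : ∑ k ∈ Finset.range n, ‖(1 - L * star L) ((star L ^ k) ζ)‖ ^ 2 =
      ‖ζ‖ ^ 2 - ‖(star L ^ n) ζ‖ ^ 2 := by
    induction n with
    | zero => simp
    | succ n ih =>
      rw [Finset.sum_range_succ, ih, norm_star_apply_sq_add hL, pow_succ' (star L)]
      show _ + (_ - ‖star L ((star L ^ n) ζ)‖ ^ 2) = _ - ‖star L ((star L ^ n) ζ)‖ ^ 2
      ring
  rw [h]
  linarith [sq_nonneg ‖(star L ^ n) ζ‖]

/-- With the projection Q = 1 − LL*, each term has matrix coefficient ⟪Q L*^k f, Q L*^l g⟫. The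
tuples (Q L*^k f) and (Q L*^l g) have square sums at most ‖f‖² and ‖g‖², and u is contractive on
tuples. -/
theorem norm_sum_hankelSign_defect_le (hL : star L * L = 1) (d : ℕ) :
    ‖∑ k ∈ Finset.range (d + 1), ∑ l ∈ Finset.range (d + 1),
      (hankelSign d k l : ℂ) • (L ^ k * (1 - L * star L) * star L ^ l)‖ ≤ 1 := by
  set T := ∑ k ∈ Finset.range (d + 1), ∑ l ∈ Finset.range (d + 1),
      (hankelSign d k l : ℂ) • (L ^ k * (1 - L * star L) * star L ^ l) with hT
  have hQ : star (1 - L * star L) * (1 - L * star L) = 1 - L * star L := by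
    rw [star_sub, star_one, star_mul, star_star, mul_sub, mul_one, sub_mul, one_mul,
      mul_assoc L, ← mul_assoc (star L), hL, one_mul, sub_self, sub_zero]
  have hadj : ∀ (S : K →L[ℂ] K) f g, ⟪f, S g⟫_ℂ = ⟪star S f, g⟫_ℂ := fun S f g =>
    (ContinuousLinearMap.adjoint_inner_left S g f).symm
  have key : ∀ f g : K, ‖⟪f, T g⟫_ℂ‖ ≤ ‖f‖ * ‖g‖ := by
    intro f g
    have h1 : ⟪f, T g⟫_ℂ = ∑ k ∈ Finset.range (d + 1), ∑ l ∈ Finset.range (d + 1),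
        (hankelSign d k l : ℂ) * ⟪(1 - L * star L) ((star L ^ k) f),
          (1 - L * star L) ((star L ^ l) g)⟫_ℂ := by
      rw [hT, sum_apply, inner_sum]
      refine Finset.sum_congr rfl fun k _ => ?_
      rw [sum_apply, inner_sum]
      refine Finset.sum_congr rfl fun l _ => ?_
      rw [smul_apply, inner_smul_right]
      congr 1
      have h2 : ⟪f, (L ^ k * (1 - L * star L) * star L ^ l) g⟫_ℂ =
          ⟪star (L ^ k) f, (star (1 - L * star L) * (1 - L * star L)) ((star L ^ l) g)⟫_ℂ := by
        rw [hQ]; exact hadj (L ^ k) f _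
      rw [h2, star_pow]
      exact (hadj (star (1 - L * star L)) _ _).trans (by rw [star_star]; rfl)
    rw [h1]
    refine (norm_inner_hankelSign_le d _ _).trans ?_
    exact mul_le_mul (Real.sqrt_le_iff.2 ⟨norm_nonneg _, sum_norm_sq_defect_le hL f _⟩)
      (Real.sqrt_le_iff.2 ⟨norm_nonneg _, sum_norm_sq_defect_le hL g _⟩)
      (Real.sqrt_nonneg _) (norm_nonneg _)
  refine ContinuousLinearMap.opNorm_le_bound _ zero_le_one fun g => ?_
  rw [one_mul]
  have h := key (T g) g
  rw [inner_self_eq_norm_sq_to_K, norm_pow] at h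
  have h2 : ‖T g‖ * ‖T g‖ ≤ ‖T g‖ * ‖g‖ := by
    rw [← sq]
    simpa using h
  rcases (norm_nonneg (T g)).eq_or_lt with h0 | h0
  · rw [← h0]; exact norm_nonneg _
  · exact le_of_mul_le_mul_left h2 h0

variable (L G) in
/-- The sum of `L^k L^{*l}`, the `L^p G^(k-p) L^{*l}` and the `L^k G^{*p} L^{*(l-p)}`. -/
def gridOperator : ℕ → ℕ → K →L[ℂ] K
  | 0, 0 => 1
  | 0, l + 1 => gridOperator 0 l * star L + star G ^ (l + 1)
  | k + 1, l => L * gridOperator k l + G ^ (k + 1) * star L ^ l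

theorem norm_pow_le_one {a : K →L[ℂ] K} (ha : ‖a‖ ≤ 1) (n : ℕ) : ‖a ^ n‖ ≤ 1 := by
  induction n with
  | zero => rw [pow_zero]; exact ContinuousLinearMap.norm_id_le
  | succ n ih =>
    rw [pow_succ]
    exact (norm_mul_le _ _).trans (mul_le_one₀ ih (norm_nonneg _) ha)

theorem norm_le_one_of_isometry (hL : star L * L = 1) : ‖L‖ ≤ 1 := by
  have h : ‖L‖ * ‖L‖ ≤ 1 := by
    rw [← CStarRing.norm_star_mul_self, hL]
    exact ContinuousLinearMap.norm_id_le
  nlinarith [norm_nonneg L]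

/-- There are k + l correction terms. Each contains at least one factor G or G*, and its remaining
factors are contractions. -/
theorem norm_gridOperator_sub_le {ε : ℝ} (hL : ‖L‖ ≤ 1) (hG : ‖G‖ ≤ ε) (hε : ε ≤ 1) (k l : ℕ) :
    ‖gridOperator L G k l - L ^ k * star L ^ l‖ ≤ (k + l) * ε := by
  have hpow : ∀ {a : K →L[ℂ] K}, ‖a‖ ≤ ε → ∀ n, ‖a ^ (n + 1)‖ ≤ ε := by
    intro a ha n
    rw [pow_succ]
    refine (norm_mul_le _ _).trans ((mul_le_of_le_one_left (norm_nonneg _)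
      (norm_pow_le_one (ha.trans hε) n)).trans ha)
  have hL' : ‖star L‖ ≤ 1 := by rwa [norm_star]
  have hG' : ‖star G‖ ≤ ε := by rwa [norm_star]
  induction k with
  | zero =>
    induction l with
    | zero => simp [gridOperator]
    | succ l ih =>
      have h : gridOperator L G 0 (l + 1) - L ^ 0 * star L ^ (l + 1) =
          (gridOperator L G 0 l - L ^ 0 * star L ^ l) * star L + star G ^ (l + 1) := by
        rw [gridOperator, pow_succ (star L)]; noncomm_ring
      rw [h]
      refine (norm_add_le _ _).trans ?_
      have h1 := (norm_mul_le (gridOperator L G 0 l - L ^ 0 * star L ^ l) (star L)).trans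
        (mul_le_of_le_one_right (norm_nonneg _) hL')
      have h2 := hpow hG' l
      push_cast at ih ⊢
      linarith
  | succ k ih =>
    have h : gridOperator L G (k + 1) l - L ^ (k + 1) * star L ^ l =
        L * (gridOperator L G k l - L ^ k * star L ^ l) + G ^ (k + 1) * star L ^ l := by
      rw [gridOperator, pow_succ' L, mul_sub, mul_assoc]; abel
    rw [h]
    refine (norm_add_le _ _).trans ?_
    have h1 := (norm_mul_le L (gridOperator L G k l - L ^ k * star L ^ l)).trans
      (mul_le_of_le_one_left (norm_nonneg _) hL)
    have h2 := (norm_mul_le (G ^ (k + 1)) (star L ^ l)).trans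
      (mul_le_of_le_one_right (norm_nonneg _) (norm_pow_le_one hL' l))
    have h3 := hpow hG k
    push_cast
    linarith

theorem norm_inner_word_sub_one_le {ε : ℝ} (hL : ‖L‖ ≤ 1) {v : K} (hv : ‖v‖ = 1)
    (hLv : ‖star L v - v‖ ≤ ε) (k l : ℕ) :
    ‖⟪v, (L ^ k * star L ^ l) v⟫_ℂ - 1‖ ≤ (k + l) * ε := by
  have hL' : ‖star L‖ ≤ 1 := by rwa [norm_star]
  have h1 : ∀ n : ℕ, ‖(star L ^ n) v - v‖ ≤ n * ε := by
    intro n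
    induction n with
    | zero => simp
    | succ n ih =>
      have e : (star L ^ (n + 1)) v - v = star L ((star L ^ n) v - v) + (star L v - v) := by
        rw [map_sub, pow_succ']
        show star L ((star L ^ n) v) - v = _
        abel
      rw [e]
      refine (norm_add_le _ _).trans ?_
      have := ((star L).le_opNorm ((star L ^ n) v - v)).trans
        (mul_le_of_le_one_left (norm_nonneg _) hL')
      rw [Nat.cast_succ]
      linarith
  have h2 : ‖(star L ^ l) v‖ ≤ 1 := by
    have := (star L ^ l).le_of_opNorm_le (norm_pow_le_one hL' l) v
    rwa [hv, one_mul] at this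
  have h3 : ⟪v, (L ^ k * star L ^ l) v⟫_ℂ - 1 =
      ⟪(star L ^ k) v - v, (star L ^ l) v⟫_ℂ + ⟪v, (star L ^ l) v - v⟫_ℂ := by
    rw [inner_sub_left, inner_sub_right, inner_self_eq_norm_sq_to_K, hv]
    have : ⟪v, (L ^ k * star L ^ l) v⟫_ℂ = ⟪(star L ^ k) v, (star L ^ l) v⟫_ℂ := by
      rw [← star_pow L k]
      exact (ContinuousLinearMap.adjoint_inner_left (L ^ k) _ v).symm
    rw [this]
    push_cast
    ring
  rw [h3]
  refine (norm_add_le _ _).trans ?_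
  have h4 := norm_inner_le_norm (𝕜 := ℂ) ((star L ^ k) v - v) ((star L ^ l) v)
  have h5 := norm_inner_le_norm (𝕜 := ℂ) v ((star L ^ l) v - v)
  rw [hv, one_mul] at h5
  have h6 := mul_le_of_le_one_right (norm_nonneg ((star L ^ k) v - v)) h2
  have := h1 k
  have := h1 l
  linarith

theorem norm_inner_gridOperator_sub_one_le {ε : ℝ} (hL : ‖L‖ ≤ 1) (hG : ‖G‖ ≤ ε) (hε : ε ≤ 1)
    {v : K} (hv : ‖v‖ = 1) (hLv : ‖star L v - v‖ ≤ ε) (k l : ℕ) :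
    ‖⟪v, gridOperator L G k l v⟫_ℂ - 1‖ ≤ 2 * (k + l) * ε := by
  have h1 := norm_inner_word_sub_one_le hL hv hLv k l
  have h2 : ‖⟪v, (gridOperator L G k l - L ^ k * star L ^ l) v⟫_ℂ‖ ≤ (k + l) * ε := by
    refine (norm_inner_le_norm _ _).trans ?_
    rw [hv, one_mul]
    have := (gridOperator L G k l - L ^ k * star L ^ l).le_of_opNorm_le
      (norm_gridOperator_sub_le hL hG hε k l) v
    rwa [hv, mul_one] at this
  have h3 : ⟪v, gridOperator L G k l v⟫_ℂ - 1 =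
      ⟪v, (gridOperator L G k l - L ^ k * star L ^ l) v⟫_ℂ +
        (⟪v, (L ^ k * star L ^ l) v⟫_ℂ - 1) := by
    rw [sub_apply, inner_sub_right]; ring
  rw [h3]
  refine (norm_add_le _ _).trans ?_
  linarith

variable (L G) in
/-- The operator `∑ u_kl (φ(k + l) Y_kl - φ(k + l + 2) Y_{k+1,l+1})`. -/
def gridSum (φ : ℕ → ℂ) (d : ℕ) : K →L[ℂ] K :=
  ∑ k ∈ Finset.range (d + 1), ∑ l ∈ Finset.range (d + 1), (hankelSign d k l : ℂ) •
    (φ (k + l) • gridOperator L G k l - φ (k + 1 + (l + 1)) • gridOperator L G (k + 1) (l + 1))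

/-- The constant in the perturbation estimates for `gridSum`. -/
def gridConst (d : ℕ) : ℝ :=
  ∑ k ∈ Finset.range (d + 1), ∑ l ∈ Finset.range (d + 1), |hankelSign d k l| * (2 * (k + l) + 2)

theorem gridConst_nonneg (d : ℕ) : 0 ≤ gridConst d :=
  Finset.sum_nonneg fun _ _ => Finset.sum_nonneg fun _ _ => by positivity

/-- For φ = 1 the bracket is L^k(1 − LL*)L*^l plus corrections of order ε; the main part is a
contraction and `gridConst`, which depends only on d, collects the rest. -/
theorem norm_gridSum_one_le {ε : ℝ} (hL : star L * L = 1) (hG : ‖G‖ ≤ ε) (hε : ε ≤ 1) (d : ℕ) :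
    ‖gridSum L G (fun _ => 1) d‖ ≤ 1 + gridConst d * ε := by
  have hL1 := norm_le_one_of_isometry hL
  have h : gridSum L G (fun _ => 1) d =
      (∑ k ∈ Finset.range (d + 1), ∑ l ∈ Finset.range (d + 1),
        (hankelSign d k l : ℂ) • (L ^ k * (1 - L * star L) * star L ^ l)) +
      ∑ k ∈ Finset.range (d + 1), ∑ l ∈ Finset.range (d + 1), (hankelSign d k l : ℂ) •
        ((gridOperator L G k l - L ^ k * star L ^ l) -
          (gridOperator L G (k + 1) (l + 1) - L ^ (k + 1) * star L ^ (l + 1))) := by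
    simp_rw [gridSum, ← Finset.sum_add_distrib, ← smul_add]
    refine Finset.sum_congr rfl fun k _ => Finset.sum_congr rfl fun l _ => ?_
    congr 1
    rw [pow_succ L, pow_succ' (star L), one_smul, one_smul]
    noncomm_ring
  rw [h]
  refine (norm_add_le _ _).trans (add_le_add (norm_sum_hankelSign_defect_le hL d) ?_)
  rw [gridConst, Finset.sum_mul]
  refine (norm_sum_le _ _).trans (Finset.sum_le_sum fun k _ => ?_)
  rw [Finset.sum_mul]
  refine (norm_sum_le _ _).trans (Finset.sum_le_sum fun l _ => ?_)
  rw [norm_smul, Complex.norm_real, Real.norm_eq_abs, mul_assoc]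
  refine mul_le_mul_of_nonneg_left ((norm_sub_le _ _).trans ?_) (abs_nonneg _)
  have h1 := norm_gridOperator_sub_le hL1 hG hε k l
  have h2 := norm_gridOperator_sub_le hL1 hG hε (k + 1) (l + 1)
  push_cast at h2
  linarith

/-- Every ⟪v, Y_kl v⟫ is close to 1 since L* almost fixes v. The sum is then close to Σ u_kl (φ(k+l)
− φ(k+l+2)) = Σ u_kl h(k,l), the trace norm. -/
theorem hankelNorm_sub_le_norm_inner_gridSum {ε : ℝ} (hL : star L * L = 1) (hG : ‖G‖ ≤ ε)
    (hε : ε ≤ 1) {v : K} (hv : ‖v‖ = 1) (hLv : ‖star L v - v‖ ≤ ε) (d : ℕ) :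
    hankelNorm d - 2 * gridConst d * ε ≤
      ‖⟪v, gridSum L G (fun n => if n ≤ d then 1 else 0) d v⟫_ℂ‖ := by
  have hL1 := norm_le_one_of_isometry hL
  set φ : ℕ → ℂ := fun n => if n ≤ d then 1 else 0 with hφ
  have hφ1 : ∀ n, ‖φ n‖ ≤ 1 := by
    intro n
    simp only [hφ]
    split_ifs <;> simp
  have hφ2 : ∀ k l, φ (k + l) - φ (k + 1 + (l + 1)) = (hankel d k l : ℂ) := by
    intro k l
    simp only [hφ, hankel]
    split_ifs <;> first | omega | simp
  have h : ⟪v, gridSum L G φ d v⟫_ℂ - hankelNorm d =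
      ∑ k ∈ Finset.range (d + 1), ∑ l ∈ Finset.range (d + 1), (hankelSign d k l : ℂ) *
        (φ (k + l) * (⟪v, gridOperator L G k l v⟫_ℂ - 1) -
          φ (k + 1 + (l + 1)) * (⟪v, gridOperator L G (k + 1) (l + 1) v⟫_ℂ - 1)) := by
    rw [← sum_hankelSign_mul_hankel, gridSum, sum_apply, inner_sum, Complex.ofReal_sum,
      ← Finset.sum_sub_distrib]
    refine Finset.sum_congr rfl fun k _ => ?_
    rw [sum_apply, inner_sum, Complex.ofReal_sum, ← Finset.sum_sub_distrib]
    refine Finset.sum_congr rfl fun l _ => ?_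
    rw [Complex.ofReal_mul, ← hφ2, smul_apply, sub_apply, smul_apply, smul_apply, inner_smul_right,
      inner_sub_right, inner_smul_right, inner_smul_right]
    ring
  have h2 : ‖⟪v, gridSum L G φ d v⟫_ℂ - hankelNorm d‖ ≤ 2 * gridConst d * ε := by
    rw [h, gridConst, mul_assoc, mul_comm, mul_assoc, Finset.sum_mul]
    refine (norm_sum_le _ _).trans (Finset.sum_le_sum fun k _ => ?_)
    rw [Finset.sum_mul]
    refine (norm_sum_le _ _).trans (Finset.sum_le_sum fun l _ => ?_)
    rw [norm_mul, Complex.norm_real, Real.norm_eq_abs, mul_assoc]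
    refine mul_le_mul_of_nonneg_left ((norm_sub_le _ _).trans ?_) (abs_nonneg _)
    rw [norm_mul, norm_mul]
    have h1 := (mul_le_of_le_one_left (norm_nonneg _) (hφ1 (k + l))).trans
      (norm_inner_gridOperator_sub_one_le hL1 hG hε hv hLv k l)
    have h2 := (mul_le_of_le_one_left (norm_nonneg _) (hφ1 (k + 1 + (l + 1)))).trans
      (norm_inner_gridOperator_sub_one_le hL1 hG hε hv hLv (k + 1) (l + 1))
    push_cast at h2
    linarith
  have h3 : hankelNorm d ≤ ‖(hankelNorm d : ℂ)‖ := by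
    rw [Complex.norm_real]; exact le_abs_self _
  have h4 := norm_sub_norm_le (hankelNorm d : ℂ) ⟪v, gridSum L G φ d v⟫_ℂ
  rw [norm_sub_rev] at h4
  linarith

/-- Take w = δ + Lδ + ⋯ + L^N δ. The summands are orthonormal because L*δ = 0, so ‖w‖² = N + 1,
while L*w − w = −L^N δ has norm 1. Normalizing a long sum gives the vector. -/
theorem exists_approx_eigenvector (hL : star L * L = 1) {δ : K} (hδ : ‖δ‖ = 1)
    (hLδ : star L δ = 0) {ε : ℝ} (hε : 0 < ε) : ∃ v : K, ‖v‖ = 1 ∧ ‖star L v - v‖ ≤ ε := by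
  have h1 : ∀ N : ℕ, ∃ w : K, ‖w‖ ^ 2 = N + 1 ∧ ‖star L w - w‖ = 1 := by
    intro N
    set w : ℕ → K := fun n => ∑ t ∈ Finset.range n, (L ^ t) δ with hw
    have hLL : ∀ f, star L (L f) = f := fun f => congrArg (fun T : K →L[ℂ] K => T f) hL
    have hnorm : ∀ f, ‖L f‖ = ‖f‖ := by
      intro f
      refine (sq_eq_sq₀ (norm_nonneg _) (norm_nonneg _)).1 (Complex.ofReal_injective ?_)
      have h : ⟪L f, L f⟫_ℂ = ⟪f, f⟫_ℂ := by
        rw [← ContinuousLinearMap.adjoint_inner_right L f (L f)]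
        exact congrArg (fun g => ⟪f, g⟫_ℂ) (hLL f)
      rw [inner_self_eq_norm_sq_to_K, inner_self_eq_norm_sq_to_K] at h
      rw [Complex.ofReal_pow, Complex.ofReal_pow]
      exact h
    have hw1 : ∀ n, w (n + 1) = δ + L (w n) := by
      intro n
      simp only [hw]
      rw [Finset.sum_range_succ', map_sum, add_comm]
      congr 1
      exact Finset.sum_congr rfl fun t _ => by rw [pow_succ' L]; rfl
    have hpow : ∀ n : ℕ, ‖(L ^ n) δ‖ = 1 := by
      intro n
      induction n with
      | zero => exact hδ
      | succ n ih =>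
        rw [pow_succ' L]
        exact (hnorm _).trans ih
    have hortho : ∀ f, ⟪δ, L f⟫_ℂ = 0 := by
      intro f
      have h : ⟪star L δ, f⟫_ℂ = ⟪δ, L f⟫_ℂ := ContinuousLinearMap.adjoint_inner_left L f δ
      rw [← h, hLδ, inner_zero_left]
    have hw2 : ∀ n : ℕ, ‖w n‖ ^ 2 = n := by
      intro n
      induction n with
      | zero => simp [hw]
      | succ n ih =>
        rw [hw1, sq, norm_add_sq_eq_norm_sq_add_norm_sq_of_inner_eq_zero (𝕜 := ℂ) _ _ (hortho _), hδ,
          hnorm, ← sq ‖w n‖, ih]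
        push_cast; ring
    refine ⟨w (N + 1), by rw [hw2]; push_cast; ring, ?_⟩
    have h : star L (w (N + 1)) - w (N + 1) = -(L ^ N) δ := by
      conv_lhs => rw [hw1]
      rw [map_add, hLδ, zero_add, hLL, ← hw1]
      simp only [hw]
      rw [Finset.sum_range_succ]
      abel
    rw [h, norm_neg, hpow]
  obtain ⟨N, hN⟩ := exists_nat_gt (1 / ε ^ 2)
  obtain ⟨w, hw, hw'⟩ := h1 N
  have hN0 : (0 : ℝ) < N := lt_trans (by positivity) hN
  have hw0 : 0 < ‖w‖ := by
    rcases (norm_nonneg w).eq_or_lt with h | h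
    · rw [← h] at hw; nlinarith
    · exact h
  have hw1 : 1 ≤ ε * ‖w‖ := by
    rw [div_lt_iff₀ (by positivity)] at hN
    refine le_of_sq_le_sq ?_ (by positivity)
    rw [mul_pow, hw]
    nlinarith [sq_nonneg ε]
  refine ⟨((‖w‖⁻¹ : ℝ) : ℂ) • w, ?_, ?_⟩
  · rw [norm_smul, Complex.norm_real, norm_inv, norm_norm, inv_mul_cancel₀ hw0.ne']
  · rw [map_smul, ← smul_sub, norm_smul, hw', Complex.norm_real, norm_inv, norm_norm, mul_one]
    exact inv_le_of_inv_le₀ hε (by rw [inv_le_iff_one_le_mul₀ hε]; linarith)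

end Grid

/-! ### The lower bound -/

section Grid

variable {H : Type u} [NormedAddCommGroup H] [InnerProductSpace ℂ H] [CompleteSpace H]
  {n : ℕ} {e : Fin (n + 1) → H}

/-- The normalised row of creation operators. -/
def creationRow (e : Fin (n + 1) → H) :
    Amp (List (Fin (n + 1))) (FockSpace H) →L[ℂ] Amp (List (Fin (n + 1))) (FockSpace H) :=
  rowOperator fun i => (((√(n + 1 : ℝ))⁻¹ : ℝ) : ℂ) • creation (e i)

/-- The normalised row of annihilation operators. -/
def annihilationRow (e : Fin (n + 1) → H) :
    Amp (List (Fin (n + 1))) (FockSpace H) →L[ℂ] Amp (List (Fin (n + 1))) (FockSpace H) :=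
  rowOperator fun i => (((√(n + 1 : ℝ))⁻¹ : ℝ) : ℂ) • star (creation (e i))

theorem inv_sqrt_mul_self (n : ℕ) :
    (((√(n + 1 : ℝ))⁻¹ : ℝ) : ℂ) * (((√(n + 1 : ℝ))⁻¹ : ℝ) : ℂ) = ((n + 1 : ℝ)⁻¹ : ℝ) := by
  rw [← Complex.ofReal_mul, ← mul_inv, Real.mul_self_sqrt (by positivity)]

theorem star_creationRow_mul_creationRow (he : Orthonormal ℂ e) :
    star (creationRow e) * creationRow e = 1 := by
  ext1 f
  refine ext_inner_left ℂ fun g => ?_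
  have h1 : ∑ i, star ((((√(n + 1 : ℝ))⁻¹ : ℝ) : ℂ) • creation (e i)) *
      ((((√(n + 1 : ℝ))⁻¹ : ℝ) : ℂ) • creation (e i)) = 1 := by
    have h2 : ∀ i, star ((((√(n + 1 : ℝ))⁻¹ : ℝ) : ℂ) • creation (e i)) *
      ((((√(n + 1 : ℝ))⁻¹ : ℝ) : ℂ) • creation (e i)) = (((n + 1 : ℝ)⁻¹ : ℝ) : ℂ) • 1 := by
      intro i
      rw [star_smul, smul_mul_smul_comm, star_creation_mul_creation, inner_self_eq_norm_sq_to_K,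
        he.1 i, Complex.star_def, Complex.conj_ofReal, inv_sqrt_mul_self]
      simp
    rw [Finset.sum_congr rfl fun i _ => h2 i, Finset.sum_const, Finset.card_univ, Fintype.card_fin,
      ← Nat.cast_smul_eq_nsmul ℂ, smul_smul]
    have : ((n + 1 : ℕ) : ℂ) * (((n + 1 : ℝ)⁻¹ : ℝ) : ℂ) = 1 := by
      push_cast
      exact mul_inv_cancel₀ (by exact_mod_cast Nat.succ_ne_zero n)
    rw [this, one_smul]
  have h3 : ⟪g, (star (creationRow e) * creationRow e) f⟫_ℂ =
      ⟪creationRow e g, creationRow e f⟫_ℂ :=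
    ContinuousLinearMap.adjoint_inner_right (creationRow e) g (creationRow e f)
  rw [h3, creationRow, inner_rowOperator, h1, ampl_one]

theorem norm_sum_creation_mul_star_le (he : Orthonormal ℂ e) :
    ‖∑ i, creation (e i) * star (creation (e i))‖ ≤ 1 := by
  set p := ∑ i, creation (e i) * star (creation (e i)) with hp
  have h1 : star p = p := by
    rw [hp, star_sum]
    exact Finset.sum_congr rfl fun i _ => by rw [star_mul, star_star]
  have h2 : p * p = p := by
    conv_lhs => rw [hp, Finset.sum_mul_sum]
    refine Finset.sum_congr rfl fun i _ => ?_
    rw [Finset.sum_eq_single i]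
    · rw [mul_assoc, ← mul_assoc (star (creation (e i))), star_creation_mul_creation,
        inner_self_eq_norm_sq_to_K, he.1 i]
      simp
    · intro k _ hk
      rw [mul_assoc, ← mul_assoc (star (creation (e i))), star_creation_mul_creation,
        he.2 (Ne.symm hk)]
      simp
    · intro h; exact absurd (Finset.mem_univ _) h
  have h3 : ‖p‖ * ‖p‖ = ‖p‖ := by
    rw [← CStarRing.norm_star_mul_self, h1, h2]
  nlinarith [norm_nonneg p]

/-- The sum of the ℓ(e_i)ℓ(e_i)* is a projection, whereas the ℓ(e_i)*ℓ(e_i) add up to n + 1. The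
factor 1/√(n+1) that makes the creation row isometric thus makes the annihilation row small. -/
theorem norm_annihilationRow_le (he : Orthonormal ℂ e) :
    ‖annihilationRow e‖ ≤ (√(n + 1 : ℝ))⁻¹ := by
  have h1 : ∑ i, star ((((√(n + 1 : ℝ))⁻¹ : ℝ) : ℂ) • star (creation (e i))) *
      ((((√(n + 1 : ℝ))⁻¹ : ℝ) : ℂ) • star (creation (e i))) =
        (((n + 1 : ℝ)⁻¹ : ℝ) : ℂ) • ∑ i, creation (e i) * star (creation (e i)) := by
    rw [Finset.smul_sum]
    refine Finset.sum_congr rfl fun i _ => ?_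
    rw [star_smul, smul_mul_smul_comm, star_star, Complex.star_def, Complex.conj_ofReal,
      inv_sqrt_mul_self]
  refine ContinuousLinearMap.opNorm_le_bound _ (by positivity) fun f => ?_
  refine le_of_sq_le_sq ?_ (by positivity)
  have h2 : ⟪annihilationRow e f, annihilationRow e f⟫_ℂ = (((n + 1 : ℝ)⁻¹ : ℝ) : ℂ) *
      ⟪f, ampl (List (Fin (n + 1))) (∑ i, creation (e i) * star (creation (e i))) f⟫_ℂ := by
    rw [annihilationRow, inner_rowOperator, h1, ampl_smul, smul_apply, inner_smul_right]
  have h3 : ‖annihilationRow e f‖ ^ 2 = (n + 1 : ℝ)⁻¹ *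
      ‖⟪f, ampl (List (Fin (n + 1))) (∑ i, creation (e i) * star (creation (e i))) f⟫_ℂ‖ := by
    have := congrArg norm h2
    rw [inner_self_eq_norm_sq_to_K, norm_mul, Complex.norm_real, Real.norm_eq_abs,
      abs_of_nonneg (by positivity : (0 : ℝ) ≤ (n + 1 : ℝ)⁻¹)] at this
    rw [← this]
    simp
  have h4 : ‖ampl (List (Fin (n + 1))) (∑ i, creation (e i) * star (creation (e i)))‖ ≤ 1 :=
    (lp.norm_mapCLM_le 2 _ (norm_nonneg _) fun _ => le_rfl).trans (norm_sum_creation_mul_star_le he)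
  have h5 := (norm_inner_le_norm (𝕜 := ℂ) f _).trans (mul_le_mul_of_nonneg_left
    (((ampl (List (Fin (n + 1))) (∑ i, creation (e i) * star (creation (e i)))).le_opNorm f).trans
      (mul_le_of_le_one_left (norm_nonneg _) h4)) (norm_nonneg f))
  rw [h3, mul_pow, inv_pow, Real.sq_sqrt (by positivity), sq ‖f‖]
  exact mul_le_mul_of_nonneg_left h5 (by positivity)

theorem star_creationRow_single_nil (e : Fin (n + 1) → H) (x : FockSpace H) :
    star (creationRow e) (lp.single 2 [] x) = 0 := by
  refine ext_inner_right ℂ fun f => ?_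
  have h : ⟪star (creationRow e) (lp.single 2 [] x), f⟫_ℂ =
      ⟪(lp.single 2 [] x : Amp (List (Fin (n + 1))) (FockSpace H)), creationRow e f⟫_ℂ :=
    ContinuousLinearMap.adjoint_inner_left _ _ _
  rw [h, lp.inner_single_left, creationRow, rowOperator_apply_nil, inner_zero_right, inner_zero_left]

end Grid

/-! ### Wick words as matrix entries of the grid operators -/

namespace OrthogonalGroup

open Complexification (re im ofReal conj)

variable {E : Type u} [NormedAddCommGroup E] [InnerProductSpace ℝ E] [CompleteSpace E]
  (U : OrthogonalGroup E)

/-- Splitting off the last letter mirrors the recursion of `gridOperator` in its second index, as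
the defining recursion of `wick` does for the first. -/
theorem wick_append_singleton (l : List (Complexification E)) (x : Complexification E) :
    U.wick (l ++ [x]) = U.wick l * star (creation (U.embeddingOperator (conj x))) +
      creationWord ((l ++ [x]).map U.embeddingOperator) := by
  induction l with
  | nil =>
    simp [wick_cons, annihilationWord, creationWord, add_comm]
  | cons y l ih =>
    rw [List.cons_append, wick_cons, ih, wick_cons]
    simp only [List.map_cons, List.map_append, List.map_nil, creationWord,
      annihilationWord, annihilationWord_append, mul_one]
    noncomm_ring

variable {n : ℕ} (ζ : Fin (n + 1) → E)

/-- The Wick word of the vectors `ζ_i`. -/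
def realWick (t : List (Fin (n + 1))) :
    FockSpace (Complexification E) →L[ℂ] FockSpace (Complexification E) :=
  U.wick (t.map fun i => ofReal (ζ i))

theorem realWick_cons (i : Fin (n + 1)) (t : List (Fin (n + 1))) :
    U.realWick ζ (i :: t) = creation (U.j (ζ i)) * U.realWick ζ t +
      annihilationWord ((i :: t).map fun i => U.j (ζ i)) := by
  rw [realWick, List.map_cons, wick_cons, ← List.map_cons (f := fun i => ofReal (ζ i)),
    List.map_map]
  simp only [Function.comp_def, Complexification.conj_ofReal]
  rfl

theorem realWick_append_singleton (t : List (Fin (n + 1))) (i : Fin (n + 1)) :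
    U.realWick ζ (t ++ [i]) = U.realWick ζ t * star (creation (U.j (ζ i))) +
      creationWord ((t ++ [i]).map fun i => U.j (ζ i)) := by
  rw [realWick, List.map_append, List.map_singleton, wick_append_singleton,
    Complexification.conj_ofReal, ← List.map_singleton (f := fun i => ofReal (ζ i)),
    ← List.map_append, List.map_map]
  rfl

/-- The grid operator for the rows of the vectors `j ζ_i`. -/
def wickGrid (k l : ℕ) :=
  gridOperator (creationRow fun i => U.j (ζ i)) (annihilationRow fun i => U.j (ζ i)) k l

/-- The three families of entries are treated together because they must share the scalar c and the
word t: only then do the two terms of the grid recursion combine into the Wick recursion. -/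
theorem exists_entry_wickGrid_zero (l : ℕ) (w w' : List (Fin (n + 1))) :
    ∃ (c : ℂ) (t : List (Fin (n + 1))), t.length = l ∧
      entry (star (creationRow fun i => U.j (ζ i)) ^ l) w w' =
        c • annihilationWord (t.map fun i => U.j (ζ i)) ∧
      entry (star (annihilationRow fun i => U.j (ζ i)) ^ l) w w' =
        c • creationWord (t.map fun i => U.j (ζ i)) ∧
      entry (U.wickGrid ζ 0 l) w w' = c • U.realWick ζ t := by
  induction l generalizing w' with
  | zero =>
    refine ⟨if w = w' then 1 else 0, [], rfl, ?_, ?_, ?_⟩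
    · rw [pow_zero, entry_one]; split_ifs <;> simp [annihilationWord]
    · rw [pow_zero, entry_one]; split_ifs <;> simp [creationWord]
    · rw [wickGrid, gridOperator, entry_one]; split_ifs <;> simp [realWick]
  | succ l ih =>
    cases w' with
    | nil =>
      -- The entries vanish here, so with c = 0 any word of the right length will do.
      refine ⟨0, List.replicate (l + 1) 0, List.length_replicate, ?_, ?_, ?_⟩
      · rw [pow_succ, creationRow, entry_mul_star_rowOperator_nil, zero_smul]
      · rw [pow_succ, annihilationRow, entry_mul_star_rowOperator_nil, zero_smul]
      · rw [wickGrid, gridOperator, entry_add, pow_succ, creationRow, annihilationRow,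
          entry_mul_star_rowOperator_nil, entry_mul_star_rowOperator_nil, zero_smul, add_zero]
    | cons i w' =>
      obtain ⟨c, t, ht, h1, h2, h3⟩ := ih w'
      set r : ℂ := (((√(n + 1 : ℝ))⁻¹ : ℝ) : ℂ) with hr
      have hstar : ∀ a : FockSpace (Complexification E) →L[ℂ] FockSpace (Complexification E),
          star (r • a) = r • star a := by
        intro a
        rw [star_smul, hr, Complex.star_def, Complex.conj_ofReal]
      have g1 : entry (star (annihilationRow fun i => U.j (ζ i)) ^ (l + 1)) w (i :: w') =
          (c * r) • creationWord ((t ++ [i]).map fun i => U.j (ζ i)) := by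
        rw [pow_succ]
        refine (entry_mul_star_rowOperator_cons _ _ i w w').trans ?_
        rw [h2, hstar, star_star, smul_mul_smul_comm, List.map_append, creationWord_append]
        simp [creationWord]
      refine ⟨c * r, t ++ [i], by simp [ht], ?_, g1, ?_⟩
      · rw [pow_succ]
        refine (entry_mul_star_rowOperator_cons _ _ i w w').trans ?_
        rw [h1, hstar, smul_mul_smul_comm, List.map_append, annihilationWord_append]
        simp [annihilationWord]
      · rw [wickGrid, gridOperator, entry_add, g1]
        have : entry (U.wickGrid ζ 0 l * star (creationRow fun i => U.j (ζ i))) w (i :: w') =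
            (c * r) • (U.realWick ζ t * star (creation (U.j (ζ i)))) := by
          refine (entry_mul_star_rowOperator_cons _ _ i w w').trans ?_
          rw [h3, hstar, smul_mul_smul_comm]
        rw [realWick_append_singleton, smul_add]
        exact congrArg (· + _) this

/-- Entries of G^k L*^l are multiples of annihilation words. With the same scalar and word they
supply the purely annihilating term of the Wick recursion when a letter is added on the left. -/
theorem exists_entry_wickGrid (k l : ℕ) (w w' : List (Fin (n + 1))) :
    ∃ (c : ℂ) (t : List (Fin (n + 1))), t.length = k + l ∧
      entry (annihilationRow (fun i => U.j (ζ i)) ^ k * star (creationRow fun i => U.j (ζ i)) ^ l)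
        w w' = c • annihilationWord (t.map fun i => U.j (ζ i)) ∧
      entry (U.wickGrid ζ k l) w w' = c • U.realWick ζ t := by
  induction k generalizing w with
  | zero =>
    obtain ⟨c, t, ht, h1, -, h3⟩ := U.exists_entry_wickGrid_zero ζ l w w'
    exact ⟨c, t, by simpa using ht, by rw [pow_zero, one_mul, h1], h3⟩
  | succ k ih =>
    cases w with
    | nil =>
      have g1 : entry (annihilationRow (fun i => U.j (ζ i)) ^ (k + 1) *
          star (creationRow fun i => U.j (ζ i)) ^ l) [] w' = 0 := by
        rw [pow_succ' (annihilationRow _), mul_assoc]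
        exact entry_rowOperator_mul_nil _ _ _
      refine ⟨0, List.replicate (k + 1 + l) 0, List.length_replicate, ?_, ?_⟩
      · rw [g1, zero_smul]
      · rw [wickGrid, gridOperator, entry_add, g1, zero_smul, add_zero]
        exact entry_rowOperator_mul_nil _ _ _
    | cons i w =>
      obtain ⟨c, t, ht, h1, h2⟩ := ih w
      set r : ℂ := (((√(n + 1 : ℝ))⁻¹ : ℝ) : ℂ) with hr
      have g1 : entry (annihilationRow (fun i => U.j (ζ i)) ^ (k + 1) *
          star (creationRow fun i => U.j (ζ i)) ^ l) (i :: w) w' =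
          (r * c) • annihilationWord ((i :: t).map fun i => U.j (ζ i)) := by
        rw [pow_succ' (annihilationRow _), mul_assoc]
        refine (entry_rowOperator_mul_cons _ _ i w w').trans ?_
        rw [h1, smul_mul_smul_comm]
        rfl
      refine ⟨r * c, i :: t, by rw [List.length_cons, ht]; omega, g1, ?_⟩
      rw [wickGrid, gridOperator, entry_add, g1, realWick_cons, smul_add]
      have : entry (creationRow (fun i => U.j (ζ i)) * U.wickGrid ζ k l) (i :: w) w' =
          (r * c) • (creation (U.j (ζ i)) * U.realWick ζ t) := by
        refine (entry_rowOperator_mul_cons _ _ i w w').trans ?_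
        rw [h2, smul_mul_smul_comm]
      exact congrArg (· + _) this

theorem entry_wickGrid_mem (k l : ℕ) (w w' : List (Fin (n + 1))) :
    entry (U.wickGrid ζ k l) w w' ∈ ArakiWoodsAlgebra U := by
  obtain ⟨c, t, -, -, h⟩ := U.exists_entry_wickGrid ζ k l w w'
  rw [h]
  exact SMulMemClass.smul_mem c (U.wick_mem _)

theorem truncation_entry_wickGrid {κ : Type u} (b : HilbertBasis κ ℂ (Complexification E)) (d : ℕ)
    (k l : ℕ) (w w' : List (Fin (n + 1))) :
    truncation b d (entry (U.wickGrid ζ k l) w w') =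
      (if k + l ≤ d then (1 : ℂ) else 0) • entry (U.wickGrid ζ k l) w w' := by
  obtain ⟨c, t, ht, -, h⟩ := U.exists_entry_wickGrid ζ k l w w'
  rw [h, map_smul, realWick, truncation_wick, List.length_map, ht]
  split_ifs <;> simp

/-- The test operator for the lower bound. -/
def wickGridSum (φ : ℕ → ℂ) (d : ℕ) :=
  gridSum (creationRow fun i => U.j (ζ i)) (annihilationRow fun i => U.j (ζ i)) φ d

theorem entry_wickGridSum (φ : ℕ → ℂ) (d : ℕ) (w w' : List (Fin (n + 1))) :
    entry (U.wickGridSum ζ φ d) w w' =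
      ∑ k ∈ Finset.range (d + 1), ∑ l ∈ Finset.range (d + 1), (hankelSign d k l : ℂ) •
        (φ (k + l) • entry (U.wickGrid ζ k l) w w' -
          φ (k + 1 + (l + 1)) • entry (U.wickGrid ζ (k + 1) (l + 1)) w w') := by
  rw [wickGridSum, gridSum, entry_sum]
  refine Finset.sum_congr rfl fun k _ => ?_
  rw [entry_sum]
  rfl

theorem entry_wickGridSum_mem (φ : ℕ → ℂ) (d : ℕ) (w w' : List (Fin (n + 1))) :
    entry (U.wickGridSum ζ φ d) w w' ∈ ArakiWoodsAlgebra U := by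
  rw [entry_wickGridSum]
  exact sum_mem fun k _ => sum_mem fun l _ => SMulMemClass.smul_mem _ (sub_mem
    (SMulMemClass.smul_mem _ (U.entry_wickGrid_mem ζ _ _ _ _))
    (SMulMemClass.smul_mem _ (U.entry_wickGrid_mem ζ _ _ _ _)))

theorem truncation_entry_wickGridSum {κ : Type u} (b : HilbertBasis κ ℂ (Complexification E))
    (d : ℕ) (w w' : List (Fin (n + 1))) :
    truncation b d (entry (U.wickGridSum ζ (fun _ => 1) d) w w') =
      entry (U.wickGridSum ζ (fun n => if n ≤ d then 1 else 0) d) w w' := by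
  rw [entry_wickGridSum, entry_wickGridSum, map_sum]
  refine Finset.sum_congr rfl fun k _ => ?_
  rw [map_sum]
  refine Finset.sum_congr rfl fun l _ => ?_
  rw [map_smul, one_smul, one_smul, map_sub, truncation_entry_wickGrid, truncation_entry_wickGrid]

end OrthogonalGroup

section CB

variable {F : Type u} [NormedAddCommGroup F] [InnerProductSpace ℂ F] [CompleteSpace F]

theorem norm_matrixOperator_le_of_cbNorm {A : StarSubalgebra ℂ (F →L[ℂ] F)} {Φ : A →L[ℂ] A}
    (hΦ : cbNorm Φ ≠ ∞) {n : ℕ} {X : Matrix (Fin n) (Fin n) A} {r : ℝ} (hr : 0 < r)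
    (hX : ‖matrixOperator (X.map fun x => (x : F →L[ℂ] F))‖ ≤ r) :
    ‖matrixOperator (X.map fun x => ((Φ x : A) : F →L[ℂ] F))‖ ≤ (cbNorm Φ).toReal * r := by
  set c : ℂ := ((r⁻¹ : ℝ) : ℂ) with hc
  have hcn : ‖c‖ = r⁻¹ := by
    rw [hc, Complex.norm_real, Real.norm_eq_abs, abs_of_pos (inv_pos.2 hr)]
  have h1 : (c • X).map (fun x => (x : F →L[ℂ] F)) = c • X.map fun x => (x : F →L[ℂ] F) := rfl
  have h2 : (c • X).map (fun x => ((Φ x : A) : F →L[ℂ] F)) =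
      c • X.map fun x => ((Φ x : A) : F →L[ℂ] F) := by
    ext1 i k
    show ((Φ (c • X i k) : A) : F →L[ℂ] F) = c • ((Φ (X i k) : A) : F →L[ℂ] F)
    rw [map_smul]; rfl
  have h3 : ‖matrixOperator ((c • X).map fun x => (x : F →L[ℂ] F))‖ ≤ 1 := by
    rw [h1, matrixOperator_smul, norm_smul, hcn, inv_mul_le_iff₀ hr, mul_one]
    exact hX
  have h4 : ‖matrixOperator ((c • X).map fun x => ((Φ x : A) : F →L[ℂ] F))‖ₑ ≤ cbNorm Φ :=
    le_iSup_of_le n (le_iSup_of_le (c • X) (le_iSup_of_le h3 le_rfl))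
  have h5 := ENNReal.toReal_mono hΦ h4
  rw [toReal_enorm, h2, matrixOperator_smul, norm_smul, hcn, inv_mul_le_iff₀ hr, mul_comm] at h5
  exact h5

end CB

/-! ### Evaluation of the completely bounded norm -/

namespace OrthogonalGroup

open Complexification (re im ofReal conj)

variable {E : Type u} [NormedAddCommGroup E] [InnerProductSpace ℝ E] [CompleteSpace E]
  (U : OrthogonalGroup E)

theorem j_add (x y : E) : U.j (x + y) = U.j x + U.j y := by
  rw [j, Complexification.ofReal_add, _root_.map_add]; rfl

theorem j_smul (c : ℝ) (x : E) : U.j (c • x) = (c : ℂ) • U.j x := by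
  rw [j, Complexification.ofReal_smul, map_smul]; rfl

theorem j_ne_zero {x : E} (hx : x ≠ 0) : U.j x ≠ 0 := by
  intro h
  have h0 : U.embeddingOperator (ofReal x) = U.embeddingOperator (ofReal 0) := by
    have h2 : U.j 0 = 0 := by simpa using U.j_smul 0 0
    exact h.trans h2.symm
  exact hx (Complexification.ofReal_injective (U.embeddingOperator_injective h0))

/-- The vectors must stay in K_ℝ although orthogonality is for the complex inner product. Being
orthogonal to finitely many vectors is a real-linear condition with values in a finite-dimensional
space, so it has a nonzero solution; `j` is injective, which permits normalization. -/
theorem exists_orthonormal_j (hE : ¬ FiniteDimensional ℝ E) :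
    ∃ ζ : ℕ → E, Orthonormal ℂ fun i => U.j (ζ i) := by
  have hsymm : Std.Symm fun x y : E => ⟪U.j x, U.j y⟫_ℂ = 0 :=
    ⟨fun x y h => inner_eq_zero_symm.1 h⟩
  obtain ⟨ζ, h1, h2⟩ := exists_seq_of_forall_finset_exists' (fun x : E => ‖U.j x‖ = 1)
    (fun x y => ⟪U.j x, U.j y⟫_ℂ = 0) (by
      intro s _
      let T : E →ₗ[ℝ] (s → ℂ) :=
        { toFun := fun y x => ⟪U.j x, U.j y⟫_ℂ
          map_add' := fun y z => by
            ext x; rw [j_add, inner_add_right]; rfl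
          map_smul' := fun c y => by
            ext x; rw [j_smul, inner_smul_right]; simp }
      have hT : ¬ Function.Injective T := fun h => hE (FiniteDimensional.of_injective T h)
      rw [injective_iff_map_eq_zero] at hT
      push Not at hT
      obtain ⟨y, hy, hy0⟩ := hT
      have hjy := norm_pos_iff.2 (U.j_ne_zero hy0)
      refine ⟨‖U.j y‖⁻¹ • y, ?_, fun x hx => ?_⟩
      · rw [j_smul, norm_smul, Complex.norm_real, norm_inv, norm_norm, inv_mul_cancel₀ hjy.ne']
      · have h : ⟪U.j x, U.j y⟫_ℂ = 0 := congrFun hy ⟨x, hx⟩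
        rw [j_smul, inner_smul_right, h, mul_zero])
  exact ⟨ζ, h1, fun i k hik => h2 hik⟩

theorem hankelNorm_sub_le (hE : ¬ FiniteDimensional ℝ E) {κ : Type u}
    (b : HilbertBasis κ ℂ (Complexification E)) (d : ℕ) {ε : ℝ} (hε : 0 < ε) (hε1 : ε ≤ 1) :
    hankelNorm d - 2 * gridConst d * ε ≤
      (cbNorm (U.wordProjection b d)).toReal * (1 + gridConst d * ε) := by
  obtain ⟨ζ, hζ⟩ := U.exists_orthonormal_j hE
  -- With this many vectors the norm bound 1/√(n+1) of the annihilation row is at most ε.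
  obtain ⟨n, hn⟩ := exists_nat_gt (1 / ε ^ 2)
  have hn' : (√(n + 1 : ℝ))⁻¹ ≤ ε := by
    rw [inv_le_comm₀ (by positivity) hε]
    refine Real.le_sqrt_of_sq_le ?_
    rw [inv_pow, ← one_div]
    linarith
  set η : Fin (n + 1) → E := fun i => ζ i with hη
  have he : Orthonormal ℂ fun i => U.j (η i) := hζ.comp _ Fin.val_injective
  have hL := star_creationRow_mul_creationRow he
  have hG := (norm_annihilationRow_le he).trans hn'
  -- The seed is the vacuum in the copy of the empty word: the creation row never reaches that copy,
  -- so its adjoint kills the seed.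
  obtain ⟨v, hv, hLv⟩ := exists_approx_eigenvector hL
    (δ := (lp.single 2 [] (vacuum (Complexification E)) : Amp (List (Fin (n + 1))) _))
    (by
      rw [lp.norm_single (by norm_num)]
      have := inner_vacuum_vacuum (H := Complexification E)
      rw [inner_self_eq_norm_sq_to_K] at this
      have h2 : ‖vacuum (Complexification E)‖ ^ 2 = 1 := by simpa using congrArg norm this
      exact (pow_eq_one_iff_of_nonneg (norm_nonneg _) two_ne_zero).1 h2)
    (star_creationRow_single_nil _ _) hε
  refine (hankelNorm_sub_le_norm_inner_gridSum hL hG hε1 hv hLv d).trans ?_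
  have hX := norm_gridSum_one_le hL hG hε1 d
  have hr : 0 < 1 + gridConst d * ε := by
    have := mul_nonneg (gridConst_nonneg d) hε.le
    linarith
  have hcb : cbNorm (U.wordProjection b d) ≠ ∞ :=
    ne_top_of_le_ne_top ENNReal.ofReal_ne_top (U.cbNorm_wordProjection_le b d)
  -- Every finite block of the test operator with φ = 1 has entries in the algebra and norm at most
  -- 1 + `gridConst d` * ε. The projection acts on the entries by inserting the weights φ, so the cb
  -- norm bounds the block of the weighted operator.
  have key := norm_inner_le_of_entries (T := U.wickGridSum η (fun n => if n ≤ d then 1 else 0) d)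
    (c := (cbNorm (U.wordProjection b d)).toReal * (1 + gridConst d * ε)) (fun N σ => by
      set X : Matrix (Fin N) (Fin N) (ArakiWoodsAlgebra U) := Matrix.of fun i k =>
        ⟨entry (U.wickGridSum η (fun _ => 1) d) (σ i) (σ k), U.entry_wickGridSum_mem η _ d _ _⟩ with hXdef
      have h1 := norm_matrixOperator_le_of_cbNorm hcb (X := X) hr
        ((norm_matrixOperator_entry_le σ (U.wickGridSum η (fun _ => 1) d)).trans hX)
      have h2 : (X.map fun x => ((U.wordProjection b d x : ArakiWoodsAlgebra U) :
          FockSpace (Complexification E) →L[ℂ] FockSpace (Complexification E))) =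
          Matrix.of fun i k => entry (U.wickGridSum η (fun n => if n ≤ d then 1 else 0) d)
            (σ i) (σ k) := by
        ext1 i k
        exact U.truncation_entry_wickGridSum η b d (σ i) (σ k)
      rwa [h2] at h1) v
  rw [hv, one_pow, mul_one] at key
  exact key

/-- The lower estimate holds for every small ε with a constant depending only on d, so letting ε
tend to 0 makes the two bounds meet. -/
theorem toReal_cbNorm_wordProjection (hE : ¬ FiniteDimensional ℝ E) {κ : Type u}
    (b : HilbertBasis κ ℂ (Complexification E)) (d : ℕ) :
    (cbNorm (U.wordProjection b d)).toReal = hankelNorm d := by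
  refine le_antisymm ?_ ?_
  · refine ENNReal.toReal_le_of_le_ofReal ?_ (U.cbNorm_wordProjection_le b d)
    exact Finset.sum_nonneg fun _ _ => abs_nonneg _
  · have h1 : Tendsto (fun ε : ℝ => hankelNorm d - 2 * gridConst d * ε)
        (nhdsWithin 0 (Set.Ioi 0)) (nhds (hankelNorm d - 2 * gridConst d * 0)) :=
      (Continuous.tendsto (by fun_prop) 0).mono_left nhdsWithin_le_nhds
    have h2 : Tendsto (fun ε : ℝ => (cbNorm (U.wordProjection b d)).toReal * (1 + gridConst d * ε))
        (nhdsWithin 0 (Set.Ioi 0))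
        (nhds ((cbNorm (U.wordProjection b d)).toReal * (1 + gridConst d * 0))) :=
      (Continuous.tendsto (by fun_prop) 0).mono_left nhdsWithin_le_nhds
    have h3 := le_of_tendsto_of_tendsto h1 h2 (by
      filter_upwards [Ioc_mem_nhdsGT zero_lt_one] with ε hε
      exact U.hankelNorm_sub_le hE b d hε.1 hε.2)
    simpa using h3

end OrthogonalGroup

end

end FreeArakiWoods

theorem mainTheorem12 {E : Type u} [NormedAddCommGroup E] [InnerProductSpace ℝ E]
    [CompleteSpace E] (hE : ¬ FiniteDimensional ℝ E) (U : FreeArakiWoods.OrthogonalGroup E) :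
    ∃ P : ℕ → (FreeArakiWoods.ArakiWoodsAlgebra U →L[ℂ] FreeArakiWoods.ArakiWoodsAlgebra U),
      (∀ (d : ℕ) (Φ : FreeArakiWoods.ArakiWoodsAlgebra U →L[ℂ] FreeArakiWoods.ArakiWoodsAlgebra U),
        FreeArakiWoods.IsWordProjection U d Φ ↔ Φ = P d) ∧
      (∀ d : ℕ, FreeArakiWoods.cbNorm (P d) < ∞) ∧
      (fun d : ℕ => (FreeArakiWoods.cbNorm (P d)).toReal)
        ~[atTop] (fun d : ℕ => 4 / Real.pi * (d : ℝ)) := by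
  obtain ⟨s, b, -⟩ := exists_hilbertBasis ℂ (FreeArakiWoods.Complexification E)
  refine ⟨U.wordProjection b, U.isWordProjection_iff b, fun d =>
    (U.cbNorm_wordProjection_le b d).trans_lt ENNReal.ofReal_lt_top, ?_⟩
  simp_rw [U.toReal_cbNorm_wordProjection hE b]
  exact FreeArakiWoods.hankelNorm_isEquivalent
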